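/- Let $1<p<\infty$ and let $X=(X,d,\mu)$ be a complete metric measure space, where $0<\mu(B)<\infty$ for every ball $B$, such that $\mu$ is doubling and $X$ supports a $p$-Poincaré inequality: there are $C\ge 0$ and $\sigma\ge 1$ such that for every ball $B=B(x,r)$, every $f\colon X\to\mathbb R$ that is integrable on balls and every upper gradient $g$ of $f$, $$\frac1{\mu(B)}\int_B|f-f_B|\,d\mu\le C r\Big(\frac1{\mu(B(x,\sigma r))}\int_{B(x,\sigma r)}g^p\,d\mu\Big)^{1/p},\qquad f_B=\frac1{\mu(B)}\int_B f\,d\mu .$$ Let $\Omega'\subset X$ be a domain (a nonempty, open, connected set), and let $u\in N^{1,p}_{\mathrm{loc}}(\Omega')$ be a nonconstant $p$-harmonic function in $\Omega'$. Let $g_u$ be (any representative of) its minimal $p$-weak upper gradient in $\Omega'$. Then for $\mu$-a.e. $x\in\{y\in\Omega':g_u(y)\neq0\}$ there exists a gradient curve of $u$ in $\Omega'$ that passes through $x$. Definitions. A Borel function $g\colon X\to[0,\infty]$ is an upper gradient of $f$ in an open set $\Omega\subset X$ if $|f(\gamma(0))-f(\gamma(\ell_\gamma))|\le\int_\gamma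 g\,ds$ for all nonconstant rectifiable curves $\gamma\colon[0,\ell_\gamma]\to\Omega$ parametrized by arc length. It is a $p$-weak upper gradient if this holds for all such $\gamma$ outside a family $\Gamma$ with $\operatorname{Mod}_p(\Gamma)=\inf\{\int_X\rho^p\,d\mu:\rho\colon X\to[0,\infty]\text{ Borel},\ \int_\gamma\rho\,ds\ge1\text{ for all }\gamma\in\Gamma\}=0$. The minimal $p$-weak upper gradient of $f$ is the $p$-weak upper gradient in $L^p_{\mathrm{loc}}(\Omega)$ that is $\mu$-a.e. in $\Omega$ at most any other $p$-weak upper gradient in $L^p_{\mathrm{loc}}(\Omega)$; it is unique up to null sets. The space $N^{1,p}(\Omega)$ consists of the $f\in L^p(\Omega)$ that have an upper gradient in $L^p(\Omega)$, and $f\in N^{1,p}_{\mathrm{loc}}(\Omega)$ if every point of $\Omega$ has a ball $B\subset\Omega$ with $f\in N^{1,p}(B)$. A function $u\colon\Omega'\to\mathbb R$ in $N^{1,p}_{\mathrm{loc}}(\Omega')$ is $p$-harmonic if it is continuous and $\int_{\varphi\neq0}g_u^p\,d\mu\le\int_{\varphi\neq0}g_{u+\varphi}^p\,d\mu$ for all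 Lipschitz functions $\varphi\colon\Omega'\to\mathbb R$ with compact support in $\Omega'$. A gradient curve of $u$ in $\Omega'$ is a nonconstant, simple (injective) rectifiable curve $\gamma\colon[0,\ell_\gamma]\to\Omega'$ parametrized by arc length such that $|u(\gamma(a))-u(\gamma(b))|=\int_a^b g_u(\gamma(t))\,dt$ for all $0\le a\le b\le\ell_\gamma$. -/

import Mathlib

open MeasureTheory Metric Set
open scoped ENNReal NNReal

namespace MetricPotential

section Curves

variable {X : Type*} [MetricSpace X]

/-- A rectifiable curve of length `len` in `X`, parametrized by arc length on `[0, len]`.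
`HasUnitSpeedOn` says that every subcurve over `[s, t]` has length `t - s`; in particular the curve
is continuous (even `1`-Lipschitz) on `[0, len]`. Only the values of `toFun` on `[0, len]` matter.
Constant curves are those with `len = 0`. -/
structure RectCurve (X : Type*) [MetricSpace X] where
  /-- the length of the curve -/
  len : ℝ
  len_nonneg : 0 ≤ len
  /-- the arc-length parametrization -/
  toFun : ℝ → X
  unitSpeed : HasUnitSpeedOn toFun (Icc 0 len)

/-- The image of a curve. -/
def RectCurve.trace (γ : RectCurve X) : Set X := γ.toFun '' Icc 0 γ.len

/-- The integral of `ρ` over the subcurve of `γ` with parameter interval `[a, b]`. -/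
noncomputable def RectCurve.integralOn (γ : RectCurve X) (ρ : X → ℝ≥0∞) (a b : ℝ) : ℝ≥0∞ :=
  ∫⁻ t in Icc a b, ρ (γ.toFun t)

/-- The curve integral `∫_γ ρ ds`. -/
noncomputable def RectCurve.integral (γ : RectCurve X) (ρ : X → ℝ≥0∞) : ℝ≥0∞ :=
  γ.integralOn ρ 0 γ.len

end Curves

section Spaces

variable {X : Type*} [MetricSpace X] [MeasurableSpace X]

/-- The upper gradient inequality for `f` and `g` on the curve `γ` (for the two endpoints). -/
def UpperGradientIneq (f : X → ℝ) (g : X → ℝ≥0∞) (γ : RectCurve X) : Prop :=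
  ENNReal.ofReal |f (γ.toFun 0) - f (γ.toFun γ.len)| ≤ γ.integral g

/-- `g` is an upper gradient of `f` in the set `Ω`: it is a Borel function to `[0, ∞]` and the upper
gradient inequality holds on every nonconstant rectifiable curve in `Ω`. -/
def IsUpperGradient (Ω : Set X) (f : X → ℝ) (g : X → ℝ≥0∞) : Prop :=
  Measurable g ∧ ∀ γ : RectCurve X, 0 < γ.len → γ.trace ⊆ Ω → UpperGradientIneq f g γ

/-- The `p`-modulus of a family of curves. (If all curves of the family lie in a Borel set `Ω`,
then integrating over `Ω` only would give the same number, since `ρ` may be set to `0` off `Ω`.) -/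
noncomputable def modulus (μ : Measure X) (p : ℝ) (Γ : Set (RectCurve X)) : ℝ≥0∞ :=
  ⨅ (ρ : X → ℝ≥0∞) (_ : Measurable ρ) (_ : ∀ γ ∈ Γ, 1 ≤ γ.integral ρ), ∫⁻ x, ρ x ^ p ∂μ

/-- `g` is a `p`-weak upper gradient of `f` in `Ω`: it is a Borel function to `[0, ∞]` and the upper
gradient inequality holds on all nonconstant rectifiable curves in `Ω` outside a family of
`p`-modulus zero. -/
def IsWeakUpperGradient (μ : Measure X) (p : ℝ) (Ω : Set X) (f : X → ℝ) (g : X → ℝ≥0∞) : Prop :=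
  Measurable g ∧ ∃ Γ : Set (RectCurve X), modulus μ p Γ = 0 ∧
    ∀ γ : RectCurve X, 0 < γ.len → γ.trace ⊆ Ω → γ ∉ Γ → UpperGradientIneq f g γ

/-- `g ∈ L^p_loc(Ω)`, for a Borel function `g` with values in `[0, ∞]`: every point of `Ω` has a ball
contained in `Ω` on which `g ^ p` is integrable. -/
def LocLp (μ : Measure X) (p : ℝ) (Ω : Set X) (g : X → ℝ≥0∞) : Prop :=
  ∀ x ∈ Ω, ∃ r : ℝ, 0 < r ∧ ball x r ⊆ Ω ∧ ∫⁻ y in ball x r, g y ^ p ∂μ < ∞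

/-- `g` is a minimal `p`-weak upper gradient `g_f` of `f` in `Ω`, i.e. the `μ`-a.e. smallest one in
`L^p_loc(Ω)`. It is determined up to sets of measure zero; `g` is any of its representatives.
(Competitors outside `L^p_loc(Ω)` have to be left out: a Borel function that has infinite integral
over every nonconstant curve is an upper gradient of everything, and so are its small multiples.) -/
def IsMinimalWeakUpperGradient (μ : Measure X) (p : ℝ) (Ω : Set X) (f : X → ℝ) (g : X → ℝ≥0∞) :
    Prop :=
  IsWeakUpperGradient μ p Ω f g ∧ LocLp μ p Ω g ∧
    ∀ h : X → ℝ≥0∞, IsWeakUpperGradient μ p Ω f h → LocLp μ p Ω h →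
      ∀ᵐ x ∂μ, x ∈ Ω → g x ≤ h x

/-- The (real-valued functions in the) Newtonian space `N^{1,p}(Ω)`: `f ∈ L^p(Ω)`, and `f` has an
upper gradient in `Ω` that belongs to `L^p(Ω)`. -/
def MemNewtonian (μ : Measure X) (p : ℝ) (Ω : Set X) (f : X → ℝ) : Prop :=
  MemLp f (ENNReal.ofReal p) (μ.restrict Ω) ∧
    ∃ g : X → ℝ≥0∞, IsUpperGradient Ω f g ∧ ∫⁻ x in Ω, g x ^ p ∂μ < ∞

/-- The local Newtonian space `N^{1,p}_loc(Ω)`. -/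
def MemNewtonianLoc (μ : Measure X) (p : ℝ) (Ω : Set X) (f : X → ℝ) : Prop :=
  ∀ x ∈ Ω, ∃ r : ℝ, 0 < r ∧ ball x r ⊆ Ω ∧ MemNewtonian μ p (ball x r) f

/-- `u` is `p`-harmonic in `Ω`: it is continuous, belongs to `N^{1,p}_loc(Ω)`, and
`∫_{φ ≠ 0} g_u ^ p dμ ≤ ∫_{φ ≠ 0} g_{u + φ} ^ p dμ` for all Lipschitz functions `φ` with compact
support in `Ω`. -/
def IsPHarmonic (μ : Measure X) (p : ℝ) (Ω : Set X) (u : X → ℝ) : Prop :=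
  ContinuousOn u Ω ∧ MemNewtonianLoc μ p Ω u ∧
    ∀ φ : X → ℝ, (∃ K : ℝ≥0, LipschitzWith K φ) → HasCompactSupport φ → tsupport φ ⊆ Ω →
      ∀ g h : X → ℝ≥0∞, IsMinimalWeakUpperGradient μ p Ω u g →
        IsMinimalWeakUpperGradient μ p Ω (fun x => u x + φ x) h →
          ∫⁻ x in {x | φ x ≠ 0}, g x ^ p ∂μ ≤ ∫⁻ x in {x | φ x ≠ 0}, h x ^ p ∂μ

/-- `γ` is a gradient curve in `Ω` of `u`, where `g` is the minimal `p`-weak upper gradient of `u`: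
a nonconstant simple rectifiable curve in `Ω` with `|u(x) - u(y)| = ∫_{γ|[x,y]} g ds` for all of its
subcurves `γ|[x,y]`. -/
def IsGradientCurve (Ω : Set X) (u : X → ℝ) (g : X → ℝ≥0∞) (γ : RectCurve X) : Prop :=
  0 < γ.len ∧ γ.trace ⊆ Ω ∧ InjOn γ.toFun (Icc 0 γ.len) ∧
    ∀ a b : ℝ, 0 ≤ a → a ≤ b → b ≤ γ.len →
      ENNReal.ofReal |u (γ.toFun a) - u (γ.toFun b)| = γ.integralOn g a b

/-- Every ball has positive and finite measure. -/
def BallsPosFinite (μ : Measure X) : Prop :=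
  ∀ (x : X) (r : ℝ), 0 < r → 0 < μ (ball x r) ∧ μ (ball x r) < ∞

/-- The measure is (globally) doubling. -/
def IsDoubling (μ : Measure X) : Prop :=
  ∃ C : ℝ≥0, ∀ (x : X) (r : ℝ), 0 < r → μ (ball x (2 * r)) ≤ C * μ (ball x r)

/-- The `p`-Poincaré inequality
`⨍_B |f - f_B| dμ ≤ C r (⨍_{σB} g ^ p dμ) ^ (1 / p)` for all balls `B` of radius `r`, all functions
`f` on `X` that are integrable on balls, and all upper gradients `g` of `f`. -/
def SupportsPoincare (μ : Measure X) (p : ℝ) : Prop :=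
  ∃ (C : ℝ≥0) (σ : ℝ), 1 ≤ σ ∧
    ∀ (f : X → ℝ) (g : X → ℝ≥0∞), (∀ (x : X) (r : ℝ), IntegrableOn f (ball x r) μ) →
      IsUpperGradient univ f g → ∀ (x : X) (r : ℝ), 0 < r →
        ⨍⁻ y in ball x r, ENNReal.ofReal |f y - ⨍ z in ball x r, f z ∂μ| ∂μ
          ≤ C * ENNReal.ofReal r * (⨍⁻ y in ball x (σ * r), g y ^ p ∂μ) ^ (1 / p)

end Spaces

end MetricPotential

/-! The claim is local, so fix a ball `U` inside a larger concentric closed ball `K ⊆ Ω`; `K` is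
compact because complete doubling spaces are proper. By Vitali–Carathéodory there is a lower
semicontinuous `H` in `L^p`, at least `1` on `K`, such that the upper gradient inequality for `u`
and `g` holds on all curves in `K` with `∫ H < ∞`, and such that on `K` the function `g` is
approximated from above by lower semicontinuous `G n` with errors at most `2⁻ⁿ H`. Among curves in
`K` with `∫ H ≤ L` lengths are bounded and `∫ g` is lower semicontinuous, so Arzelà–Ascoli applies
to those that start off `U` and satisfy `∫ g ≤ |u(start) - u(end)|`. Their endpoints form a closed
set `R_L` (`gradientReach`), and a shortest such curve ending at a given point of `U` is a gradient
curve (`LscApproximation.exists_isGradientCurve`). It remains to see that `g = 0` almost everywhere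
in `U` off the union of the `R_L`.

Let `E ⊆ U` be compact and disjoint from `R_L`. By compactness the upper gradient inequality has a
gap `δ > 0` on the curves with `∫ H ≤ L` that start off `U` and end in `E`
(`LscApproximation.exists_gap`). Let `C` bound the oscillation of `u` on `K`, and let `s + t = 1`
with `s` small in terms of `δ`. Then `g` can be lowered to `t g` on `E`, at the price of adding `(s
C / L) H`, so that the resulting `h` still dominates the increments of `u` on curves starting off
`U` (`increment_le_of_gap`). The truncated value function `v(y) = inf (u(start) + ∫ h)` over curves
from the complement of `U` to `y` agrees with `u` off `U` and has `h` as an upper gradient in `K`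
(`exists_value_function`). Minimality of the energy, in the norm of `L^p(K)` and up to errors `2⁻ⁿ
‖H‖`, gives `‖g‖ ≤ t ‖g‖ + s ‖1_{Eᶜ} g‖ + (s C / L) ‖H‖`. Here `s` cancels, although it depends on
`L` through `δ`. If `E` misses every `R_L`, then `L → ∞` yields `∫_E g ^ p = 0`.

The difference `v - u` is only a bounded Newtonian function, whereas `p`-harmonicity is tested with
Lipschitz functions. The Poincaré inequality bridges this: it makes `v - u` Lipschitz off a small
set where a maximal function is large (`exists_lipschitz_approximation`), which leads to
`IsPHarmonic.lintegral_le`. -/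

open Filter Topology

set_option linter.unusedSectionVars false

namespace MetricPotential

/-! ### Subcurves, reversal and concatenation of arc-length curves. -/

section CurveOperations

variable {X : Type*} [MetricSpace X]

theorem hasUnitSpeedOn_Icc_iff {f : ℝ → X} {a b : ℝ} :
    HasUnitSpeedOn f (Icc a b) ↔
      ∀ x y, a ≤ x → x ≤ y → y ≤ b → eVariationOn f (Icc x y) = ENNReal.ofReal (y - x) := by
  unfold HasUnitSpeedOn
  rw [hasConstantSpeedOnWith_iff_ordered]
  constructor
  · intro h x y hx hxy hy
    have := h ⟨hx, hxy.trans hy⟩ ⟨hx.trans hxy, hy⟩ hxy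
    rwa [Icc_inter_Icc, sup_of_le_right hx, inf_of_le_right hy, NNReal.coe_one, one_mul] at this
  · intro h x hx y hy hxy
    rw [Icc_inter_Icc, sup_of_le_right hx.1, inf_of_le_right hy.2, NNReal.coe_one, one_mul]
    exact h x y hx.1 hxy hy.2

namespace RectCurve

theorem lipschitzOnWith (γ : RectCurve X) : LipschitzOnWith 1 γ.toFun (Icc 0 γ.len) := by
  have key : ∀ s ∈ Icc 0 γ.len, ∀ t ∈ Icc 0 γ.len, s ≤ t →
      edist (γ.toFun s) (γ.toFun t) ≤ edist s t := by
    intro s hs t ht hst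
    have h := hasUnitSpeedOn_Icc_iff.1 γ.unitSpeed s t hs.1 hst ht.2
    refine (eVariationOn.edist_le γ.toFun (left_mem_Icc.2 hst) (right_mem_Icc.2 hst)).trans ?_
    rw [h, edist_comm, edist_dist, Real.dist_eq, abs_of_nonneg (sub_nonneg.2 hst)]
  intro s hs t ht
  rw [ENNReal.coe_one, one_mul]
  rcases le_total s t with h | h
  · exact key s hs t ht h
  · rw [edist_comm, edist_comm s]
    exact key t ht s hs h

theorem continuousOn (γ : RectCurve X) : ContinuousOn γ.toFun (Icc 0 γ.len) :=
  γ.lipschitzOnWith.continuousOn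

theorem isCompact_trace (γ : RectCurve X) : IsCompact γ.trace :=
  isCompact_Icc.image_of_continuousOn γ.continuousOn

theorem mem_trace (γ : RectCurve X) {t : ℝ} (h0 : 0 ≤ t) (h1 : t ≤ γ.len) : γ.toFun t ∈ γ.trace :=
  ⟨t, ⟨h0, h1⟩, rfl⟩

theorem zero_mem_trace (γ : RectCurve X) : γ.toFun 0 ∈ γ.trace := γ.mem_trace le_rfl γ.len_nonneg

theorem len_mem_trace (γ : RectCurve X) : γ.toFun γ.len ∈ γ.trace :=
  γ.mem_trace γ.len_nonneg le_rfl

theorem aemeasurable [MeasurableSpace X] [BorelSpace X] (γ : RectCurve X) {a b : ℝ} (ha : 0 ≤ a)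
    (hb : b ≤ γ.len) :
    AEMeasurable γ.toFun (volume.restrict (Icc a b)) :=
  (γ.continuousOn.mono (Icc_subset_Icc ha hb)).aemeasurable measurableSet_Icc

theorem aemeasurable_comp [MeasurableSpace X] [BorelSpace X] (γ : RectCurve X) {a b : ℝ}
    (ha : 0 ≤ a) (hb : b ≤ γ.len) {ρ : X → ℝ≥0∞} (hρ : Measurable ρ) :
    AEMeasurable (fun t => ρ (γ.toFun t)) (volume.restrict (Icc a b)) :=
  hρ.comp_aemeasurable (γ.aemeasurable ha hb)

theorem integralOn_mono (γ : RectCurve X) {ρ ρ' : X → ℝ≥0∞} {s : Set X} (hs : γ.trace ⊆ s)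
    (h : ∀ x ∈ s, ρ x ≤ ρ' x) {a b : ℝ} (ha : 0 ≤ a) (hb : b ≤ γ.len) :
    γ.integralOn ρ a b ≤ γ.integralOn ρ' a b :=
  setLIntegral_mono' measurableSet_Icc fun _ ht =>
    h _ (hs (γ.mem_trace (ha.trans ht.1) (ht.2.trans hb)))

theorem integral_mono (γ : RectCurve X) {ρ ρ' : X → ℝ≥0∞} {s : Set X} (hs : γ.trace ⊆ s)
    (h : ∀ x ∈ s, ρ x ≤ ρ' x) : γ.integral ρ ≤ γ.integral ρ' :=
  γ.integralOn_mono hs h le_rfl le_rfl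

theorem integral_mono' (γ : RectCurve X) {ρ ρ' : X → ℝ≥0∞} (h : ∀ x, ρ x ≤ ρ' x) :
    γ.integral ρ ≤ γ.integral ρ' :=
  γ.integral_mono (subset_univ _) fun x _ => h x

theorem integral_const_mul [MeasurableSpace X] [BorelSpace X] (γ : RectCurve X) (c : ℝ≥0∞)
    {ρ : X → ℝ≥0∞} (hρ : Measurable ρ) :
    γ.integral (fun x => c * ρ x) = c * γ.integral ρ :=
  lintegral_const_mul'' _ (γ.aemeasurable_comp le_rfl le_rfl hρ)

theorem integral_add [MeasurableSpace X] [BorelSpace X] (γ : RectCurve X)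
    {ρ ρ' : X → ℝ≥0∞} (hρ : Measurable ρ) :
    γ.integral (fun x => ρ x + ρ' x) = γ.integral ρ + γ.integral ρ' :=
  lintegral_add_left' (γ.aemeasurable_comp le_rfl le_rfl hρ) _

theorem integral_const (γ : RectCurve X) (c : ℝ≥0∞) :
    γ.integral (fun _ => c) = c * ENNReal.ofReal γ.len := by
  simp [integral, integralOn]

theorem integralOn_add (γ : RectCurve X) (ρ : X → ℝ≥0∞) {a b c : ℝ} (hab : a ≤ b) (hbc : b ≤ c) :
    γ.integralOn ρ a b + γ.integralOn ρ b c = γ.integralOn ρ a c := by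
  unfold integralOn
  rw [← setLIntegral_congr (Ioc_ae_eq_Icc (a := b) (b := c)),
    ← lintegral_union measurableSet_Ioc, Icc_union_Ioc_eq_Icc hab hbc]
  exact disjoint_left.2 fun x hx hx' => not_lt.2 hx.2 hx'.1

theorem integralOn_le_integral (γ : RectCurve X) (ρ : X → ℝ≥0∞) {a b : ℝ} (ha : 0 ≤ a)
    (hb : b ≤ γ.len) : γ.integralOn ρ a b ≤ γ.integral ρ :=
  lintegral_mono_set (Icc_subset_Icc ha hb)

/-- The subcurve with parameter interval `[a, b]`. -/
def sub (γ : RectCurve X) (a b : ℝ) (ha : 0 ≤ a) (hab : a ≤ b) (hb : b ≤ γ.len) : RectCurve X where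
  len := b - a
  len_nonneg := sub_nonneg.2 hab
  toFun t := γ.toFun (a + t)
  unitSpeed := by
    rw [hasUnitSpeedOn_Icc_iff]
    intro x y hx hxy hy
    have hm : MonotoneOn (fun t : ℝ => a + t) (Icc x y) := fun s _ t _ h => by
      simpa using h
    have h1 : eVariationOn (fun t => γ.toFun (a + t)) (Icc x y) =
        eVariationOn γ.toFun ((fun t : ℝ => a + t) '' Icc x y) :=
      eVariationOn.comp_eq_of_monotoneOn γ.toFun _ hm
    rw [h1, image_const_add_Icc,
      hasUnitSpeedOn_Icc_iff.1 γ.unitSpeed _ _ (by linarith) (by linarith) (by linarith)]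
    congr 1; ring

theorem sub_trace_subset (γ : RectCurve X) {a b : ℝ} (ha : 0 ≤ a) (hab : a ≤ b)
    (hb : b ≤ γ.len) : (γ.sub a b ha hab hb).trace ⊆ γ.trace := by
  rintro _ ⟨t, ht, rfl⟩
  have h1 : t ≤ b - a := ht.2
  exact γ.mem_trace (by linarith [ht.1]) (by linarith)

theorem sub_integral (γ : RectCurve X) {a b : ℝ} (ha : 0 ≤ a) (hab : a ≤ b)
    (hb : b ≤ γ.len) (ρ : X → ℝ≥0∞) : (γ.sub a b ha hab hb).integral ρ = γ.integralOn ρ a b := by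
  have h := lintegral_image_eq_lintegral_abs_deriv_mul (s := Icc 0 (b - a))
    (f := fun t : ℝ => a + t) (f' := fun _ => 1) measurableSet_Icc
    (fun x _ => ((hasDerivAt_id x).const_add a).hasDerivWithinAt)
    (add_right_injective a).injOn (fun t => ρ (γ.toFun t))
  rw [image_const_add_Icc] at h
  simp only [add_zero, add_sub_cancel, abs_one, ENNReal.ofReal_one, one_mul] at h
  exact h.symm

theorem sub_toFun_zero (γ : RectCurve X) {a b : ℝ} (ha : 0 ≤ a) (hab : a ≤ b)
    (hb : b ≤ γ.len) : (γ.sub a b ha hab hb).toFun 0 = γ.toFun a := by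
  simp [sub]

theorem sub_toFun_len (γ : RectCurve X) {a b : ℝ} (ha : 0 ≤ a) (hab : a ≤ b)
    (hb : b ≤ γ.len) :
    (γ.sub a b ha hab hb).toFun (γ.sub a b ha hab hb).len = γ.toFun b := by
  simp [sub]

/-- The curve run through backwards. -/
def reverse (γ : RectCurve X) : RectCurve X where
  len := γ.len
  len_nonneg := γ.len_nonneg
  toFun t := γ.toFun (γ.len - t)
  unitSpeed := by
    rw [hasUnitSpeedOn_Icc_iff]
    intro x y hx hxy hy
    have hm : AntitoneOn (fun t : ℝ => γ.len - t) (Icc x y) := fun s _ t _ h =>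
      sub_le_sub_left h _
    have h1 : eVariationOn (fun t => γ.toFun (γ.len - t)) (Icc x y) =
        eVariationOn γ.toFun ((fun t : ℝ => γ.len - t) '' Icc x y) :=
      eVariationOn.comp_eq_of_antitoneOn γ.toFun _ hm
    rw [h1, image_const_sub_Icc,
      hasUnitSpeedOn_Icc_iff.1 γ.unitSpeed _ _ (by linarith) (by linarith) (by linarith)]
    congr 1; ring

theorem reverse_trace (γ : RectCurve X) : γ.reverse.trace ⊆ γ.trace := by
  rintro _ ⟨t, ht, rfl⟩
  have h1 : t ≤ γ.len := ht.2
  exact γ.mem_trace (by linarith [ht.1]) (by linarith [ht.1])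

theorem reverse_integral (γ : RectCurve X) (ρ : X → ℝ≥0∞) :
    γ.reverse.integral ρ = γ.integral ρ := by
  have h := lintegral_image_eq_lintegral_abs_deriv_mul (s := Icc 0 γ.len)
    (f := fun t : ℝ => γ.len - t) (f' := fun _ => -1) measurableSet_Icc
    (fun x _ => ((hasDerivAt_id x).const_sub γ.len).hasDerivWithinAt)
    (sub_right_injective).injOn (fun t => ρ (γ.toFun t))
  rw [image_const_sub_Icc] at h
  simp only [sub_self, sub_zero, abs_neg, abs_one, ENNReal.ofReal_one, one_mul] at h
  exact h.symm

theorem reverse_toFun_zero (γ : RectCurve X) : γ.reverse.toFun 0 = γ.toFun γ.len := by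
  simp [reverse]

theorem reverse_toFun_len (γ : RectCurve X) : γ.reverse.toFun γ.reverse.len = γ.toFun 0 := by
  simp [reverse]

/-- The constant curve. -/
def const (x : X) : RectCurve X where
  len := 0
  len_nonneg := le_rfl
  toFun _ := x
  unitSpeed := hasConstantSpeedOnWith_of_subsingleton _ (by simp) _

theorem const_trace (x : X) : (const x).trace = {x} := by
  simp [trace, const]

theorem const_integral (x : X) (ρ : X → ℝ≥0∞) : (const x).integral ρ = 0 := by
  simp [integral, integralOn, const]

/-- Serves to cut loops out of curves and to prove the triangle inequality for the value function.
-/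
theorem exists_concat (γ γ' : RectCurve X) (h : γ.toFun γ.len = γ'.toFun 0) :
    ∃ γ'' : RectCurve X, γ''.len = γ.len + γ'.len ∧ γ''.toFun 0 = γ.toFun 0 ∧
      γ''.toFun γ''.len = γ'.toFun γ'.len ∧ γ''.trace ⊆ γ.trace ∪ γ'.trace ∧
      ∀ ρ : X → ℝ≥0∞, γ''.integral ρ = γ.integral ρ + γ'.integral ρ := by
  have l1 := γ.len_nonneg
  have l2 := γ'.len_nonneg
  set f : ℝ → X := fun t => if t ≤ γ.len then γ.toFun t else γ'.toFun (t - γ.len) with hf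
  have f1 : EqOn f γ.toFun (Icc 0 γ.len) := fun t ht => by simp [hf, ht.2]
  have f2 : EqOn f (fun t => γ'.toFun (t - γ.len)) (Icc γ.len (γ.len + γ'.len)) := fun t ht => by
    by_cases h1 : t ≤ γ.len
    · have : t = γ.len := le_antisymm h1 ht.1
      simp [hf, this, h]
    · simp [hf, h1]
  have u1 : HasUnitSpeedOn f (Icc 0 γ.len) := by
    rw [hasUnitSpeedOn_Icc_iff]
    intro x y hx hxy hy
    rw [eVariationOn.eq_of_eqOn (f1.mono (Icc_subset_Icc hx hy))]
    exact hasUnitSpeedOn_Icc_iff.1 γ.unitSpeed x y hx hxy hy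
  have u2 : HasUnitSpeedOn f (Icc γ.len (γ.len + γ'.len)) := by
    rw [hasUnitSpeedOn_Icc_iff]
    intro x y hx hxy hy
    rw [eVariationOn.eq_of_eqOn (f2.mono (Icc_subset_Icc hx hy))]
    have hm : MonotoneOn (fun t : ℝ => t - γ.len) (Icc x y) := fun s _ t _ h => by
      simpa using h
    have h1 : eVariationOn (fun t => γ'.toFun (t - γ.len)) (Icc x y) =
        eVariationOn γ'.toFun ((fun t : ℝ => t - γ.len) '' Icc x y) :=
      eVariationOn.comp_eq_of_monotoneOn γ'.toFun _ hm
    rw [h1, image_sub_const_Icc,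
      hasUnitSpeedOn_Icc_iff.1 γ'.unitSpeed _ _ (by linarith) (by linarith) (by linarith)]
    congr 1; ring
  let γ'' : RectCurve X := ⟨γ.len + γ'.len, by linarith, f, u1.Icc_Icc u2⟩
  refine ⟨γ'', rfl, f1 ⟨le_rfl, l1⟩, ?_, ?_, ?_⟩
  · have := f2 (x := γ.len + γ'.len) ⟨by linarith, le_rfl⟩
    simpa using this
  · rintro _ ⟨t, ht, rfl⟩
    have h2 : t ≤ γ.len + γ'.len := ht.2
    rcases le_total t γ.len with h1 | h1
    · left
      exact ⟨t, ⟨ht.1, h1⟩, (f1 ⟨ht.1, h1⟩).symm⟩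
    · right
      exact ⟨t - γ.len, ⟨by linarith, by linarith⟩, (f2 ⟨h1, h2⟩).symm⟩
  · intro ρ
    have e : γ''.integral ρ = γ''.integralOn ρ 0 γ.len +
        γ''.integralOn ρ γ.len (γ.len + γ'.len) :=
      (γ''.integralOn_add ρ l1 (by linarith)).symm
    rw [e]
    congr 1
    · exact setLIntegral_congr_fun measurableSet_Icc fun t ht => by
        show ρ (f t) = _
        rw [f1 ht]
    · have h := lintegral_image_eq_lintegral_abs_deriv_mul (s := Icc γ.len (γ.len + γ'.len))
        (f := fun t : ℝ => t - γ.len) (f' := fun _ => 1) measurableSet_Icc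
        (fun x _ => ((hasDerivAt_id x).sub_const γ.len).hasDerivWithinAt)
        (sub_left_injective).injOn (fun t => ρ (γ'.toFun t))
      rw [image_sub_const_Icc] at h
      simp only [sub_self, add_sub_cancel_left, abs_one, ENNReal.ofReal_one, one_mul] at h
      refine Eq.trans ?_ h.symm
      exact setLIntegral_congr_fun measurableSet_Icc fun t ht => by
        show ρ (f t) = _
        rw [f2 ht]

end RectCurve

end CurveOperations

/-! ### Arc-length reparametrization and compactness of families of curves. -/

section Limits

variable {X : Type*} [MetricSpace X]

/-- Lebesgue measure does not grow by more than the Lipschitz constant. -/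
theorem volume_image_le_of_lipschitzOnWith {f : ℝ → ℝ} {C : ℝ≥0} {s : Set ℝ}
    (hf : LipschitzOnWith C f s) : volume (f '' s) ≤ C * volume s := by
  have h := hf.hausdorffMeasure_image_le (d := 1) zero_le_one
  rwa [hausdorffMeasure_real, ENNReal.rpow_one] at h

namespace RectCurve

/-- A Lipschitz map of an interval can be parametrized by arc length. -/
theorem exists_of_lipschitzOnWith [MeasurableSpace X] [BorelSpace X] {c : ℝ → X} {C : ℝ≥0}
    (hc : LipschitzOnWith C c (Icc 0 1)) :
    ∃ γ : RectCurve X, γ.toFun 0 = c 0 ∧ γ.toFun γ.len = c 1 ∧ γ.trace ⊆ c '' Icc 0 1 ∧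
      γ.len ≤ C ∧ ∀ ρ : X → ℝ≥0∞,
        γ.integral ρ ≤ C * ∫⁻ t in Icc (0 : ℝ) 1, ρ (c t) := by
  set I : Set ℝ := Icc 0 1 with hI
  have h0 : (0 : ℝ) ∈ I := ⟨le_rfl, zero_le_one⟩
  have h1 : (1 : ℝ) ∈ I := ⟨zero_le_one, le_rfl⟩
  have var_le : ∀ x ∈ I, ∀ y ∈ I, x ≤ y →
      eVariationOn c (I ∩ Icc x y) ≤ C * ENNReal.ofReal (y - x) := by
    intro x hx y hy hxy
    have hm : MonotoneOn (id : ℝ → ℝ) I := monotoneOn_id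
    have h2 := (hm.eVariationOn_eq hx hy).le
    have h3 := hc.comp_eVariationOn_le (g := (id : ℝ → ℝ)) (s := I ∩ Icc x y)
      (fun t ht => ht.1)
    exact h3.trans (mul_le_mul_right h2 _)
  have lbv : LocallyBoundedVariationOn c I := by
    intro x y hx hy
    rcases le_total x y with h | h
    · exact ((var_le x hx y hy h).trans_lt (ENNReal.mul_lt_top ENNReal.coe_lt_top
        ENNReal.ofReal_lt_top)).ne
    · have h4 : I ∩ Icc x y ⊆ I ∩ Icc y y ∪ I ∩ Icc x x := by
        rintro t ⟨ht, ht'⟩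
        have : t = y := le_antisymm ht'.2 (h.trans ht'.1)
        exact Or.inl ⟨ht, this.ge, this.le⟩
      have h5 : (I ∩ Icc x y).Subsingleton := by
        rintro s ⟨_, hs⟩ t ⟨_, ht⟩
        linarith [hs.1, hs.2, ht.1, ht.2]
      rw [BoundedVariationOn, eVariationOn.subsingleton c h5]
      exact ENNReal.zero_ne_top
  -- `V` is the arc length from the initial point. It is `C`-Lipschitz, maps onto `[0, V 1]`, and `c
  -- = N ∘ V` for the unit-speed parametrization `N`.
  set V : ℝ → ℝ := variationOnFromTo c I 0 with hV
  have V0 : V 0 = 0 := variationOnFromTo.self c I 0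
  have Vmono : MonotoneOn V I := variationOnFromTo.monotoneOn lbv h0
  have Vsub : ∀ x ∈ I, ∀ y ∈ I, x ≤ y → V y - V x ≤ C * (y - x) := by
    intro x hx y hy hxy
    have h2 := variationOnFromTo.add lbv h0 hx hy
    have h3 : V y - V x = variationOnFromTo c I x y := by rw [hV, ← h2]; ring
    rw [h3, variationOnFromTo.eq_of_le c I hxy]
    refine ENNReal.toReal_le_of_le_ofReal (mul_nonneg C.2 (sub_nonneg.2 hxy)) ?_
    rw [ENNReal.ofReal_mul C.coe_nonneg, ENNReal.ofReal_coe_nnreal]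
    exact var_le x hx y hy hxy
  have Vlip : LipschitzOnWith C V I := by
    refine LipschitzOnWith.of_le_add_mul C fun x hx y hy => ?_
    rcases le_total x y with h | h
    · have := Vmono hx hy h
      have h2 : 0 ≤ C * dist x y := mul_nonneg C.2 dist_nonneg
      linarith
    · have := Vsub y hy x hx h
      rw [Real.dist_eq, abs_of_nonneg (sub_nonneg.2 h)]
      linarith
  have Vimage : V '' I = Icc 0 (V 1) := by
    apply Subset.antisymm
    · rintro _ ⟨t, ht, rfl⟩
      exact ⟨V0 ▸ Vmono h0 ht ht.1, Vmono ht h1 ht.2⟩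
    · have := intermediate_value_Icc zero_le_one Vlip.continuousOn
      rwa [V0] at this
  have V1 : 0 ≤ V 1 := V0 ▸ Vmono h0 h1 zero_le_one
  set N := naturalParameterization c I 0 with hN
  have NV : ∀ t ∈ I, N (V t) = c t := fun t ht =>
    edist_eq_zero.1 (edist_naturalParameterization_eq_zero lbv h0 ht)
  have us := has_unit_speed_naturalParameterization c lbv h0
  rw [← hV, ← hN, Vimage] at us
  refine ⟨⟨V 1, V1, N, us⟩, ?_, NV 1 h1, ?_, ?_, ?_⟩
  · have := NV 0 h0
    rwa [V0] at this
  · rintro _ ⟨s, hs, rfl⟩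
    change s ∈ Icc 0 (V 1) at hs
    rw [← Vimage] at hs
    obtain ⟨t, ht, rfl⟩ := hs
    exact ⟨t, ht, (NV t ht).symm⟩
  · have := Vsub 0 h0 1 h1 zero_le_one
    rw [V0] at this
    simpa using this
  · intro ρ
    change ∫⁻ s in Icc 0 (V 1), ρ (N s) ≤ _
    have Vae : AEMeasurable V (volume.restrict I) :=
      Vlip.continuousOn.aemeasurable measurableSet_Icc
    -- `V` enlarges Lebesgue measure by at most the factor `C`. This comparison replaces a change of
    -- variables and needs no measurability of `ρ`.
    have hle : volume.restrict (Icc 0 (V 1)) ≤ (C : ℝ≥0∞) • Measure.map V (volume.restrict I) := by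
      rw [Measure.le_iff]
      intro B hB
      rw [Measure.restrict_apply hB, Measure.smul_apply, smul_eq_mul,
        Measure.map_apply_of_aemeasurable Vae hB, Measure.restrict_apply' measurableSet_Icc]
      refine le_trans (measure_mono ?_)
        (volume_image_le_of_lipschitzOnWith (Vlip.mono (inter_subset_right : V ⁻¹' B ∩ I ⊆ I)))
      rintro s ⟨hsB, hs⟩
      rw [← Vimage] at hs
      obtain ⟨t, ht, rfl⟩ := hs
      exact ⟨t, ⟨hsB, ht⟩, rfl⟩
    calc ∫⁻ s in Icc 0 (V 1), ρ (N s)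
        ≤ ∫⁻ s, ρ (N s) ∂((C : ℝ≥0∞) • Measure.map V (volume.restrict I)) :=
          lintegral_mono' hle le_rfl
      _ = C * ∫⁻ s, ρ (N s) ∂(Measure.map V (volume.restrict I)) := lintegral_smul_measure _ _
      _ ≤ C * ∫⁻ t in I, ρ (N (V t)) := mul_le_mul_right (lintegral_map_le _ _) _
      _ = C * ∫⁻ t in I, ρ (c t) := by
          congr 1
          exact setLIntegral_congr_fun measurableSet_Icc fun t ht => by
            show ρ (N (V t)) = _
            rw [NV t ht]

theorem integral_eq_smul (γ : RectCurve X) (ρ : X → ℝ≥0∞) :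
    γ.integral ρ = ENNReal.ofReal γ.len * ∫⁻ t in Icc (0 : ℝ) 1, ρ (γ.toFun (γ.len * t)) := by
  rcases γ.len_nonneg.eq_or_lt with h0 | h0
  · simp [integral, integralOn, ← h0]
  · have h := lintegral_image_eq_lintegral_abs_deriv_mul (s := Icc (0 : ℝ) 1)
      (f := fun t : ℝ => γ.len * t) (f' := fun _ => γ.len) measurableSet_Icc
      (fun x _ => by simpa using ((hasDerivAt_id x).const_mul γ.len).hasDerivWithinAt)
      (mul_right_injective₀ h0.ne').injOn (fun t => ρ (γ.toFun t))
    have h2 : (fun t : ℝ => γ.len * t) '' Icc 0 1 = Icc 0 γ.len := by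
      have := image_mul_left_Icc' h0 0 1
      simpa using this
    rw [h2, lintegral_const_mul' _ _ ENNReal.ofReal_ne_top, abs_of_pos h0] at h
    exact h

/-- A sequence of curves of bounded length in a compact set subconverges to a curve; the length
and all the integrals of lower semicontinuous functions are lower semicontinuous. -/
theorem exists_subseq_limit [MeasurableSpace X] [BorelSpace X] {K : Set X} (hK : IsCompact K)
    {L : ℝ} (γ : ℕ → RectCurve X) (hγK : ∀ i, (γ i).trace ⊆ K) (hL : ∀ i, (γ i).len ≤ L) :
    ∃ (φ : ℕ → ℕ) (γ' : RectCurve X) (l : ℝ), StrictMono φ ∧ γ'.trace ⊆ K ∧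
      Tendsto (fun i => (γ (φ i)).toFun 0) atTop (𝓝 (γ'.toFun 0)) ∧
      Tendsto (fun i => (γ (φ i)).toFun (γ (φ i)).len) atTop (𝓝 (γ'.toFun γ'.len)) ∧
      Tendsto (fun i => (γ (φ i)).len) atTop (𝓝 l) ∧ γ'.len ≤ l ∧
      ∀ ρ : X → ℝ≥0∞, LowerSemicontinuous ρ →
        γ'.integral ρ ≤ liminf (fun i => (γ (φ i)).integral ρ) atTop := by
  have L0 : 0 ≤ L := (γ 0).len_nonneg.trans (hL 0)
  have cdist : ∀ (i : ℕ) (s t : ℝ), s ∈ Icc (0 : ℝ) 1 → t ∈ Icc (0 : ℝ) 1 →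
      dist ((γ i).toFun ((γ i).len * s)) ((γ i).toFun ((γ i).len * t)) ≤
        (γ i).len * dist s t := by
    intro i s t hs ht
    have l0 := (γ i).len_nonneg
    have m : ∀ r ∈ Icc (0 : ℝ) 1, (γ i).len * r ∈ Icc 0 (γ i).len := fun r hr =>
      ⟨mul_nonneg l0 hr.1, mul_le_of_le_one_right l0 hr.2⟩
    have h := (γ i).lipschitzOnWith.dist_le_mul _ (m s hs) _ (m t ht)
    rw [NNReal.coe_one, one_mul, Real.dist_eq, ← mul_sub, abs_mul, abs_of_nonneg l0] at h
    exact h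
  have clip : ∀ i, LipschitzWith (Real.toNNReal L)
      (fun t : Icc (0 : ℝ) 1 => (γ i).toFun ((γ i).len * t)) := by
    intro i
    refine LipschitzWith.of_dist_le_mul fun s t => (cdist i s t s.2 t.2).trans ?_
    rw [Real.coe_toNNReal _ L0]
    exact mul_le_mul_of_nonneg_right (hL i) dist_nonneg
  -- Constant-speed parametrizations put all the curves on one interval with the common Lipschitz
  -- constant `L`, as Arzelà–Ascoli requires.
  let c : ℕ → BoundedContinuousFunction (Icc (0 : ℝ) 1) X := fun i =>
    BoundedContinuousFunction.mkOfCompact ⟨_, (clip i).continuous⟩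
  have ceval : ∀ i t, c i t = (γ i).toFun ((γ i).len * t) := fun i t => rfl
  have cK : ∀ i t, c i t ∈ K := fun i t => hγK i ((γ i).mem_trace
    (mul_nonneg (γ i).len_nonneg t.2.1) (mul_le_of_le_one_right (γ i).len_nonneg t.2.2))
  have hcomp : IsCompact (closure (range c)) := by
    refine BoundedContinuousFunction.arzela_ascoli K hK (range c) ?_ ?_
    · rintro _ t ⟨i, rfl⟩
      exact cK i t
    · refine (LipschitzWith.uniformEquicontinuous (fun f : range c => ⇑(f : BoundedContinuousFunction (Icc (0 : ℝ) 1) X))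
        (Real.toNNReal L) ?_).equicontinuous
      rintro ⟨_, i, rfl⟩
      exact clip i
  -- The lengths converge along the same subsequence. Their limit `l` is a Lipschitz constant of the
  -- limit map, but may exceed its length.
  have hcomp2 := hcomp.prod (isCompact_Icc (a := (0 : ℝ)) (b := L))
  obtain ⟨⟨d, l⟩, ⟨-, hl⟩, φ, hφ, hlim⟩ := hcomp2.tendsto_subseq
    (x := fun i => (c i, (γ i).len))
    (fun i => ⟨subset_closure ⟨i, rfl⟩, (γ i).len_nonneg, hL i⟩)
  have hlimc : Tendsto (fun i => c (φ i)) atTop (𝓝 d) :=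
    (continuous_fst.tendsto _).comp hlim
  have hliml : Tendsto (fun i => (γ (φ i)).len) atTop (𝓝 l) :=
    (continuous_snd.tendsto _).comp hlim
  have hpt : ∀ t, Tendsto (fun i => c (φ i) t) atTop (𝓝 (d t)) := fun t =>
    ((continuous_eval_const t).tendsto d).comp hlimc
  have dK : ∀ t, d t ∈ K := fun t =>
    hK.isClosed.mem_of_tendsto (hpt t) (Eventually.of_forall fun i => cK _ t)
  let e : ℝ → X := fun t => d (projIcc 0 1 zero_le_one t)
  have e_eq : ∀ t (ht : t ∈ Icc (0 : ℝ) 1), e t = d ⟨t, ht⟩ := fun t ht => by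
    simp only [e, projIcc_of_mem _ ht]
  have elip : LipschitzOnWith (Real.toNNReal l) e (Icc 0 1) := by
    refine LipschitzOnWith.of_dist_le_mul fun s hs t ht => ?_
    rw [e_eq s hs, e_eq t ht, Real.coe_toNNReal _ hl.1]
    refine le_of_tendsto_of_tendsto' ((hpt ⟨s, hs⟩).dist (hpt ⟨t, ht⟩))
      (hliml.mul_const _) fun i => ?_
    exact cdist (φ i) s t hs ht
  obtain ⟨γ', hs, ht, htr, hlen, hint⟩ := exists_of_lipschitzOnWith elip
  have m0 : (0 : ℝ) ∈ Icc (0 : ℝ) 1 := ⟨le_rfl, zero_le_one⟩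
  have m1 : (1 : ℝ) ∈ Icc (0 : ℝ) 1 := ⟨zero_le_one, le_rfl⟩
  refine ⟨φ, γ', l, hφ, ?_, ?_, ?_, hliml, ?_, ?_⟩
  · intro x hx
    obtain ⟨t, ht, rfl⟩ := htr hx
    rw [e_eq t ht]; exact dK _
  · rw [hs, e_eq 0 m0]
    have := hpt ⟨0, m0⟩
    simpa [ceval] using this
  · rw [ht, e_eq 1 m1]
    have := hpt ⟨1, m1⟩
    simpa [ceval] using this
  · rwa [Real.coe_toNNReal _ hl.1] at hlen
  · intro ρ hρ
    set F : ℕ → ℝ → ℝ≥0∞ := fun i t => ρ ((γ (φ i)).toFun ((γ (φ i)).len * t)) with hF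
    have hFm : ∀ i, AEMeasurable (F i) (volume.restrict (Icc (0 : ℝ) 1)) := by
      intro i
      have h1 : ContinuousOn (fun t : ℝ => (γ (φ i)).toFun ((γ (φ i)).len * t)) (Icc 0 1) := by
        rw [continuousOn_iff_continuous_domRestrict]
        exact (clip (φ i)).continuous
      exact hρ.measurable.comp_aemeasurable (h1.aemeasurable measurableSet_Icc)
    have hpw : ∀ t ∈ Icc (0 : ℝ) 1, ρ (e t) ≤ liminf (fun i => F i t) atTop := by
      intro t ht
      rw [e_eq t ht]
      refine le_of_forall_lt fun y hy => ?_
      obtain ⟨z, hyz, hz⟩ := exists_between hy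
      refine lt_of_lt_of_le hyz (le_liminf_of_le (by isBoundedDefault) ?_)
      have := (hpt ⟨t, ht⟩).eventually (hρ (d ⟨t, ht⟩) z hz)
      exact this.mono fun i hi => hi.le
    have hfatou : ∫⁻ t in Icc (0 : ℝ) 1, ρ (e t) ≤
        liminf (fun i => ∫⁻ t in Icc (0 : ℝ) 1, F i t) atTop :=
      (setLIntegral_mono' measurableSet_Icc hpw).trans (lintegral_liminf_le' hFm)
    have hlimL : Tendsto (fun i => ENNReal.ofReal (γ (φ i)).len) atTop (𝓝 (ENNReal.ofReal l)) :=
      (ENNReal.continuous_ofReal.tendsto l).comp hliml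
    calc γ'.integral ρ ≤ ENNReal.ofReal l * ∫⁻ t in Icc (0 : ℝ) 1, ρ (e t) := hint ρ
      _ ≤ liminf (fun i => ENNReal.ofReal (γ (φ i)).len) atTop *
          liminf (fun i => ∫⁻ t in Icc (0 : ℝ) 1, F i t) atTop := by
          rw [hlimL.liminf_eq]; gcongr
      _ ≤ liminf ((fun i => ENNReal.ofReal (γ (φ i)).len) *
          fun i => ∫⁻ t in Icc (0 : ℝ) 1, F i t) atTop := ENNReal.le_liminf_mul
      _ = liminf (fun i => (γ (φ i)).integral ρ) atTop := by
          congr 1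
          funext i
          exact ((γ (φ i)).integral_eq_smul ρ).symm

end RectCurve

end Limits

/-! ### Absolutely continuous functions on an interval. -/

section RealLine

variable {F F₁ F₂ : ℝ → ℝ} {G G₁ G₂ : ℝ → ℝ≥0∞} {l : ℝ}

/-- A function whose increments are dominated by the integrals of an integrable function is
absolutely continuous, and its derivative is dominated by that function. -/
theorem absolutelyContinuous_of_increment_le (hl : 0 ≤ l)
    (hG : AEMeasurable G (volume.restrict (Icc 0 l))) (hfin : ∫⁻ t in Icc 0 l, G t ≠ ∞)
    (h : ∀ a b, 0 ≤ a → a ≤ b → b ≤ l →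
      ENNReal.ofReal |F b - F a| ≤ ∫⁻ t in Icc a b, G t) :
    AbsolutelyContinuousOnInterval F 0 l ∧
      ∀ᵐ t ∂(volume.restrict (Icc 0 l)), ENNReal.ofReal |deriv F t| ≤ G t := by
  set g : ℝ → ℝ := fun t => (G t).toReal with hg
  have gint : IntegrableOn g (Icc 0 l) := integrable_toReal_of_lintegral_ne_top hG hfin
  have gii : IntervalIntegrable g volume 0 l :=
    (intervalIntegrable_iff_integrableOn_Icc_of_le hl).2 gint
  -- The increments of `F` are dominated by those of the primitive `P`. Absolute continuity is
  -- inherited from `P`, and the bound on the derivative comes from Lebesgue differentiation of `P`.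
  set P : ℝ → ℝ := fun x => ∫ t in (0 : ℝ)..x, g t with hP
  have Gfin : ∀ᵐ t ∂(volume.restrict (Icc 0 l)), G t ≠ ∞ :=
    (ae_lt_top' hG hfin).mono fun t ht => ht.ne
  have Pinc : ∀ a b, 0 ≤ a → a ≤ b → b ≤ l → |F b - F a| ≤ P b - P a := by
    intro a b ha hab hb
    have hsub : Icc a b ⊆ Icc 0 l := Icc_subset_Icc ha hb
    have e : P b - P a = ∫ t in Icc a b, g t := by
      have i1 : IntervalIntegrable g volume 0 a :=
        (intervalIntegrable_iff_integrableOn_Icc_of_le ha).2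
          (gint.mono_set (Icc_subset_Icc le_rfl (hab.trans hb)))
      have i2 : IntervalIntegrable g volume a b :=
        (intervalIntegrable_iff_integrableOn_Icc_of_le hab).2 (gint.mono_set hsub)
      rw [integral_Icc_eq_integral_Ioc, ← intervalIntegral.integral_of_le hab, hP]
      simp only
      rw [← intervalIntegral.integral_add_adjacent_intervals i1 i2]
      ring
    have hGab : ∫⁻ t in Icc a b, G t ≠ ∞ :=
      ((lintegral_mono_set hsub).trans_lt hfin.lt_top).ne
    have e2 : ∫ t in Icc a b, g t = (∫⁻ t in Icc a b, G t).toReal :=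
      integral_toReal (hG.mono_measure (Measure.restrict_mono hsub le_rfl))
        (ae_lt_top' (hG.mono_measure (Measure.restrict_mono hsub le_rfl)) hGab)
    rw [e, e2]
    exact (ENNReal.ofReal_le_iff_le_toReal hGab).1 (h a b ha hab hb)
  have Pinc' : ∀ a ∈ Icc 0 l, ∀ b ∈ Icc 0 l, |F b - F a| ≤ |P b - P a| := by
    intro a ha b hb
    rcases le_total a b with hab | hab
    · exact (Pinc a b ha.1 hab hb.2).trans (le_abs_self _)
    · rw [abs_sub_comm, abs_sub_comm (P b)]
      exact (Pinc b a hb.1 hab ha.2).trans (le_abs_self _)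
  constructor
  · have hPac : AbsolutelyContinuousOnInterval P 0 l :=
      gii.absolutelyContinuousOnInterval_intervalIntegral (by simp)
    rw [absolutelyContinuousOnInterval_iff] at hPac ⊢
    intro ε hε
    obtain ⟨δ, hδ, H⟩ := hPac ε hε
    refine ⟨δ, hδ, fun E hE hlen => lt_of_le_of_lt (Finset.sum_le_sum fun i hi => ?_)
      (H E hE hlen)⟩
    have := hE.1 i hi
    rw [uIcc_of_le hl] at this
    rw [Real.dist_eq, Real.dist_eq]
    exact Pinc' _ this.2 _ this.1
  · rw [Measure.restrict_congr_set Ioo_ae_eq_Icc.symm] at Gfin ⊢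
    have hd := gii.ae_hasDerivAt_integral
    filter_upwards [ae_restrict_of_ae hd, Gfin, ae_restrict_mem measurableSet_Ioo] with t ht hGt hm
    have hmI : t ∈ uIcc 0 l := by rw [uIcc_of_le hl]; exact Ioo_subset_Icc_self hm
    have hPd : HasDerivAt P (g t) t := ht hmI 0 (by simp)
    by_cases hF : DifferentiableAt ℝ F t
    · have h1 := (hasDerivAt_iff_tendsto_slope.1 hF.hasDerivAt).abs
      have h2 := (hasDerivAt_iff_tendsto_slope.1 hPd).abs
      have h3 : |deriv F t| ≤ |g t| := by
        refine le_of_tendsto_of_tendsto h1 h2 ?_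
        have : ∀ᶠ s in 𝓝[≠] t, s ∈ Ioo 0 l :=
          nhdsWithin_le_nhds (isOpen_Ioo.mem_nhds hm)
        filter_upwards [this] with s hs
        rw [slope_def_field, slope_def_field, abs_div, abs_div]
        exact div_le_div_of_nonneg_right
          (Pinc' _ (Ioo_subset_Icc_self hm) _ (Ioo_subset_Icc_self hs)) (abs_nonneg _)
      rw [abs_of_nonneg (ENNReal.toReal_nonneg : 0 ≤ g t)] at h3
      exact (ENNReal.ofReal_le_iff_le_toReal hGt).2 h3
    · rw [deriv_zero_of_not_differentiableAt hF]; simp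

/-- All but countably many points of `S` are limits from the right of points of `S`. At such a point
the derivative within `S` is unique, hence that of the zero function. -/
theorem ae_hasDerivAt_eq_zero_of_eq_zero {D : ℝ → ℝ} {S : Set ℝ} (hS : ∀ t ∈ S, D t = 0) :
    ∀ᵐ t, t ∈ S → DifferentiableAt ℝ D t → deriv D t = 0 := by
  have hc : {t ∈ S | 𝓝[S ∩ Ioi t] t = ⊥}.Countable := countable_setOfPred_isolated_right_within
  filter_upwards [compl_mem_ae_iff.2 (hc.measure_zero volume)] with t ht htS hd
  have hne : 𝓝[S ∩ Ioi t] t ≠ ⊥ := fun h => ht ⟨htS, h⟩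
  have hacc : UniqueDiffWithinAt ℝ S t := by
    rw [uniqueDiffWithinAt_iff_accPt, accPt_principal_iff_nhdsWithin]
    have := neBot_iff.2 hne
    exact this.mono (nhdsWithin_mono _ fun s hs => ⟨hs.1, ne_of_gt hs.2⟩)
  have h1 : HasDerivWithinAt D (deriv D t) S t := hd.hasDerivAt.hasDerivWithinAt
  have h2 : HasDerivWithinAt D 0 S t :=
    (hasDerivWithinAt_const t S (0 : ℝ)).congr (fun s hs => hS s hs) (hS t htS)
  exact hacc.eq_deriv _ h1 h2

/-- If `F₁ = F₂` on a set `S`, then the increments of `F₁` can be estimated by a function that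
dominates the control function of `F₂` on `S` and the one of `F₁` off `S`. -/
theorem increment_le_of_eq_on (hl : 0 ≤ l)
    (hG₁ : AEMeasurable G₁ (volume.restrict (Icc 0 l))) (hfin₁ : ∫⁻ t in Icc 0 l, G₁ t ≠ ∞)
    (h₁ : ∀ a b, 0 ≤ a → a ≤ b → b ≤ l → ENNReal.ofReal |F₁ b - F₁ a| ≤ ∫⁻ t in Icc a b, G₁ t)
    (hG₂ : AEMeasurable G₂ (volume.restrict (Icc 0 l))) (hfin₂ : ∫⁻ t in Icc 0 l, G₂ t ≠ ∞)
    (h₂ : ∀ a b, 0 ≤ a → a ≤ b → b ≤ l → ENNReal.ofReal |F₂ b - F₂ a| ≤ ∫⁻ t in Icc a b, G₂ t)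
    {S : Set ℝ} (hS : ∀ᵐ t ∂(volume.restrict (Icc 0 l)), t ∈ S → F₁ t = F₂ t ∧ G₂ t ≤ G t)
    (hS' : ∀ᵐ t ∂(volume.restrict (Icc 0 l)), t ∉ S → G₁ t ≤ G t) :
    ENNReal.ofReal |F₁ l - F₁ 0| ≤ ∫⁻ t in Icc 0 l, G t := by
  obtain ⟨ac₁, d₁⟩ := absolutelyContinuous_of_increment_le hl hG₁ hfin₁ h₁
  obtain ⟨ac₂, d₂⟩ := absolutelyContinuous_of_increment_le hl hG₂ hfin₂ h₂
  have z := ae_hasDerivAt_eq_zero_of_eq_zero (D := fun t => F₁ t - F₂ t)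
    (S := {t | F₁ t = F₂ t}) fun t ht => sub_eq_zero.2 ht
  have D₁ := ac₁.ae_differentiableAt
  have D₂ := ac₂.ae_differentiableAt
  rw [uIcc_of_le hl] at D₁ D₂
  -- On `S` the derivatives of `F₁` and `F₂` agree almost everywhere, so the bound for `F₂` applies
  -- there. Absolute continuity of `F₁` then integrates the estimate.
  have key : ∀ᵐ t ∂(volume.restrict (Icc 0 l)), ENNReal.ofReal |deriv F₁ t| ≤ G t := by
    filter_upwards [d₁, d₂, ae_restrict_of_ae z, ae_restrict_of_ae D₁, ae_restrict_of_ae D₂, hS,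
      hS', ae_restrict_mem measurableSet_Icc] with t d₁ d₂ z D₁ D₂ hS hS' ht
    by_cases hts : t ∈ S
    · have hz := z (hS hts).1 ((D₁ ht).sub (D₂ ht))
      rw [deriv_fun_sub (D₁ ht) (D₂ ht), sub_eq_zero] at hz
      rw [hz]
      exact d₂.trans (hS hts).2
    · exact d₁.trans (hS' hts)
  rw [← ac₁.integral_deriv_eq_sub, intervalIntegral.integral_of_le hl,
    ← integral_Icc_eq_integral_Ioc, ← Real.norm_eq_abs, ofReal_norm]
  refine (enorm_integral_le_lintegral_enorm _).trans (lintegral_mono_ae ?_)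
  filter_upwards [key] with t ht
  rwa [← ofReal_norm, Real.norm_eq_abs]

end RealLine

/-! ### Majorants in `L^p` of countable families. -/

section Combination

variable {X : Type*} [MeasurableSpace X] {μ : Measure X} {p : ℝ}

/-- The pointwise `ℓ^p` norm is used instead of the supremum: the energies then add up exactly. -/
theorem exists_lp_majorant {ι : Type*} [Countable ι] (hp : 0 < p) (f : ι → X → ℝ≥0∞)
    (hf : ∀ i, Measurable (f i)) :
    ∃ ρ : X → ℝ≥0∞, Measurable ρ ∧ ∫⁻ x, ρ x ^ p ∂μ = ∑' i, ∫⁻ x, f i x ^ p ∂μ ∧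
      ∀ i x, f i x ≤ ρ x := by
  refine ⟨fun x => (∑' i, f i x ^ p) ^ (1 / p), ?_, ?_, ?_⟩
  · exact (Measurable.tsum fun i => (hf i).pow_const p).pow_const _
  · rw [← lintegral_tsum fun i => ((hf i).pow_const p).aemeasurable]
    congr 1
    funext x
    rw [← ENNReal.rpow_mul, one_div_mul_cancel hp.ne', ENNReal.rpow_one]
  · intro i x
    have h := ENNReal.le_tsum (f := fun i => f i x ^ p) i
    calc f i x = (f i x ^ p) ^ (1 / p) := by
          rw [← ENNReal.rpow_mul, mul_one_div_cancel hp.ne', ENNReal.rpow_one]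
      _ ≤ _ := ENNReal.rpow_le_rpow h (by positivity)

/-- Countably many functions in `L^p` are dominated, up to constants, by a single one. -/
theorem exists_lp_majorant_mul {ι : Type*} [Countable ι] (hp : 0 < p) (f : ι → X → ℝ≥0∞)
    (hf : ∀ i, Measurable (f i)) (hfin : ∀ i, ∫⁻ x, f i x ^ p ∂μ ≠ ∞) :
    ∃ ρ : X → ℝ≥0∞, Measurable ρ ∧ ∫⁻ x, ρ x ^ p ∂μ ≠ ∞ ∧
      ∀ i, ∃ C : ℝ≥0∞, C ≠ ∞ ∧ ∀ x, f i x ≤ C * ρ x := by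
  obtain ⟨ε, hε, hsum⟩ := ENNReal.exists_pos_sum_of_countable one_ne_zero ι
  set J : ι → ℝ≥0∞ := fun i => ∫⁻ x, f i x ^ p ∂μ with hJ
  -- With this weight the energy of `c i * f i` is at most `ε i`; the summand `1` keeps `c i` finite
  -- when `J i = 0`.
  set c : ι → ℝ≥0∞ := fun i => (ε i / (1 + J i)) ^ (1 / p) with hc
  have d0 : ∀ i, (ε i : ℝ≥0∞) / (1 + J i) ≠ 0 := fun i =>
    (ENNReal.div_pos (by exact_mod_cast (hε i).ne') (ENNReal.add_ne_top.2
      ⟨ENNReal.one_ne_top, hfin i⟩)).ne'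
  have dt : ∀ i, (ε i : ℝ≥0∞) / (1 + J i) ≠ ∞ := fun i =>
    ENNReal.div_ne_top ENNReal.coe_ne_top (by simp)
  have c0 : ∀ i, c i ≠ 0 := fun i => by
    simp only [hc]
    exact (ENNReal.rpow_pos (pos_iff_ne_zero.2 (d0 i)) (dt i)).ne'
  have ct : ∀ i, c i ≠ ∞ := fun i => ENNReal.rpow_ne_top_of_nonneg (by positivity) (dt i)
  obtain ⟨ρ, hρ, hint, hle⟩ := exists_lp_majorant (μ := μ) hp (fun i x => c i * f i x)
    (fun i => (hf i).const_mul _)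
  refine ⟨ρ, hρ, ?_, fun i => ⟨(c i)⁻¹, ENNReal.inv_ne_top.2 (c0 i), fun x => ?_⟩⟩
  · rw [hint]
    have : ∀ i, ∫⁻ x, (c i * f i x) ^ p ∂μ ≤ ε i := by
      intro i
      have e : ∀ x, (c i * f i x) ^ p = (ε i / (1 + J i)) * f i x ^ p := fun x => by
        rw [ENNReal.mul_rpow_of_nonneg _ _ hp.le]
        congr 1
        simp only [hc]
        rw [← ENNReal.rpow_mul, one_div_mul_cancel hp.ne', ENNReal.rpow_one]
      simp only [e]
      rw [lintegral_const_mul _ ((hf i).pow_const p)]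
      change _ * J i ≤ _
      rw [mul_comm, ← mul_div_assoc]
      refine ENNReal.div_le_of_le_mul ?_
      rw [mul_comm]
      gcongr
      exact le_add_self
    exact ((ENNReal.tsum_le_tsum this).trans_lt (hsum.trans ENNReal.one_lt_top)).ne
  · calc f i x = (c i)⁻¹ * (c i * f i x) := by
          rw [← mul_assoc, ENNReal.inv_mul_cancel (c0 i) (ct i), one_mul]
      _ ≤ _ := by gcongr; exact hle i x

end Combination

/-! ### Exceptional families of curves and gluing of weak upper gradients. -/

section WeakUpperGradients

variable {X : Type*} [MetricSpace X] [MeasurableSpace X] [BorelSpace X] {μ : Measure X} {p : ℝ}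
  {Ω : Set X} {f f₁ f₂ : X → ℝ} {g g₁ g₂ h : X → ℝ≥0∞}

/-- The upper gradient inequality holds on all the curves in `Ω` along which `ρ` has a finite
integral. -/
def UpperGradientOff (Ω : Set X) (f : X → ℝ) (g ρ : X → ℝ≥0∞) : Prop :=
  ∀ γ : RectCurve X, γ.trace ⊆ Ω → γ.integral ρ ≠ ∞ → UpperGradientIneq f g γ

theorem upperGradientIneq_of_len_eq_zero {γ : RectCurve X} (h : γ.len = 0) :
    UpperGradientIneq f g γ := by
  simp [UpperGradientIneq, h]

/-- A family has modulus zero exactly when some function in `L^p` has infinite integral along each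
of its curves. This form passes to subcurves and to countable unions of families, so it replaces
moduli from here on. For the converse, small multiples of `ρ` remain admissible. -/
theorem isWeakUpperGradient_iff (hp : 1 < p) :
    IsWeakUpperGradient μ p Ω f g ↔ Measurable g ∧ ∃ ρ : X → ℝ≥0∞, Measurable ρ ∧
      ∫⁻ x, ρ x ^ p ∂μ ≠ ∞ ∧ UpperGradientOff Ω f g ρ := by
  have p0 : 0 < p := zero_lt_one.trans hp
  refine and_congr_right fun _ => ⟨?_, ?_⟩
  · rintro ⟨Γ, hΓ, H⟩
    have ex : ∀ n : ℕ, ∃ ρ : X → ℝ≥0∞, Measurable ρ ∧ (∀ γ ∈ Γ, 1 ≤ γ.integral ρ) ∧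
        ∫⁻ x, ρ x ^ p ∂μ < (2 : ℝ≥0∞)⁻¹ ^ n / ((n : ℝ≥0∞) ^ p + 1) := by
      intro n
      have pos : 0 < (2 : ℝ≥0∞)⁻¹ ^ n / ((n : ℝ≥0∞) ^ p + 1) := by
        refine ENNReal.div_pos (pow_ne_zero _ (by simp)) ?_
        exact ENNReal.add_ne_top.2
          ⟨ENNReal.rpow_ne_top_of_nonneg p0.le (ENNReal.natCast_ne_top n), ENNReal.one_ne_top⟩
      rw [← hΓ, modulus] at pos
      simp only [iInf_lt_iff] at pos
      obtain ⟨ρ, h1, h2, h3⟩ := pos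
      exact ⟨ρ, h1, h2, h3⟩
    choose ρ hρm hρΓ hρ using ex
    -- Along a curve of `Γ` the integral of `σ` is at least `n` for every `n`. The bound on the
    -- energy of `ρ n` was chosen to absorb the factor `n ^ p`.
    obtain ⟨σ, hσ, hint, hle⟩ := exists_lp_majorant (μ := μ) p0 (fun (n : ℕ) x => n * ρ n x)
      (fun n => (hρm n).const_mul _)
    refine ⟨σ, hσ, ?_, fun γ hγ hfin => ?_⟩
    · rw [hint]
      refine ((ENNReal.tsum_le_tsum (g := fun n : ℕ => (2 : ℝ≥0∞)⁻¹ ^ n) fun n => ?_).trans_lt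
        ?_).ne
      · simp only [ENNReal.mul_rpow_of_nonneg _ _ p0.le]
        rw [lintegral_const_mul _ ((hρm n).pow_const p)]
        calc (n : ℝ≥0∞) ^ p * ∫⁻ x, ρ n x ^ p ∂μ
            ≤ ((n : ℝ≥0∞) ^ p + 1) * ((2 : ℝ≥0∞)⁻¹ ^ n / ((n : ℝ≥0∞) ^ p + 1)) := by
              gcongr
              · exact le_self_add
              · exact (hρ n).le
          _ ≤ _ := ENNReal.mul_div_le
      · rw [ENNReal.tsum_geometric]
        simp
    · rcases γ.len_nonneg.eq_or_lt with h0 | h0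
      · exact upperGradientIneq_of_len_eq_zero h0.symm
      refine H γ h0 hγ fun hΓ' => hfin ?_
      refine ENNReal.eq_top_of_forall_nnreal_le fun r => ?_
      obtain ⟨n, hn⟩ := exists_nat_ge r
      calc (r : ℝ≥0∞) ≤ n := by exact_mod_cast hn
        _ = n * 1 := (mul_one _).symm
        _ ≤ n * γ.integral (ρ n) := by gcongr; exact hρΓ n γ hΓ'
        _ = γ.integral (fun x => n * ρ n x) := (γ.integral_const_mul _ (hρm n)).symm
        _ ≤ _ := γ.integral_mono' (hle n)
  · rintro ⟨ρ, hρ, hfin, H⟩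
    refine ⟨{γ | γ.integral ρ = ∞}, ?_, fun γ _ hγ hΓ => H γ hγ hΓ⟩
    rw [← nonpos_iff_eq_zero]
    have hb : ∀ n : ℕ, modulus μ p {γ : RectCurve X | γ.integral ρ = ∞} ≤
        ((n : ℝ≥0∞) + 1)⁻¹ ^ p * ∫⁻ x, ρ x ^ p ∂μ := by
      intro n
      refine (iInf₂_le (fun x => ((n : ℝ≥0∞) + 1)⁻¹ * ρ x) (hρ.const_mul _)).trans
        ((iInf_le _ ?_).trans_eq ?_)
      · intro γ hγ
        rw [γ.integral_const_mul _ hρ, show γ.integral ρ = ∞ from hγ, ENNReal.mul_top]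
        · exact le_top
        · exact ENNReal.inv_ne_zero.2 (by simp)
      · simp only [ENNReal.mul_rpow_of_nonneg _ _ p0.le]
        rw [lintegral_const_mul _ (hρ.pow_const p)]
    have hlim : Tendsto (fun n : ℕ => ((n : ℝ≥0∞) + 1)⁻¹ ^ p * ∫⁻ x, ρ x ^ p ∂μ) atTop
        (𝓝 (0 ^ p * ∫⁻ x, ρ x ^ p ∂μ)) := by
      refine ENNReal.Tendsto.mul_const ?_ (Or.inr hfin)
      refine (ENNReal.continuous_rpow_const.tendsto _).comp ?_
      have := (tendsto_add_atTop_iff_nat 1).2 ENNReal.tendsto_inv_nat_nhds_zero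
      simpa using this
    rw [ENNReal.zero_rpow_of_pos p0, zero_mul] at hlim
    exact ge_of_tendsto' hlim hb

/-- Subcurves inherit the finiteness of the integral of `ρ`, so a nonexceptional curve has no
exceptional subcurves. -/
theorem UpperGradientOff.increment_le {ρ : X → ℝ≥0∞} (H : UpperGradientOff Ω f g ρ)
    {γ : RectCurve X} (hγ : γ.trace ⊆ Ω) (hfin : γ.integral ρ ≠ ∞) {a b : ℝ} (ha : 0 ≤ a)
    (hab : a ≤ b) (hb : b ≤ γ.len) :
    ENNReal.ofReal |f (γ.toFun b) - f (γ.toFun a)| ≤ γ.integralOn g a b := by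
  have h := H (γ.sub a b ha hab hb) ((γ.sub_trace_subset ha hab hb).trans hγ) (by
    rw [γ.sub_integral]
    exact ne_top_of_le_ne_top hfin (γ.integralOn_le_integral ρ ha hb))
  rw [UpperGradientIneq, γ.sub_toFun_zero, γ.sub_toFun_len, γ.sub_integral, abs_sub_comm] at h
  exact h

/-- A function in `L^p_loc` has a finite integral along almost every curve. -/
theorem LocLp.exists_integral_ne_top [SecondCountableTopology X] (hp : 0 < p)
    (hg : Measurable g) (hloc : LocLp μ p Ω g) :
    ∃ ρ : X → ℝ≥0∞, Measurable ρ ∧ ∫⁻ x, ρ x ^ p ∂μ ≠ ∞ ∧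
      ∀ γ : RectCurve X, γ.trace ⊆ Ω → γ.integral ρ ≠ ∞ → γ.integral g ≠ ∞ := by
  choose! r hr hrΩ hrint using hloc
  obtain ⟨t, htΩ, htc, hcov⟩ := TopologicalSpace.countable_cover_nhdsWithin
    (f := fun x => ball x (r x)) (s := Ω)
    fun x hx => mem_nhdsWithin_of_mem_nhds (ball_mem_nhds x (hr x hx))
  have := htc.to_subtype
  have mind : ∀ i : t, Measurable ((ball (i : X) (r i)).indicator g) := fun i =>
    hg.indicator measurableSet_ball
  obtain ⟨ρ, hρ, hfin, hle⟩ := exists_lp_majorant_mul (μ := μ) hp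
    (fun (i : t) => (ball (i : X) (r i)).indicator g) mind (fun i => by
      have e : ∀ x, (ball (i : X) (r i)).indicator g x ^ p =
          (ball (i : X) (r i)).indicator (fun x => g x ^ p) x := fun x => by
        by_cases hx : x ∈ ball (i : X) (r i) <;> simp [hx, hp]
      simp only [e]
      rw [lintegral_indicator measurableSet_ball]
      exact (hrint i (htΩ i.2)).ne)
  refine ⟨ρ, hρ, hfin, fun γ hγ hγfin => ?_⟩
  have hi : ∀ i : t, γ.integral ((ball (i : X) (r i)).indicator g) ≠ ∞ := fun i => by
    obtain ⟨C, hC, hC'⟩ := hle i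
    refine ne_top_of_le_ne_top ?_ (γ.integral_mono' hC')
    rw [γ.integral_const_mul C hρ]
    exact ENNReal.mul_ne_top hC hγfin
  -- Countably many balls cover `Ω`, and the compact trace needs only finitely many of them, so a
  -- finite sum of finite integrals bounds the integral of `g`.
  obtain ⟨s, hs⟩ := γ.isCompact_trace.elim_finite_subcover
    (fun i : t => ball (i : X) (r i)) (fun i => isOpen_ball) (fun x hx => by
      have := hcov (hγ hx)
      simpa [mem_iUnion] using this)
  have hb : γ.integral g ≤ γ.integral fun x => ∑ i ∈ s, (ball (i : X) (r i)).indicator g x := by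
    refine γ.integral_mono hs fun x hx => ?_
    simp only [mem_iUnion] at hx
    obtain ⟨i, his, hx⟩ := hx
    refine le_trans ?_ (Finset.single_le_sum (f := fun i : t => (ball (i : X) (r i)).indicator g x)
      (fun _ _ => zero_le) his)
    rw [indicator_of_mem hx]
  refine ne_top_of_le_ne_top ?_ hb
  unfold RectCurve.integral RectCurve.integralOn
  rw [lintegral_finsetSum' s fun i _ => γ.aemeasurable_comp le_rfl le_rfl (mind i)]
  exact ENNReal.sum_ne_top.2 fun i _ => hi i

/-- Both the exceptional curves and the curves with infinite integral can be detected by one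
function. -/
theorem IsWeakUpperGradient.exists_control [SecondCountableTopology X] (hp : 1 < p)
    (hg : IsWeakUpperGradient μ p Ω f g) (hloc : LocLp μ p Ω g) :
    ∃ ρ : X → ℝ≥0∞, Measurable ρ ∧ ∫⁻ x, ρ x ^ p ∂μ ≠ ∞ ∧ UpperGradientOff Ω f g ρ ∧
      ∀ γ : RectCurve X, γ.trace ⊆ Ω → γ.integral ρ ≠ ∞ → γ.integral g ≠ ∞ := by
  have p0 : 0 < p := zero_lt_one.trans hp
  obtain ⟨gm, ρ₁, m₁, i₁, H₁⟩ := (isWeakUpperGradient_iff hp).1 hg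
  obtain ⟨ρ₂, m₂, i₂, H₂⟩ := hloc.exists_integral_ne_top p0 gm
  obtain ⟨ρ, hρ, hint, hle⟩ := exists_lp_majorant (μ := μ) p0 (fun b : Bool => cond b ρ₁ ρ₂)
    (fun b => by cases b <;> assumption)
  refine ⟨ρ, hρ, ?_, fun γ hγ h => H₁ γ hγ (ne_top_of_le_ne_top h (γ.integral_mono' (hle true))),
    fun γ hγ h => H₂ γ hγ (ne_top_of_le_ne_top h (γ.integral_mono' (hle false)))⟩
  rw [hint, tsum_bool]
  exact ENNReal.add_ne_top.2 ⟨i₂, i₁⟩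

/-- The control functions of countably many weak upper gradients can be chosen the same. -/
theorem exists_common_control {ι : Type*} [Countable ι] (hp : 0 < p) (ρ : ι → X → ℝ≥0∞)
    (hρ : ∀ i, Measurable (ρ i)) (hfin : ∀ i, ∫⁻ x, ρ i x ^ p ∂μ ≠ ∞) :
    ∃ σ : X → ℝ≥0∞, Measurable σ ∧ ∫⁻ x, σ x ^ p ∂μ ≠ ∞ ∧
      ∀ γ : RectCurve X, γ.integral σ ≠ ∞ → ∀ i, γ.integral (ρ i) ≠ ∞ := by
  obtain ⟨σ, hσ, hfin, hle⟩ := exists_lp_majorant_mul (μ := μ) hp ρ hρ hfin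
  refine ⟨σ, hσ, hfin, fun γ hγ i => ?_⟩
  obtain ⟨C, hC, hC'⟩ := hle i
  refine ne_top_of_le_ne_top ?_ (γ.integral_mono' hC')
  rw [γ.integral_const_mul C hσ]
  exact ENNReal.mul_ne_top hC hγ

/-- The function that is `∞` on a measurable null set containing `N` has energy zero, and its
integral is finite only along curves that spend no time in that set. -/
theorem exists_control_of_null (hp : 0 < p) {N : Set X} (hN : μ N = 0) :
    ∃ ρ : X → ℝ≥0∞, Measurable ρ ∧ ∫⁻ x, ρ x ^ p ∂μ ≠ ∞ ∧
      ∀ γ : RectCurve X, γ.integral ρ ≠ ∞ →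
        ∀ᵐ t ∂(volume.restrict (Icc 0 γ.len)), γ.toFun t ∉ N := by
  set M := toMeasurable μ N with hM
  have mM : MeasurableSet M := measurableSet_toMeasurable μ N
  have hρ : Measurable (M.indicator fun _ => (∞ : ℝ≥0∞)) := measurable_const.indicator mM
  refine ⟨M.indicator fun _ => ∞, hρ, ?_, fun γ hγ => ?_⟩
  · have e : ∀ x, (M.indicator (fun _ => (∞ : ℝ≥0∞)) x) ^ p = M.indicator (fun _ => ∞) x := by
      intro x
      by_cases hx : x ∈ M <;> simp [hx, hp]
    simp only [e]
    rw [lintegral_indicator mM, setLIntegral_const, hM, measure_toMeasurable, hN]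
    simp
  · have h := ae_lt_top' (γ.aemeasurable_comp le_rfl le_rfl hρ) hγ
    filter_upwards [h] with t ht hN
    rw [indicator_of_mem (subset_toMeasurable μ N hN)] at ht
    exact lt_irrefl _ ht

/-- **Gluing**: if `f₁ = f₂` almost everywhere in `A`, then a weak upper gradient of `f₁` may be
replaced in `A` by one of `f₂`. -/
theorem IsWeakUpperGradient.glue [SecondCountableTopology X] (hp : 1 < p)
    (h₁ : IsWeakUpperGradient μ p Ω f₁ g₁) (l₁ : LocLp μ p Ω g₁)
    (h₂ : IsWeakUpperGradient μ p Ω f₂ g₂) (l₂ : LocLp μ p Ω g₂) {A : Set X}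
    (hA : ∀ᵐ x ∂μ, x ∈ Ω → x ∈ A → f₁ x = f₂ x ∧ g₂ x ≤ g x)
    (hA' : ∀ᵐ x ∂μ, x ∈ Ω → x ∉ A → g₁ x ≤ g x) (hg : Measurable g) :
    IsWeakUpperGradient μ p Ω f₁ g := by
  have p0 : 0 < p := zero_lt_one.trans hp
  obtain ⟨ρ₁, m₁, i₁, H₁, J₁⟩ := h₁.exists_control hp l₁
  obtain ⟨ρ₂, m₂, i₂, H₂, J₂⟩ := h₂.exists_control hp l₂
  obtain ⟨ρ₃, m₃, i₃, H₃⟩ := exists_control_of_null (μ := μ) p0 hA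
  obtain ⟨ρ₄, m₄, i₄, H₄⟩ := exists_control_of_null (μ := μ) p0 hA'
  obtain ⟨ρ, mρ, iρ, H⟩ := exists_common_control (μ := μ) p0 ![ρ₁, ρ₂, ρ₃, ρ₄]
    (by intro i; fin_cases i <;> assumption) (by intro i; fin_cases i <;> assumption)
  refine (isWeakUpperGradient_iff hp).2 ⟨hg, ρ, mρ, iρ, fun γ hγ hfin => ?_⟩
  have e₁ := H γ hfin 0
  have e₂ := H γ hfin 1
  have e₃ := H₃ γ (H γ hfin 2)
  have e₄ := H₄ γ (H γ hfin 3)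
  have htr : ∀ t ∈ Icc 0 γ.len, γ.toFun t ∈ Ω := fun t ht => hγ (γ.mem_trace ht.1 ht.2)
  -- Along a single nonexceptional curve, gluing is the statement on the real line with `S` the set
  -- of times spent in `A`.
  have key := increment_le_of_eq_on (F₁ := fun t => f₁ (γ.toFun t)) (F₂ := fun t => f₂ (γ.toFun t))
    (G₁ := fun t => g₁ (γ.toFun t)) (G₂ := fun t => g₂ (γ.toFun t)) (G := fun t => g (γ.toFun t))
    (S := {t | γ.toFun t ∈ A}) γ.len_nonneg (γ.aemeasurable_comp le_rfl le_rfl h₁.1)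
    (J₁ γ hγ e₁) (fun a b ha hab hb => H₁.increment_le hγ e₁ ha hab hb)
    (γ.aemeasurable_comp le_rfl le_rfl h₂.1)
    (J₂ γ hγ e₂) (fun a b ha hab hb => H₂.increment_le hγ e₂ ha hab hb)
    (by
      filter_upwards [e₃, ae_restrict_mem measurableSet_Icc] with t ht hm hA
      exact not_not.1 ht (htr t hm) hA)
    (by
      filter_upwards [e₄, ae_restrict_mem measurableSet_Icc] with t ht hm hA
      exact not_not.1 ht (htr t hm) hA)
  rw [UpperGradientIneq, abs_sub_comm]
  exact key

theorem LocLp.mono (hp : 0 ≤ p) (hg : LocLp μ p Ω g) (hle : ∀ x, h x ≤ g x) : LocLp μ p Ω h := by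
  intro x hx
  obtain ⟨r, hr, hrΩ, hfin⟩ := hg x hx
  refine ⟨r, hr, hrΩ, lt_of_le_of_lt (lintegral_mono fun y => ?_) hfin⟩
  exact ENNReal.rpow_le_rpow (hle y) hp

theorem LocLp.add (hp : 1 ≤ p) (hgm : Measurable g) (hg : LocLp μ p Ω g) (hh : LocLp μ p Ω h) :
    LocLp μ p Ω fun x => g x + h x := by
  intro x hx
  obtain ⟨r, hr, hrΩ, hfin⟩ := hg x hx
  obtain ⟨s, hs, hsΩ, hfin'⟩ := hh x hx
  refine ⟨min r s, lt_min hr hs, (ball_subset_ball (min_le_left _ _)).trans hrΩ, ?_⟩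
  have hb : ∀ y, (g y + h y) ^ p ≤ 2 ^ (p - 1) * (g y ^ p + h y ^ p) := fun y =>
    ENNReal.rpow_add_le_mul_rpow_add_rpow _ _ hp
  refine lt_of_le_of_lt (lintegral_mono hb) ?_
  rw [lintegral_const_mul' _ _ (ENNReal.rpow_ne_top_of_nonneg (by linarith) ENNReal.ofNat_ne_top),
    lintegral_add_left (hgm.pow_const p)]
  refine ENNReal.mul_lt_top
    (ENNReal.rpow_lt_top_of_nonneg (by linarith) ENNReal.ofNat_ne_top)
    (ENNReal.add_lt_top.2 ⟨?_, ?_⟩)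
  · exact lt_of_le_of_lt (lintegral_mono_set (ball_subset_ball (min_le_left _ _))) hfin
  · exact lt_of_le_of_lt (lintegral_mono_set (ball_subset_ball (min_le_right _ _))) hfin'

theorem locLp_of_lintegral_ne_top (hΩ : IsOpen Ω) (hg : ∫⁻ x, g x ^ p ∂μ ≠ ∞) :
    LocLp μ p Ω g := by
  intro x hx
  obtain ⟨r, hr, hrΩ⟩ := Metric.isOpen_iff.1 hΩ x hx
  exact ⟨r, hr, hrΩ, lt_of_le_of_lt (setLIntegral_le_lintegral _ _) hg.lt_top⟩

theorem locLp_const (hballs : BallsPosFinite μ) (hp : 0 ≤ p) (hΩ : IsOpen Ω) (c : ℝ≥0) :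
    LocLp μ p Ω fun _ => c := by
  intro x hx
  obtain ⟨r, hr, hrΩ⟩ := Metric.isOpen_iff.1 hΩ x hx
  refine ⟨r, hr, hrΩ, ?_⟩
  rw [setLIntegral_const]
  exact ENNReal.mul_lt_top (ENNReal.rpow_lt_top_of_nonneg hp ENNReal.coe_ne_top) (hballs x r hr).2

theorem LocLp.lintegral_lt_top {K : Set X} (hg : LocLp μ p Ω g) (hK : IsCompact K) (hKΩ : K ⊆ Ω) :
    ∫⁻ x in K, g x ^ p ∂μ < ∞ := by
  choose! r hr hrΩ hrint using hg
  obtain ⟨t, htK, hcov⟩ := hK.elim_nhds_subcover (fun x => ball x (r x))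
    fun x hx => ball_mem_nhds x (hr x (hKΩ hx))
  calc ∫⁻ x in K, g x ^ p ∂μ ≤ ∫⁻ x in ⋃ i : t, ball (i : X) (r i), g x ^ p ∂μ :=
        lintegral_mono_set (hcov.trans_eq (biUnion_eq_iUnion _ _))
    _ ≤ ∑' i : t, ∫⁻ x in ball (i : X) (r i), g x ^ p ∂μ := lintegral_iUnion_le _ _
    _ < ∞ := by
        rw [tsum_fintype]
        exact ENNReal.sum_lt_top.2 fun i _ => hrint i (hKΩ (htK i i.2))

/-- The hypothesis is on increments, so that sums and differences are both covered. -/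
theorem IsWeakUpperGradient.add (hp : 1 < p) (h₁ : IsWeakUpperGradient μ p Ω f₁ g₁)
    (h₂ : IsWeakUpperGradient μ p Ω f₂ g₂) {f : X → ℝ}
    (hf : ∀ x ∈ Ω, ∀ y ∈ Ω, |f x - f y| ≤ |f₁ x - f₁ y| + |f₂ x - f₂ y|) :
    IsWeakUpperGradient μ p Ω f fun x => g₁ x + g₂ x := by
  have p0 : 0 < p := zero_lt_one.trans hp
  obtain ⟨m₁, ρ₁, n₁, i₁, H₁⟩ := (isWeakUpperGradient_iff hp).1 h₁
  obtain ⟨m₂, ρ₂, n₂, i₂, H₂⟩ := (isWeakUpperGradient_iff hp).1 h₂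
  obtain ⟨ρ, mρ, iρ, H⟩ := exists_common_control (μ := μ) p0 ![ρ₁, ρ₂]
    (by intro i; fin_cases i <;> assumption) (by intro i; fin_cases i <;> assumption)
  refine (isWeakUpperGradient_iff hp).2 ⟨m₁.add m₂, ρ, mρ, iρ, fun γ hγ hfin => ?_⟩
  have e₁ := H₁ γ hγ (H γ hfin 0)
  have e₂ := H₂ γ hγ (H γ hfin 1)
  rw [UpperGradientIneq] at *
  rw [γ.integral_add m₁]
  refine le_trans ?_ (add_le_add e₁ e₂)
  rw [← ENNReal.ofReal_add (abs_nonneg _) (abs_nonneg _)]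
  exact ENNReal.ofReal_le_ofReal (hf _ (hγ γ.zero_mem_trace) _ (hγ γ.len_mem_trace))

end WeakUpperGradients

/-! ### Locality, lattice properties, and existence of minimal weak upper gradients. -/

section MinimalWeakUpperGradients

variable {X : Type*} [MetricSpace X] [MeasurableSpace X] [BorelSpace X] {μ : Measure X} {p : ℝ}
  {Ω : Set X} {f f₁ f₂ : X → ℝ} {g g₁ g₂ h : X → ℝ≥0∞}

/-- Being a weak upper gradient is a local property. -/
theorem IsWeakUpperGradient.of_cover (hp : 1 < p) {V : Bool → Set X} (hV : ∀ b, IsOpen (V b))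
    (hcov : Ω ⊆ ⋃ b, V b) (hg : ∀ b, IsWeakUpperGradient μ p (V b) f g) :
    IsWeakUpperGradient μ p Ω f g := by
  choose gm ρ₀ m₀ i₀ H₀ using fun b => (isWeakUpperGradient_iff hp).1 (hg b)
  obtain ⟨ρ, mρ, iρ, H⟩ := exists_common_control (zero_lt_one.trans hp) ρ₀ m₀ i₀
  refine (isWeakUpperGradient_iff hp).2 ⟨gm true, ρ, mρ, iρ, fun γ hγ hfin => ?_⟩
  have hc := γ.continuousOn
  rw [continuousOn_iff_continuous_domRestrict] at hc
  obtain ⟨t, ht0, htm, ⟨m, hm⟩, hti⟩ := exists_monotone_Icc_subset_open_cover_Icc γ.len_nonneg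
    (c := fun b => ((Icc 0 γ.len).domRestrict γ.toFun) ⁻¹' V b) (fun b => (hV b).preimage hc)
    (fun s _ => by
      obtain ⟨b, hb⟩ := mem_iUnion.1 (hcov (hγ (γ.mem_trace s.2.1 s.2.2)))
      exact mem_iUnion.2 ⟨b, hb⟩)
  have key : ∀ n, ENNReal.ofReal |f (γ.toFun 0) - f (γ.toFun (t n))| ≤
      γ.integralOn g 0 (t n) := by
    intro n
    induction n with
    | zero => simp [ht0]
    | succ n ih =>
      have h0 := (t n).2.1
      have h1 : (t n : ℝ) ≤ t (n + 1) := htm n.le_succ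
      have h2 := (t (n + 1)).2.2
      obtain ⟨b, hb⟩ := hti n
      have htr : (γ.sub (t n) (t (n + 1)) h0 h1 h2).trace ⊆ V b := by
        rintro _ ⟨s, hs, rfl⟩
        have hs1 : s ≤ t (n + 1) - t n := hs.2
        have := @hb ⟨t n + s, by linarith [hs.1], by linarith⟩ ⟨by
          show (t n : ℝ) ≤ t n + s
          linarith [hs.1], by
          show (t n : ℝ) + s ≤ t (n + 1)
          linarith⟩
        exact this
      have hi : (γ.sub (t n) (t (n + 1)) h0 h1 h2).integral (ρ₀ b) ≠ ∞ := by
        rw [γ.sub_integral]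
        exact ne_top_of_le_ne_top (H γ hfin b) (γ.integralOn_le_integral _ h0 h2)
      have h3 := H₀ b _ htr hi
      rw [UpperGradientIneq, γ.sub_toFun_zero, γ.sub_toFun_len, γ.sub_integral] at h3
      rw [← γ.integralOn_add g h0 h1]
      refine le_trans ?_ (add_le_add ih h3)
      rw [← ENNReal.ofReal_add (abs_nonneg _) (abs_nonneg _)]
      exact ENNReal.ofReal_le_ofReal (abs_sub_le _ _ _)
  have := key m
  rw [hm m le_rfl] at this
  exact this

/-- Gluing of `f` with itself along the set where `g₂ ≤ g₁`. -/
theorem IsWeakUpperGradient.min [SecondCountableTopology X] (hp : 1 < p)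
    (h₁ : IsWeakUpperGradient μ p Ω f g₁) (l₁ : LocLp μ p Ω g₁)
    (h₂ : IsWeakUpperGradient μ p Ω f g₂) (l₂ : LocLp μ p Ω g₂) :
    IsWeakUpperGradient μ p Ω f fun x => min (g₁ x) (g₂ x) :=
  h₁.glue hp l₁ h₂ l₂ (A := {x | g₂ x ≤ g₁ x})
    (Eventually.of_forall fun _ _ hx => ⟨rfl, le_min hx le_rfl⟩)
    (Eventually.of_forall fun _ _ hx => le_min le_rfl (not_le.1 hx).le) (h₁.1.min h₂.1)

/-- The limit of a decreasing sequence of weak upper gradients is a weak upper gradient. -/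
theorem IsWeakUpperGradient.iInf [SecondCountableTopology X] (hp : 1 < p) {k : ℕ → X → ℝ≥0∞}
    (hk : ∀ n, IsWeakUpperGradient μ p Ω f (k n)) (hl : LocLp μ p Ω (k 0)) (ha : Antitone k) :
    IsWeakUpperGradient μ p Ω f fun x => ⨅ n, k n x := by
  have p0 : 0 < p := zero_lt_one.trans hp
  have hlk : ∀ n, LocLp μ p Ω (k n) := fun n => hl.mono p0.le (ha (Nat.zero_le n))
  choose ρ₀ m₀ i₀ H₀ J₀ using fun n => (hk n).exists_control hp (hlk n)
  obtain ⟨ρ, mρ, iρ, H⟩ := exists_common_control p0 ρ₀ m₀ i₀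
  refine (isWeakUpperGradient_iff hp).2
    ⟨Measurable.iInf fun n => (hk n).1, ρ, mρ, iρ, fun γ hγ hfin => ?_⟩
  have hlim : Tendsto (fun n => γ.integral (k n)) atTop (𝓝 (γ.integral fun x => ⨅ n, k n x)) := by
    refine tendsto_lintegral_of_dominated_convergence' (fun t => k 0 (γ.toFun t))
      (fun n => γ.aemeasurable_comp le_rfl le_rfl (hk n).1)
      (fun n => Eventually.of_forall fun t => ha (Nat.zero_le n) _) (J₀ 0 γ hγ (H γ hfin 0))
      (Eventually.of_forall fun t => tendsto_atTop_iInf fun i j hij => ha hij _)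
  exact ge_of_tendsto' hlim fun n => H₀ n γ hγ (H γ hfin n)

theorem exists_isMinimalWeakUpperGradient [SecondCountableTopology X] [IsLocallyFiniteMeasure μ]
    (hp : 1 < p) (hΩ : IsOpen Ω) (hg : IsWeakUpperGradient μ p Ω f g) (hl : LocLp μ p Ω g) :
    ∃ k, IsMinimalWeakUpperGradient μ p Ω f k := by
  have p0 : 0 < p := zero_lt_one.trans hp
  obtain ⟨ν, hνf, hν, -⟩ := exists_isFiniteMeasure_absolutelyContinuous (μ.restrict Ω)
  let 𝓕 : Set (X → ℝ≥0∞) := {h | IsWeakUpperGradient μ p Ω f h ∧ LocLp μ p Ω h}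
  -- A functional that is strictly decreasing in `h` and finite even if the energy over `Ω` is not.
  -- The infimum of a maximizing sequence attains its supremum, and taking the minimum with any
  -- competitor cannot increase `J` further, so that minimum changes nothing almost everywhere.
  let J : (X → ℝ≥0∞) → ℝ≥0∞ := fun h => ∫⁻ x, (1 + h x)⁻¹ ∂ν
  have hJ : ∀ h h' : X → ℝ≥0∞, (∀ x, h x ≤ h' x) → J h' ≤ J h := fun h h' hle =>
    lintegral_mono fun x => ENNReal.inv_le_inv.2 (add_le_add_right (hle x) 1)
  have hJfin : ∀ h, J h ≠ ∞ := fun h => by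
    refine ne_top_of_le_ne_top (b := ∫⁻ _, 1 ∂ν) (by simp) (lintegral_mono fun x => ?_)
    exact ENNReal.inv_le_one.2 le_self_add
  obtain ⟨a, -, ha, hmem⟩ := exists_seq_tendsto_sSup (S := J '' 𝓕) ⟨J g, g, ⟨hg, hl⟩, rfl⟩
    (OrderTop.bddAbove _)
  choose h hh hha using hmem
  let k : ℕ → X → ℝ≥0∞ := fun n => Nat.rec (h 0) (fun n k x => min (k x) (h (n + 1) x)) n
  have ks : ∀ n, k (n + 1) = fun x => min (k n x) (h (n + 1) x) := fun n => rfl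
  have k𝓕 : ∀ n, k n ∈ 𝓕 := by
    intro n
    induction n with
    | zero => exact hh 0
    | succ n ih =>
      rw [ks]
      exact ⟨ih.1.min hp ih.2 (hh (n + 1)).1 (hh (n + 1)).2,
        ih.2.mono p0.le fun x => min_le_left _ _⟩
  have kanti : Antitone k := antitone_nat_of_succ_le fun n x => min_le_left _ _
  have kle : ∀ n x, k n x ≤ h n x := by
    rintro (_ | n) x
    · exact le_rfl
    · exact min_le_right _ _
  have kinf : IsWeakUpperGradient μ p Ω f fun x => ⨅ n, k n x :=
    IsWeakUpperGradient.iInf hp (fun n => (k𝓕 n).1) (k𝓕 0).2 kanti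
  have kl : LocLp μ p Ω fun x => ⨅ n, k n x := (k𝓕 0).2.mono p0.le fun x => iInf_le _ 0
  refine ⟨_, kinf, kl, fun h' hw' hl' => ?_⟩
  have hSle : sSup (J '' 𝓕) ≤ J fun x => ⨅ n, k n x := by
    refine le_of_tendsto' ha fun n => ?_
    rw [← hha n]
    exact hJ _ _ fun x => (iInf_le _ n).trans (kle n x)
  have hm := kinf.min hp kl hw' hl'
  have hml : LocLp μ p Ω fun x => min (⨅ n, k n x) (h' x) :=
    kl.mono p0.le fun x => min_le_left _ _
  have hle : (J fun x => min (⨅ n, k n x) (h' x)) ≤ J fun x => ⨅ n, k n x :=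
    (le_sSup (mem_image_of_mem J (show _ ∈ 𝓕 from ⟨hm, hml⟩))).trans hSle
  have hae := ae_eq_of_ae_le_of_lintegral_le (μ := ν)
    (f := fun x => (1 + ⨅ n, k n x)⁻¹) (g := fun x => (1 + min (⨅ n, k n x) (h' x))⁻¹)
    (Eventually.of_forall fun x =>
      ENNReal.inv_le_inv.2 (add_le_add_right (min_le_left _ _) 1))
    (hJfin _) ((measurable_const.add hm.1).inv).aemeasurable hle
  filter_upwards [(ae_restrict_iff' hΩ.measurableSet).1 (hν.ae_le hae)] with x hx hxΩ
  have h3 := inv_injective (hx hxΩ)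
  rw [ENNReal.add_right_inj ENNReal.one_ne_top] at h3
  exact h3.le.trans (min_le_right _ _)

/-- A minimal weak upper gradient of `f₁` is dominated by the weak upper gradients of `f₂` at
almost every point of `{f₁ = f₂}`. -/
theorem IsMinimalWeakUpperGradient.le_of_eq [SecondCountableTopology X] (hp : 1 < p)
    (hg : IsMinimalWeakUpperGradient μ p Ω f₁ g) (h₂ : IsWeakUpperGradient μ p Ω f₂ g₂)
    (l₂ : LocLp μ p Ω g₂) {A : Set X} (hA : MeasurableSet A) (h : ∀ x ∈ A, f₁ x = f₂ x) :
    ∀ᵐ x ∂μ, x ∈ Ω → x ∈ A → g x ≤ g₂ x := by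
  classical
  have p0 : 0 < p := zero_lt_one.trans hp
  have hm : Measurable (A.piecewise (fun x => min (g x) (g₂ x)) g) :=
    Measurable.piecewise hA (hg.1.1.min h₂.1) hg.1.1
  -- On `A` the two functions coincide, so gluing allows the use of `g₂` there; minimality of `g`
  -- against the result gives the claim.
  have hw : IsWeakUpperGradient μ p Ω f₁ (A.piecewise (fun x => min (g x) (g₂ x)) g) := by
    have hmin : IsWeakUpperGradient μ p Ω f₁ (A.piecewise g₂ g) := by
      refine hg.1.glue hp hg.2.1 h₂ l₂ (A := A) ?_ ?_ (Measurable.piecewise hA h₂.1 hg.1.1)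
      · exact Eventually.of_forall fun x _ hx => ⟨h x hx, by simp [hx]⟩
      · exact Eventually.of_forall fun x _ hx => by simp [hx]
    have hl : LocLp μ p Ω (A.piecewise g₂ g) :=
      (hg.2.1.add hp.le hg.1.1 l₂).mono p0.le fun x => by
        by_cases hx : x ∈ A <;> simp [hx]
    convert hg.1.min hp hg.2.1 hmin hl using 2 with x
    by_cases hx : x ∈ A <;> simp [hx]
  have hl : LocLp μ p Ω (A.piecewise (fun x => min (g x) (g₂ x)) g) :=
    hg.2.1.mono p0.le fun x => by by_cases hx : x ∈ A <;> simp [hx]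
  filter_upwards [hg.2.2 _ hw hl] with x hx hxΩ hxA
  have := hx hxΩ
  rw [piecewise_eq_of_mem _ _ _ hxA] at this
  exact this.trans (min_le_right _ _)

end MinimalWeakUpperGradients

/-! ### Doubling measures: properness of the space and the maximal function. -/

section Doubling

variable {X : Type*} [MetricSpace X] [MeasurableSpace X] [BorelSpace X] {μ : Measure X} {p : ℝ}

theorem IsDoubling.exists_measure_ball_le (h : IsDoubling μ) (a : ℝ) :
    ∃ D : ℝ≥0, ∀ (x : X) (r R : ℝ), 0 < r → R ≤ a * r → μ (ball x R) ≤ D * μ (ball x r) := by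
  obtain ⟨C, hC⟩ := h
  obtain ⟨k, hk⟩ := pow_unbounded_of_one_lt a one_lt_two
  have it : ∀ (k : ℕ) (x : X) (r : ℝ), 0 < r → μ (ball x (2 ^ k * r)) ≤ C ^ k * μ (ball x r) := by
    intro k x r hr
    induction k with
    | zero => simp
    | succ k ih =>
      rw [pow_succ', mul_assoc, pow_succ', mul_assoc]
      exact (hC x (2 ^ k * r) (by positivity)).trans (mul_le_mul_right ih _)
  refine ⟨C ^ k, fun x r R hr hR => (measure_mono (ball_subset_ball ?_)).trans
    ((it k x r hr).trans_eq (by push_cast; rfl))⟩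
  exact hR.trans (mul_le_mul_of_nonneg_right hk.le hr.le)

theorem IsDoubling.isUnifLocDoublingMeasure (h : IsDoubling μ) : IsUnifLocDoublingMeasure μ := by
  obtain ⟨D, hD⟩ := h.exists_measure_ball_le 4
  refine ⟨⟨D, ?_⟩⟩
  filter_upwards [self_mem_nhdsWithin] with ε hε x
  have hε : 0 < ε := hε
  calc μ (closedBall x (2 * ε)) ≤ μ (ball x (4 * ε)) :=
        measure_mono (closedBall_subset_ball (by linarith))
    _ ≤ D * μ (ball x ε) := hD x ε _ hε le_rfl
    _ ≤ D * μ (closedBall x ε) := mul_le_mul_right (measure_mono ball_subset_closedBall) _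

/-- Volume counting: an infinite `ε`-separated subset of a ball would give infinitely many disjoint
balls of radius `ε / 2` in a set of finite measure, with measures bounded below by doubling. Hence
closed balls are totally bounded, and completeness makes them compact. -/
theorem IsDoubling.properSpace [CompleteSpace X] (hb : BallsPosFinite μ) (h : IsDoubling μ) :
    ProperSpace X := by
  refine ⟨fun x R => TotallyBounded.isCompact_of_isClosed ?_ isClosed_closedBall⟩
  rw [Metric.totallyBounded_iff]
  intro ε hε
  by_contra hcon
  push Not at hcon
  have hR : 0 ≤ R := by
    by_contra hR
    have := hcon ∅ finite_empty
    rw [closedBall_eq_empty.2 (not_le.1 hR)] at this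
    exact this (empty_subset _)
  obtain ⟨a, ha, hsep⟩ := exists_seq_of_forall_finset_exists (fun y => y ∈ closedBall x R)
    (fun y z => ε ≤ dist z y) (fun s _ => by
      obtain ⟨z, hz, hz'⟩ := not_subset.1 (hcon s s.finite_toSet)
      refine ⟨z, hz, fun y hy => ?_⟩
      by_contra hlt
      exact hz' (mem_iUnion₂.2 ⟨y, hy, not_le.1 hlt⟩))
  obtain ⟨D, hD⟩ := h.exists_measure_ball_le ((2 * R + ε) / (ε / 2))
  have hle : ∀ n, μ (ball x (R + ε)) ≤ D * μ (ball (a n) (ε / 2)) := fun n =>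
    (measure_mono (ball_subset_ball' (by
      have : dist (a n) x ≤ R := ha n
      rw [dist_comm] at this
      linarith))).trans (hD (a n) (ε / 2) (2 * R + ε) (by linarith)
        (by rw [div_mul_cancel₀]; positivity))
  have hsub : ∀ n, ball (a n) (ε / 2) ⊆ ball x (R + ε) := fun n => ball_subset_ball' (by
    have : dist (a n) x ≤ R := ha n
    linarith)
  have hdisj : Pairwise (Function.onFun Disjoint fun n => ball (a n) (ε / 2)) := by
    intro m n hmn
    refine ball_disjoint_ball ?_
    rw [add_halves]
    rcases lt_or_gt_of_ne hmn with hlt | hlt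
    · rw [dist_comm]; exact hsep m n hlt
    · exact hsep n m hlt
  have hpos := (hb x (R + ε) (by linarith))
  have D0 : (D : ℝ≥0∞) ≠ 0 := fun h0 => by
    have := hle 0
    rw [h0, zero_mul, nonpos_iff_eq_zero] at this
    exact hpos.1.ne' this
  have hfin := Measure.finite_const_le_meas_of_disjoint_iUnion μ
    (ε := μ (ball x (R + ε)) / D) (ENNReal.div_pos hpos.1.ne' ENNReal.coe_ne_top)
    (As := fun n => ball (a n) (ε / 2)) (fun n => measurableSet_ball) hdisj
    ((measure_mono (iUnion_subset hsub)).trans_lt hpos.2).ne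
  refine infinite_univ (hfin.subset fun n _ => ?_)
  show μ (ball x (R + ε)) / (D : ℝ≥0∞) ≤ μ (ball (a n) (ε / 2))
  refine ENNReal.div_le_of_le_mul ?_
  rw [mul_comm]
  exact hle n

theorem BallsPosFinite.isLocallyFiniteMeasure (hb : BallsPosFinite μ) :
    IsLocallyFiniteMeasure μ :=
  ⟨fun x => ⟨ball x 1, ball_mem_nhds x one_pos, (hb x 1 one_pos).2⟩⟩

/-- The weak type estimate for the maximal function over balls of radius at most `1`. -/
theorem exists_weak_type_estimate [SecondCountableTopology X] (hb : BallsPosFinite μ)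
    (hd : IsDoubling μ) :
    ∃ D : ℝ≥0, ∀ (F : X → ℝ≥0∞) (τ : ℝ≥0∞),
      τ * μ {x | ∃ r, 0 < r ∧ r ≤ 1 ∧ τ < ⨍⁻ y in ball x r, F y ∂μ} ≤ D * ∫⁻ x, F x ∂μ := by
  -- Vitali's covering lemma enlarges balls by the factor `5`, and the closed ball of radius `5 r`
  -- lies in the open ball of radius `6 r`.
  obtain ⟨D, hD⟩ := hd.exists_measure_ball_le 6
  refine ⟨D, fun F τ => ?_⟩
  set B := {x | ∃ r, 0 < r ∧ r ≤ 1 ∧ τ < ⨍⁻ y in ball x r, F y ∂μ} with hB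
  choose! r hr hr1 hτ using show ∀ x ∈ B, ∃ r, 0 < r ∧ r ≤ 1 ∧ τ < ⨍⁻ y in ball x r, F y ∂μ from
    fun x hx => hx
  obtain ⟨u, huB, hdis, hcov⟩ := Vitali.exists_disjoint_subfamily_covering_enlargement_closedBall
    B (fun x => x) r 1 hr1 5 (by norm_num)
  have hdis' : u.PairwiseDisjoint fun x => ball x (r x) :=
    hdis.mono fun x => ball_subset_closedBall
  have huc : u.Countable := hdis'.countable_of_isOpen (fun x _ => isOpen_ball)
    fun x hx => ⟨x, mem_ball_self (hr x (huB hx))⟩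
  have h1 : μ B ≤ ∑' x : u, D * μ (ball (x : X) (r x)) := by
    have hsub : B ⊆ ⋃ x ∈ u, closedBall x (5 * r x) := fun x hx => by
      obtain ⟨y, hy, hxy⟩ := hcov x hx
      exact mem_iUnion₂.2 ⟨y, hy, hxy (mem_closedBall_self (hr x hx).le)⟩
    refine (measure_mono hsub).trans ((measure_biUnion_le μ huc _).trans
      (ENNReal.tsum_le_tsum fun x => ?_))
    have hx := hr x (huB x.2)
    exact (measure_mono (closedBall_subset_ball (by linarith))).trans
      (hD x (r x) (6 * r x) hx le_rfl)
  have h2 : ∀ x : u, τ * μ (ball (x : X) (r x)) ≤ ∫⁻ y in ball (x : X) (r x), F y ∂μ := by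
    intro x
    have hx := hb x _ (hr x (huB x.2))
    have := hτ x (huB x.2)
    rw [setLAverage_eq] at this
    exact (ENNReal.le_div_iff_mul_le (Or.inl hx.1.ne') (Or.inl hx.2.ne)).1 this.le
  calc τ * μ B ≤ τ * ∑' x : u, D * μ (ball (x : X) (r x)) := mul_le_mul_right h1 _
    _ = D * ∑' x : u, τ * μ (ball (x : X) (r x)) := by
        rw [ENNReal.tsum_mul_left, ENNReal.tsum_mul_left]; ring
    _ ≤ D * ∑' x : u, ∫⁻ y in ball (x : X) (r x), F y ∂μ :=
        mul_le_mul_right (ENNReal.tsum_le_tsum h2) _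
    _ = D * ∫⁻ y in ⋃ x ∈ u, ball x (r x), F y ∂μ := by
        rw [lintegral_biUnion huc (fun x _ => measurableSet_ball) hdis']
    _ ≤ D * ∫⁻ x, F x ∂μ := mul_le_mul_right (setLIntegral_le_lintegral _ _) _

/-- The sets where the maximal function of an integrable function is large have a measure that is
`o(1 / τ)`. -/
theorem tendsto_mul_measure_maximal [SecondCountableTopology X] (hb : BallsPosFinite μ)
    (hd : IsDoubling μ) {F : X → ℝ≥0∞} (hF : Measurable F) (hfin : ∫⁻ x, F x ∂μ ≠ ∞)
    {τ : ℕ → ℝ≥0} (hτ : Tendsto τ atTop atTop) :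
    Tendsto (fun n => (τ n : ℝ≥0∞) *
      μ {x | ∃ r, 0 < r ∧ r ≤ 1 ∧ (τ n : ℝ≥0∞) < ⨍⁻ y in ball x r, F y ∂μ}) atTop (𝓝 0) := by
  obtain ⟨D, hD⟩ := exists_weak_type_estimate hb hd
  -- The part of `F` off `T n` contributes at most `τ n / 2` to any average. So the weak type
  -- estimate needs only the integral of `F` over `T n`, which tends to `0`.
  set T : ℕ → Set X := fun n => {x | (τ n / 2 : ℝ≥0∞) ≤ F x} with hT
  have mT : ∀ n, MeasurableSet (T n) := fun n => measurableSet_le measurable_const hF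
  have hτ' : Tendsto (fun n => (τ n / 2 : ℝ≥0∞)) atTop (𝓝 ∞) := by
    have := ENNReal.tendsto_coe_nhds_top.2 hτ
    have h2 := ENNReal.Tendsto.mul_const (b := 2⁻¹) this (Or.inl ENNReal.top_ne_zero)
    rwa [ENNReal.top_mul (by simp)] at h2
  have hμT : Tendsto (fun n => μ (T n)) atTop (𝓝 0) := by
    have h3 : ∀ n, 0 < τ n → μ (T n) ≤ (∫⁻ x, F x ∂μ) / (τ n / 2) := fun n hn => by
      have hn' : (τ n / 2 : ℝ≥0∞) ≠ 0 := by simpa using hn.ne'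
      exact meas_ge_le_lintegral_div hF.aemeasurable hn' (ENNReal.div_ne_top (by simp) (by simp))
    have h4 : Tendsto (fun n => (∫⁻ x, F x ∂μ) / (τ n / 2)) atTop (𝓝 0) := by
      have := ENNReal.Tendsto.const_div (a := ∫⁻ x, F x ∂μ) hτ' (Or.inr hfin)
      rwa [ENNReal.div_top] at this
    refine tendsto_of_tendsto_of_tendsto_of_le_of_le' tendsto_const_nhds h4
      (Eventually.of_forall fun _ => zero_le) ?_
    filter_upwards [hτ.eventually_gt_atTop 0] with n hn using h3 n hn
  have hint : Tendsto (fun n => ∫⁻ x in T n, F x ∂μ) atTop (𝓝 0) :=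
    tendsto_setLIntegral_zero hfin hμT
  have hmain : ∀ n, (τ n : ℝ≥0∞) *
      μ {x | ∃ r, 0 < r ∧ r ≤ 1 ∧ (τ n : ℝ≥0∞) < ⨍⁻ y in ball x r, F y ∂μ} ≤
      2 * (D * ∫⁻ x in T n, F x ∂μ) := by
    intro n
    have hsub : {x | ∃ r, 0 < r ∧ r ≤ 1 ∧ (τ n : ℝ≥0∞) < ⨍⁻ y in ball x r, F y ∂μ} ⊆
        {x | ∃ r, 0 < r ∧ r ≤ 1 ∧ (τ n / 2 : ℝ≥0∞) < ⨍⁻ y in ball x r, (T n).indicator F y ∂μ} := by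
      rintro x ⟨r, hr, hr1, hlt⟩
      refine ⟨r, hr, hr1, ?_⟩
      by_contra hle
      rw [not_lt] at hle
      refine not_le.2 hlt ?_
      have hbx := hb x r hr
      calc ⨍⁻ y in ball x r, F y ∂μ
          ≤ ⨍⁻ y in ball x r, ((T n).indicator F y + τ n / 2) ∂μ := by
            refine laverage_mono_ae (Eventually.of_forall fun y => ?_)
            show F y ≤ (T n).indicator F y + τ n / 2
            by_cases hy : y ∈ T n
            · rw [indicator_of_mem hy]; exact le_self_add
            · rw [indicator_of_notMem hy, zero_add]
              exact (not_le.1 hy).le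
        _ = ⨍⁻ y in ball x r, (T n).indicator F y ∂μ + τ n / 2 := by
            rw [setLAverage_eq, setLAverage_eq, lintegral_add_right _ measurable_const,
              setLIntegral_const, ENNReal.add_div,
              ENNReal.mul_div_cancel_right hbx.1.ne' hbx.2.ne]
        _ ≤ τ n / 2 + τ n / 2 := add_le_add_left hle _
        _ = τ n := ENNReal.add_halves _
    have h5 := hD ((T n).indicator F) (τ n / 2)
    rw [lintegral_indicator (mT n)] at h5
    calc _ = 2 * ((τ n / 2 : ℝ≥0∞) *
          μ {x | ∃ r, 0 < r ∧ r ≤ 1 ∧ (τ n : ℝ≥0∞) < ⨍⁻ y in ball x r, F y ∂μ}) := by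
          rw [← mul_assoc, ENNReal.mul_div_cancel (by simp) (by simp)]
      _ ≤ 2 * ((τ n / 2 : ℝ≥0∞) * _) :=
          mul_le_mul_right (mul_le_mul_right (measure_mono hsub) _) _
      _ ≤ _ := mul_le_mul_right h5 _
  have hz : Tendsto (fun n => 2 * (D * ∫⁻ x in T n, F x ∂μ)) atTop (𝓝 0) := by
    have := ENNReal.Tendsto.const_mul (a := 2)
      (ENNReal.Tendsto.const_mul (a := (D : ℝ≥0∞)) hint (Or.inr ENNReal.coe_ne_top))
      (Or.inr ENNReal.ofNat_ne_top)
    simpa using this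
  exact tendsto_of_tendsto_of_tendsto_of_le_of_le tendsto_const_nhds hz (fun _ => zero_le) hmain

end Doubling

/-! ### Pointwise Lipschitz estimates from the Poincaré inequality. -/

section LipschitzApproximation

variable {X : Type*} [MetricSpace X] [MeasurableSpace X] [BorelSpace X] {μ : Measure X} {p : ℝ}

/-- One link of a telescoping chain: passing from `T` to a subset of comparable measure moves the
average by at most a multiple of the mean oscillation on `T`. -/
theorem enorm_setAverage_sub_le {f : X → ℝ} {S T : Set X} {D : ℝ≥0} (hST : S ⊆ T)
    (hS0 : μ S ≠ 0) (hS : μ S ≠ ∞) (hD : μ T ≤ D * μ S) (hf : IntegrableOn f S μ) (c : ℝ) :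
    ‖(⨍ x in S, f x ∂μ) - c‖ₑ ≤ D * ⨍⁻ x in T, ‖f x - c‖ₑ ∂μ := by
  have : IsFiniteMeasure (μ.restrict S) := ⟨by simpa using hS.lt_top⟩
  have hr0 : 0 < μ.real S := ENNReal.toReal_pos hS0 hS
  have e : (⨍ x in S, f x ∂μ) - c = ⨍ x in S, (f x - c) ∂μ := by
    rw [setAverage_eq, setAverage_eq, integral_sub hf (integrable_const c), setIntegral_const,
      smul_sub, smul_smul, inv_mul_cancel₀ hr0.ne', one_smul]
  have hT0 : μ T ≠ 0 := fun h => hS0 (measure_mono_null hST h)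
  have hDT : (μ S)⁻¹ ≤ D * (μ T)⁻¹ := by
    rw [← div_eq_mul_inv, ENNReal.le_div_iff_mul_le (Or.inl hT0)
      (Or.inl (ne_top_of_le_ne_top (ENNReal.mul_ne_top ENNReal.coe_ne_top hS) hD))]
    calc (μ S)⁻¹ * μ T ≤ (μ S)⁻¹ * (D * μ S) := mul_le_mul_right hD _
      _ = D := by rw [mul_left_comm, ENNReal.inv_mul_cancel hS0 hS, mul_one]
  have hinv : ‖(μ.real S)⁻¹‖ₑ = (μ S)⁻¹ := by
    rw [Real.enorm_eq_ofReal (inv_nonneg.2 hr0.le), ENNReal.ofReal_inv_of_pos hr0, Measure.real,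
      ENNReal.ofReal_toReal hS]
  rw [e, setAverage_eq, enorm_smul, setLAverage_eq, div_eq_mul_inv, hinv]
  calc (μ S)⁻¹ * ‖∫ x in S, (f x - c) ∂μ‖ₑ ≤ (D * (μ T)⁻¹) * ∫⁻ x in T, ‖f x - c‖ₑ ∂μ :=
        mul_le_mul' hDT ((enorm_integral_le_lintegral_enorm _).trans (lintegral_mono_set hST))
    _ = _ := by ring

theorem abs_le_of_enorm_le {a b : ℝ} (hb : 0 ≤ b) (h : ‖a‖ₑ ≤ ENNReal.ofReal b) : |a| ≤ b := by
  rw [Real.enorm_eq_ofReal_abs] at h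
  exact (ENNReal.ofReal_le_ofReal_iff hb).1 h

/-- Averages over open balls converge at almost every point. -/
theorem ae_tendsto_average_ball [SecondCountableTopology X] (hb : BallsPosFinite μ)
    (hd : IsDoubling μ) {f : X → ℝ} (hf : ∀ x r, IntegrableOn f (ball x r) μ) :
    ∀ᵐ x ∂μ, ∀ δ : ℕ → ℝ, (∀ n, 0 < δ n) → Tendsto δ atTop (𝓝 0) →
      Tendsto (fun n => ⨍ y in ball x (δ n), f y ∂μ) atTop (𝓝 (f x)) := by
  have := hd.isUnifLocDoublingMeasure
  have := hb.isLocallyFiniteMeasure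
  have hloc : LocallyIntegrable f μ := fun x => ⟨ball x 1, ball_mem_nhds x one_pos, hf x 1⟩
  obtain ⟨D, hD⟩ := hd.exists_measure_ball_le 2
  filter_upwards [IsUnifLocDoublingMeasure.ae_tendsto_average_norm_sub μ hloc 1] with x hx δ hδ hlim
  have h1 := hx (fun _ : ℕ => x) δ
    (tendsto_nhdsWithin_iff.2 ⟨hlim, Eventually.of_forall fun n => hδ n⟩)
    (Eventually.of_forall fun n => mem_closedBall_self (by rw [one_mul]; exact (hδ n).le))
  -- The differentiation theorem concerns closed balls; doubling transfers it to open ones.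
  have hle : ∀ n, |(⨍ y in ball x (δ n), f y ∂μ) - f x| ≤
      D * ⨍ y in closedBall x (δ n), ‖f y - f x‖ ∂μ := by
    intro n
    have hbx := hb x (δ n) (hδ n)
    have hfin : μ (closedBall x (δ n)) ≠ ∞ :=
      ((measure_mono (closedBall_subset_ball (lt_add_one _))).trans_lt
        (hb x (δ n + 1) (by linarith [hδ n])).2).ne
    have : IsFiniteMeasure (μ.restrict (closedBall x (δ n))) := ⟨by simpa using hfin.lt_top⟩
    have hint : IntegrableOn (fun y => ‖f y - f x‖) (closedBall x (δ n)) μ :=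
      (((hf x (δ n + 1)).mono_set (closedBall_subset_ball (lt_add_one _))).sub
        (integrable_const (f x))).norm
    refine abs_le_of_enorm_le (mul_nonneg D.2 (integral_nonneg fun _ => norm_nonneg _)) ?_
    refine (enorm_setAverage_sub_le (T := closedBall x (δ n)) (D := D) ball_subset_closedBall
      hbx.1.ne' hbx.2.ne ?_ (hf x _) (f x)).trans_eq ?_
    · exact (measure_mono (closedBall_subset_ball (by linarith [hδ n]))).trans
        (hD x (δ n) (2 * δ n) (hδ n) le_rfl)
    · rw [ENNReal.ofReal_mul D.coe_nonneg, ofReal_setAverage hint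
        (Eventually.of_forall fun _ => norm_nonneg _), setLAverage_eq, ENNReal.ofReal_coe_nnreal]
      simp only [ofReal_norm]
  rw [tendsto_iff_norm_sub_tendsto_zero]
  have hz : Tendsto (fun n => (D : ℝ) * ⨍ y in closedBall x (δ n), ‖f y - f x‖ ∂μ) atTop (𝓝 0) := by
    simpa using h1.const_mul (D : ℝ)
  exact squeeze_zero (fun _ => norm_nonneg _) hle hz

/-- The Poincaré inequality implies a pointwise Lipschitz estimate on the sublevel sets of the
maximal function of `ψ ^ p`. -/
theorem exists_pointwise_estimate [SecondCountableTopology X] (hp : 0 < p) (hb : BallsPosFinite μ)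
    (hd : IsDoubling μ) (hP : SupportsPoincare μ p) :
    ∃ (Λ R₀ : ℝ), 0 ≤ Λ ∧ 0 < R₀ ∧ ∀ (f : X → ℝ) (ψ : X → ℝ≥0∞),
      (∀ x r, IntegrableOn f (ball x r) μ) → IsUpperGradient univ f ψ →
      ∃ N : Set X, μ N = 0 ∧ ∀ (l : ℝ≥0) (x y : X), x ∉ N → y ∉ N →
        (∀ r, 0 < r → r ≤ 1 → ⨍⁻ z in ball x r, ψ z ^ p ∂μ ≤ (l : ℝ≥0∞) ^ p) →
        (∀ r, 0 < r → r ≤ 1 → ⨍⁻ z in ball y r, ψ z ^ p ∂μ ≤ (l : ℝ≥0∞) ^ p) →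
        dist x y ≤ R₀ → |f x - f y| ≤ Λ * l * dist x y := by
  obtain ⟨C, σ, hσ, hPI⟩ := hP
  obtain ⟨D, hD⟩ := hd.exists_measure_ball_le 3
  have σ0 : 0 < σ := by linarith
  -- With `d = dist x y`, telescoping over halved radii costs `2 D C l r`, with `r = 2 d` at `x` and
  -- `r = d` at `y`. The step between the balls of radius `2 d` at `x` and `d` at `y` costs `2 D C l
  -- d`. The choice of `R₀` keeps all radii, multiplied by `σ`, at most `1`.
  refine ⟨2 * D * C * 3 + D * C * 2, 1 / (2 * σ), by positivity, by positivity,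
    fun f ψ hf hψ => ?_⟩
  refine ⟨_, ae_tendsto_average_ball hb hd hf, fun l x y hx hy hMx hMy hxy => ?_⟩
  rw [mem_compl_iff, not_not] at hx hy
  set A : X → ℝ → ℝ := fun z r => ⨍ y in ball z r, f y ∂μ with hA
  have osc : ∀ z : X, (∀ r, 0 < r → r ≤ 1 → ⨍⁻ w in ball z r, ψ w ^ p ∂μ ≤ (l : ℝ≥0∞) ^ p) →
      ∀ r, 0 < r → σ * r ≤ 1 → ∀ (w : X) (s : ℝ), 0 < s → ball w s ⊆ ball z r →
        μ (ball z r) ≤ D * μ (ball w s) → |A w s - A z r| ≤ D * C * r * l := by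
    intro z hM r hr hr1 w s hs hsub hDle
    refine abs_le_of_enorm_le (by positivity) ?_
    have hws := hb w s hs
    refine (enorm_setAverage_sub_le hsub hws.1.ne' hws.2.ne hDle (hf w s) (A z r)).trans ?_
    have h1 := hPI f ψ hf hψ z r hr
    have h2 := hM (σ * r) (by positivity) hr1
    have h3 : (⨍⁻ w in ball z (σ * r), ψ w ^ p ∂μ) ^ (1 / p) ≤ (l : ℝ≥0∞) := by
      refine (ENNReal.rpow_le_rpow h2 (by positivity)).trans_eq ?_
      rw [← ENNReal.rpow_mul, mul_one_div_cancel hp.ne', ENNReal.rpow_one]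
    simp only [← Real.enorm_eq_ofReal_abs] at h1
    have e : ENNReal.ofReal (D * C * r * l) = D * (C * ENNReal.ofReal r * l) := by
      rw [ENNReal.ofReal_mul (by positivity), ENNReal.ofReal_mul (by positivity),
        ENNReal.ofReal_mul (by positivity), ENNReal.ofReal_coe_nnreal, ENNReal.ofReal_coe_nnreal,
        ENNReal.ofReal_coe_nnreal]
      ring
    rw [e]
    exact mul_le_mul_right (h1.trans (mul_le_mul_right h3 _)) _
  have chain : ∀ z : X, (∀ δ : ℕ → ℝ, (∀ n, 0 < δ n) → Tendsto δ atTop (𝓝 0) →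
      Tendsto (fun n => A z (δ n)) atTop (𝓝 (f z))) →
      (∀ r, 0 < r → r ≤ 1 → ⨍⁻ w in ball z r, ψ w ^ p ∂μ ≤ (l : ℝ≥0∞) ^ p) →
      ∀ r, 0 < r → σ * r ≤ 1 → |f z - A z r| ≤ 2 * (D * C * l) * r := by
    intro z hz hM r hr hr1
    have hhalf : ∀ n : ℕ, 0 < r * (1 / 2) ^ n := fun n => by positivity
    have hlim : Tendsto (fun n : ℕ => r * (1 / 2) ^ n) atTop (𝓝 0) := by
      simpa using (tendsto_pow_atTop_nhds_zero_of_lt_one (r := (1 / 2 : ℝ)) (by norm_num)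
        (by norm_num)).const_mul r
    have h1 := hz _ hhalf hlim
    have hind : ∀ n : ℕ, |A z (r * (1 / 2) ^ n) - A z r| ≤
        2 * (D * C * l) * r * (1 - (1 / 2) ^ n) := by
      intro n
      induction n with
      | zero => simp
      | succ n ih =>
        have hle : (1 / 2 : ℝ) ^ n ≤ 1 := pow_le_one₀ (by norm_num) (by norm_num)
        have h2 := osc z hM (r * (1 / 2) ^ n) (hhalf n)
          (by
            refine le_trans ?_ hr1
            have : r * (1 / 2) ^ n ≤ r := mul_le_of_le_one_right hr.le hle
            exact mul_le_mul_of_nonneg_left this σ0.le) z (r * (1 / 2) ^ (n + 1)) (hhalf _)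
          (ball_subset_ball (by
            rw [pow_succ]
            have := hhalf n
            linarith))
          (hD z _ _ (hhalf _) (by
            rw [pow_succ]
            have := hhalf n
            linarith))
        have h3 := abs_sub_le (A z (r * (1 / 2) ^ (n + 1))) (A z (r * (1 / 2) ^ n)) (A z r)
        rw [pow_succ] at h2 h3 ⊢
        nlinarith
    have h2 : ∀ n : ℕ, |A z (r * (1 / 2) ^ n) - A z r| ≤ 2 * (D * C * l) * r := fun n => by
      refine (hind n).trans (mul_le_of_le_one_right (by positivity) ?_)
      have : (0 : ℝ) ≤ (1 / 2) ^ n := by positivity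
      linarith
    exact le_of_tendsto' ((h1.sub_const _).abs) h2
  rcases (dist_nonneg (x := x) (y := y)).eq_or_lt with h0 | h0
  · rw [← h0, dist_eq_zero.1 h0.symm]; simp
  set d := dist x y with hd'
  have hσd : σ * (2 * d) ≤ 1 := by
    have := mul_le_mul_of_nonneg_left hxy (show 0 ≤ 2 * σ by positivity)
    rw [mul_one_div_cancel (by positivity)] at this
    linarith
  have hsd : σ * d ≤ 1 := by nlinarith
  have e1 := chain x hx hMx (2 * d) (by positivity) hσd
  have e2 := chain y hy hMy d h0 hsd
  have e3 := osc x hMx (2 * d) (by positivity) hσd y d h0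
    (ball_subset_ball' (by rw [dist_comm y x]; linarith))
    ((measure_mono (ball_subset_ball' (by linarith))).trans (hD y d (3 * d) h0 le_rfl))
  have t2 : |f x - f y| ≤ |f x - A x (2 * d)| + |A y d - A x (2 * d)| + |f y - A y d| := by
    have q1 := abs_le.1 (le_refl |f x - A x (2 * d)|)
    have q2 := abs_le.1 (le_refl |A y d - A x (2 * d)|)
    have q3 := abs_le.1 (le_refl |f y - A y d|)
    rw [abs_le]
    constructor <;> linarith [q1.1, q1.2, q2.1, q2.2, q3.1, q3.2]
  have : (2 * D * C * 3 + D * C * 2) * l * d =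
      2 * (D * C * l) * (2 * d) + D * C * (2 * d) * l + 2 * (D * C * l) * d := by ring
  rw [this]
  linarith

end LipschitzApproximation

/-! ### Approximation of bounded Newtonian functions by Lipschitz functions. -/

section LipschitzApproximation

variable {X : Type*} [MetricSpace X] [MeasurableSpace X] [BorelSpace X] {μ : Measure X} {p : ℝ}

theorem isUpperGradient_of_lipschitzWith {f : X → ℝ} {K : ℝ≥0} (hf : LipschitzWith K f)
    (Ω : Set X) : IsUpperGradient Ω f fun _ => K := by
  refine ⟨measurable_const, fun γ _ _ => ?_⟩
  rw [UpperGradientIneq, γ.integral_const, ← Real.dist_eq, ← edist_dist]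
  refine (hf _ _).trans (mul_le_mul_right ?_ _)
  have h := γ.lipschitzOnWith (left_mem_Icc.2 γ.len_nonneg) (right_mem_Icc.2 γ.len_nonneg)
  rw [ENNReal.coe_one, one_mul, edist_dist 0, Real.dist_eq, zero_sub, abs_neg,
    abs_of_nonneg γ.len_nonneg] at h
  exact h

theorem IsUpperGradient.isWeakUpperGradient (hp : 1 < p) {Ω : Set X} {f : X → ℝ} {g : X → ℝ≥0∞}
    (h : IsUpperGradient Ω f g) : IsWeakUpperGradient μ p Ω f g := by
  refine (isWeakUpperGradient_iff hp).2 ⟨h.1, fun _ => 0, measurable_const, ?_, fun γ hγ _ => ?_⟩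
  · simp [zero_lt_one.trans hp]
  · rcases γ.len_nonneg.eq_or_lt with h0 | h0
    · exact upperGradientIneq_of_len_eq_zero h0.symm
    · exact h.2 γ h0 hγ

/-- A weak upper gradient on the whole space becomes an upper gradient when a function in `L^p` is
added. -/
theorem IsWeakUpperGradient.exists_isUpperGradient (hp : 1 < p) {f : X → ℝ} {g : X → ℝ≥0∞}
    (h : IsWeakUpperGradient μ p univ f g) (hg : ∫⁻ x, g x ^ p ∂μ ≠ ∞) :
    ∃ ψ : X → ℝ≥0∞, IsUpperGradient univ f ψ ∧ ∫⁻ x, ψ x ^ p ∂μ ≠ ∞ := by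
  have p0 : 0 < p := zero_lt_one.trans hp
  obtain ⟨gm, ρ, mρ, iρ, H⟩ := (isWeakUpperGradient_iff hp).1 h
  obtain ⟨ψ, mψ, iψ, hle⟩ := exists_lp_majorant (μ := μ) p0 (fun b : Bool => cond b g ρ)
    (fun b => by cases b <;> assumption)
  refine ⟨ψ, ⟨mψ, fun γ _ hγ => ?_⟩, ?_⟩
  · by_cases hfin : γ.integral ψ = ∞
    · rw [UpperGradientIneq, hfin]; exact le_top
    · exact (H γ hγ (ne_top_of_le_ne_top hfin (γ.integral_mono' (hle false)))).trans
        (γ.integral_mono' (hle true))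
  · rw [iψ, tsum_bool]
    exact ENNReal.add_ne_top.2 ⟨iρ, hg⟩

/-- Bounded Newtonian functions that vanish off a ball can be approximated by Lipschitz functions
that vanish off a slightly larger ball. -/
theorem exists_lipschitz_approximation [ProperSpace X] (hp : 1 < p) (hb : BallsPosFinite μ)
    (hd : IsDoubling μ) (hP : SupportsPoincare μ p) {f : X → ℝ} (hfm : Measurable f) {M : ℝ}
    (hM : ∀ x, |f x| ≤ M) {x₀ : X} {r₀ r₁ : ℝ} (hr : r₀ < r₁)
    (hf0 : ∀ x, x ∉ ball x₀ r₀ → f x = 0) {ψ : X → ℝ≥0∞} (hψ : IsUpperGradient univ f ψ)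
    (hfin : ∫⁻ x, ψ x ^ p ∂μ ≠ ∞) {ε : ℝ≥0∞} (hε : 0 < ε) :
    ∃ (f' : X → ℝ) (k : X → ℝ≥0∞), (∃ K : ℝ≥0, LipschitzWith K f') ∧
      (∀ x, x ∉ ball x₀ r₁ → f' x = 0) ∧
      IsWeakUpperGradient μ p univ (fun x => f x - f' x) k ∧ ∫⁻ x, k x ^ p ∂μ < ε := by
  have p0 : 0 < p := zero_lt_one.trans hp
  have := hb.isLocallyFiniteMeasure
  have M0 : 0 ≤ M := (abs_nonneg _).trans (hM x₀)
  have hint : ∀ x r, IntegrableOn f (ball x r) μ := by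
    intro x r
    have : IsFiniteMeasure (μ.restrict (ball x r)) := ⟨by simpa using measure_ball_lt_top⟩
    exact Integrable.of_bound hfm.aestronglyMeasurable M (Eventually.of_forall hM)
  obtain ⟨Λ, R₀, hΛ, hR₀, hest⟩ := exists_pointwise_estimate p0 hb hd hP
  obtain ⟨N, hN, hpt⟩ := hest f ψ hint hψ
  set τ : ℕ → ℝ≥0 := fun n => (n : ℝ≥0) ^ p with hτ
  have hτc : ∀ n, ((τ n : ℝ≥0) : ℝ≥0∞) = (n : ℝ≥0∞) ^ p := fun n => by
    simp only [hτ]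
    rw [ENNReal.coe_rpow_of_nonneg _ p0.le, ENNReal.coe_natCast]
  have hτlim : Tendsto τ atTop atTop :=
    (NNReal.tendsto_rpow_atTop p0).comp tendsto_natCast_atTop_atTop
  set B : ℕ → Set X := fun n =>
    {x | ∃ r, 0 < r ∧ r ≤ 1 ∧ (τ n : ℝ≥0∞) < ⨍⁻ y in ball x r, ψ y ^ p ∂μ} with hB
  -- Off `B n` the function is Lipschitz with a constant of order `n`. The extension therefore has
  -- energy of order `n ^ p * μ (B n)` on the bad set, and this tends to `0`.
  have hBlim := tendsto_mul_measure_maximal hb hd (hψ.1.pow_const p) hfin hτlim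
  change Tendsto (fun n => (τ n : ℝ≥0∞) * μ (B n)) atTop (𝓝 0) at hBlim
  have hμB : Tendsto (fun n => μ (B n)) atTop (𝓝 0) := by
    refine tendsto_of_tendsto_of_tendsto_of_le_of_le' tendsto_const_nhds hBlim
      (Eventually.of_forall fun _ => zero_le) ?_
    filter_upwards [hτlim.eventually_ge_atTop 1] with n hn
    calc μ (B n) = 1 * μ (B n) := (one_mul _).symm
      _ ≤ _ := mul_le_mul_left (by exact_mod_cast hn) _
  set T : ℕ → Set X := fun n => toMeasurable μ (B n) with hT
  have mT : ∀ n, MeasurableSet (T n) := fun n => measurableSet_toMeasurable _ _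
  have μT : ∀ n, μ (T n) = μ (B n) := fun n => measure_toMeasurable _
  have hT1 : Tendsto (fun n => ∫⁻ x in T n, ψ x ^ p ∂μ) atTop (𝓝 0) :=
    tendsto_setLIntegral_zero hfin (by simpa only [Function.comp_def, μT] using hμB)
  have hsub : 0 < r₁ - r₀ := sub_pos.2 hr
  -- The summands account for pairs at distance at most `R₀`, for pairs farther apart, where `|f| ≤
  -- M` suffices, and for pairs separated by the annulus between `r₀` and `r₁`.
  obtain ⟨c, hc⟩ : ∃ c : ℝ≥0, (c : ℝ) = Λ + 2 * M / R₀ + M / (r₁ - r₀) :=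
    ⟨_, Real.coe_toNNReal _ (by positivity)⟩
  have hlim : Tendsto (fun n => 2 ^ (p - 1) * (∫⁻ x in T n, ψ x ^ p ∂μ +
      (c : ℝ≥0∞) ^ p * ((τ n : ℝ≥0∞) * μ (B n)))) atTop (𝓝 0) := by
    have h1 := hT1.add (ENNReal.Tendsto.const_mul (a := (c : ℝ≥0∞) ^ p) hBlim
      (Or.inr (ENNReal.rpow_ne_top_of_nonneg p0.le ENNReal.coe_ne_top)))
    have h2 := ENNReal.Tendsto.const_mul (a := 2 ^ (p - 1)) h1
      (Or.inr (ENNReal.rpow_ne_top_of_nonneg (by linarith) ENNReal.ofNat_ne_top))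
    simpa using h2
  obtain ⟨n, hn, hn1⟩ := ((hlim.eventually_lt_const hε).and (eventually_ge_atTop 1)).exists
  have hn1' : (1 : ℝ) ≤ n := by exact_mod_cast hn1
  -- Including the complement of the larger ball forces the Lipschitz extension to vanish there.
  set S : Set X := (T n ∪ N)ᶜ ∪ (ball x₀ r₁)ᶜ with hS
  have cn : (c : ℝ) * n = Λ * n + 2 * M / R₀ * n + M / (r₁ - r₀) * n := by
    rw [hc]; ring
  have good : ∀ x ∉ T n, ∀ r, 0 < r → r ≤ 1 →
      ⨍⁻ z in ball x r, ψ z ^ p ∂μ ≤ ((n : ℝ≥0) : ℝ≥0∞) ^ p := by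
    intro x hx r hr hr1
    by_contra hlt
    refine hx (subset_toMeasurable μ (B n) ⟨r, hr, hr1, ?_⟩)
    rw [hτc]
    simpa using hlt
  have a0 : 0 ≤ Λ * n := by positivity
  have a1 : 0 ≤ 2 * M / R₀ * n := by positivity
  have a2 : 0 ≤ M / (r₁ - r₀) * n := by positivity
  have mixed : ∀ x, ∀ y ∉ ball x₀ r₁, |f x - f y| ≤ c * n * dist x y := by
    intro x y hy
    rw [hf0 y fun h => hy (ball_subset_ball hr.le h), sub_zero]
    by_cases hx : x ∈ ball x₀ r₀
    · have h1 : r₁ - r₀ ≤ dist x y := by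
        rw [mem_ball] at hx hy
        have := dist_triangle_left y x₀ x
        rw [not_lt] at hy
        linarith
      have h2 : M ≤ M / (r₁ - r₀) * n * dist x y := by
        calc M = M / (r₁ - r₀) * 1 * (r₁ - r₀) := by field_simp
          _ ≤ _ := by gcongr
      refine (hM x).trans (h2.trans ?_)
      rw [cn]
      exact mul_le_mul_of_nonneg_right (by linarith) dist_nonneg
    · rw [hf0 x hx, abs_zero]; positivity
  have hlip : LipschitzOnWith (c * n) f S := by
    refine LipschitzOnWith.of_dist_le_mul fun x hx y hy => ?_
    rw [Real.dist_eq]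
    push_cast
    rcases hy with hy | hy
    · rcases hx with hx | hx
      · by_cases hxy : dist x y ≤ R₀
        · refine (hpt n x y (fun h => hx (Or.inr h)) (fun h => hy (Or.inr h))
            (good x fun h => hx (Or.inl h)) (good y fun h => hy (Or.inl h)) hxy).trans ?_
          rw [cn, NNReal.coe_natCast]
          exact mul_le_mul_of_nonneg_right (by linarith) dist_nonneg
        · have h1 : |f x - f y| ≤ 2 * M := by
            have := abs_sub (f x) (f y)
            linarith [hM x, hM y]
          have h2 : 2 * M ≤ 2 * M / R₀ * n * dist x y := by
            calc 2 * M = 2 * M / R₀ * 1 * R₀ := by field_simp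
              _ ≤ _ := by gcongr; exact (not_le.1 hxy).le
          refine h1.trans (h2.trans ?_)
          rw [cn]
          exact mul_le_mul_of_nonneg_right (by linarith) dist_nonneg
      · rw [abs_sub_comm, dist_comm]; exact mixed y x hx
    · exact mixed x y hy
  obtain ⟨f', hf'lip, hf'eq⟩ := hlip.extend_real
  have hKc : ((c * n : ℝ≥0) : ℝ≥0∞) = c * n := by push_cast; rfl
  refine ⟨f', (T n).indicator fun x => ψ x + (c * n : ℝ≥0), ⟨_, hf'lip⟩, fun x hx => ?_, ?_, ?_⟩
  · rw [← hf'eq (Or.inr hx)]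
    exact hf0 x fun h => hx (ball_subset_ball hr.le h)
  · have w1 : IsWeakUpperGradient μ p univ (fun x => f x - f' x)
        fun x => ψ x + (c * n : ℝ≥0) := by
      refine (hψ.isWeakUpperGradient hp).add hp
        ((isUpperGradient_of_lipschitzWith hf'lip univ).isWeakUpperGradient hp) fun x _ y _ => ?_
      have : f x - f' x - (f y - f' y) = (f x - f y) - (f' x - f' y) := by ring
      rw [this]
      exact abs_sub _ _
    have l1 : LocLp μ p univ fun x => ψ x + (c * n : ℝ≥0) :=
      (locLp_of_lintegral_ne_top isOpen_univ hfin).add hp.le hψ.1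
        (locLp_const hb p0.le isOpen_univ _)
    have w2 : IsWeakUpperGradient μ p univ (fun _ => (0 : ℝ)) fun _ : X => ((0 : ℝ≥0) : ℝ≥0∞) :=
      (isUpperGradient_of_lipschitzWith (LipschitzWith.const (0 : ℝ)) univ).isWeakUpperGradient hp
    -- Almost everywhere off `T n` the difference `f - f'` is zero, so by gluing its weak upper
    -- gradient may be set to `0` there.
    refine w1.glue hp l1 w2 (locLp_const hb p0.le isOpen_univ 0) (A := (T n)ᶜ) ?_ ?_
      ((hψ.1.add measurable_const).indicator (mT n))
    · filter_upwards [compl_mem_ae_iff.2 hN] with x hx _ hxT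
      refine ⟨sub_eq_zero.2 (hf'eq (Or.inl ?_)), by simp⟩
      rintro (h | h)
      exacts [hxT h, hx h]
    · refine Eventually.of_forall fun x _ hx => ?_
      rw [notMem_compl_iff] at hx
      rw [indicator_of_mem hx]
  · refine lt_of_le_of_lt ?_ hn
    have e : ∀ x, ((T n).indicator (fun x => ψ x + (c * n : ℝ≥0)) x) ^ p =
        (T n).indicator (fun x => (ψ x + (c * n : ℝ≥0)) ^ p) x := fun x => by
      by_cases hx : x ∈ T n <;> simp [hx, p0]
    simp only [e]
    rw [lintegral_indicator (mT n)]
    have hb : ∀ y, (ψ y + (c * n : ℝ≥0)) ^ p ≤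
        2 ^ (p - 1) * (ψ y ^ p + ((c * n : ℝ≥0) : ℝ≥0∞) ^ p) := fun y =>
      ENNReal.rpow_add_le_mul_rpow_add_rpow _ _ hp.le
    refine (lintegral_mono hb).trans ?_
    rw [lintegral_const_mul' _ _
        (ENNReal.rpow_ne_top_of_nonneg (by linarith) ENNReal.ofNat_ne_top),
      lintegral_add_left (hψ.1.pow_const p), setLIntegral_const, μT, hKc,
      ENNReal.mul_rpow_of_nonneg _ _ p0.le, hτc, mul_assoc]

end LipschitzApproximation

/-! ### Energy minimality against competitors that need not be Lipschitz perturbations. -/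

section Minimality

variable {X : Type*} [MetricSpace X] [MeasurableSpace X] [BorelSpace X] {μ : Measure X} {p : ℝ}
  {Ω : Set X}

theorem IsWeakUpperGradient.mono (hp : 1 < p) {V : Set X} {f : X → ℝ} {g g' : X → ℝ≥0∞}
    (h : IsWeakUpperGradient μ p Ω f g) (hV : V ⊆ Ω) (hg : ∀ x ∈ V, g x ≤ g' x)
    (hm : Measurable g') : IsWeakUpperGradient μ p V f g' := by
  obtain ⟨-, ρ, mρ, iρ, H⟩ := (isWeakUpperGradient_iff hp).1 h
  exact (isWeakUpperGradient_iff hp).2 ⟨hm, ρ, mρ, iρ, fun γ hγ hfin =>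
    (H γ (hγ.trans hV) hfin).trans (γ.integral_mono hγ hg)⟩

theorem IsWeakUpperGradient.congr {f f' : X → ℝ} {g : X → ℝ≥0∞}
    (h : IsWeakUpperGradient μ p Ω f g) (hf : ∀ x ∈ Ω, f' x = f x) :
    IsWeakUpperGradient μ p Ω f' g := by
  obtain ⟨hm, Γ, hΓ, H⟩ := h
  refine ⟨hm, Γ, hΓ, fun γ h0 hγ hγΓ => ?_⟩
  rw [UpperGradientIneq, hf _ (hγ γ.zero_mem_trace), hf _ (hγ γ.len_mem_trace)]
  exact H γ h0 hγ hγΓ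

theorem isWeakUpperGradient_of_eq_zero (hp : 1 < p) {f : X → ℝ} {g : X → ℝ≥0∞}
    (hf : ∀ x ∈ Ω, f x = 0) (hm : Measurable g) : IsWeakUpperGradient μ p Ω f g := by
  refine IsWeakUpperGradient.congr (f := fun _ => (0 : ℝ)) ?_ hf
  exact ((isUpperGradient_of_lipschitzWith (LipschitzWith.const (0 : ℝ)) Ω).isWeakUpperGradient
    hp).mono hp subset_rfl (fun x _ => by simp) hm

/-- A `p`-harmonic function has the smallest energy among all the functions with the same values
off a ball. -/
theorem IsPHarmonic.lintegral_le [ProperSpace X] (hp : 1 < p) (hb : BallsPosFinite μ)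
    (hd : IsDoubling μ) (hP : SupportsPoincare μ p) (hΩ : IsOpen Ω) {u : X → ℝ}
    (hu : IsPHarmonic μ p Ω u) {g : X → ℝ≥0∞} (hg : IsMinimalWeakUpperGradient μ p Ω u g)
    {x₀ : X} {r₀ r₁ : ℝ} (hr : r₀ < r₁) (hK : closedBall x₀ r₁ ⊆ Ω) {v : X → ℝ}
    (hvm : Measurable fun x => v x - u x) {M : ℝ} (hM : ∀ x, |v x - u x| ≤ M)
    (hv : ∀ x, x ∉ ball x₀ r₀ → v x = u x) {h : X → ℝ≥0∞} (hh : IsWeakUpperGradient μ p Ω v h)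
    (hl : LocLp μ p Ω h) :
    (∫⁻ x in closedBall x₀ r₁, g x ^ p ∂μ) ^ (1 / p) ≤
      (∫⁻ x in closedBall x₀ r₁, h x ^ p ∂μ) ^ (1 / p) := by
  have p0 : 0 < p := zero_lt_one.trans hp
  have := hb.isLocallyFiniteMeasure
  set K := closedBall x₀ r₁ with hKdef
  have mK : MeasurableSet K := measurableSet_closedBall
  have hm : Measurable fun x => h x + g x := hh.1.add hg.1.1
  have mind : Measurable (K.indicator fun x => h x + g x) := hm.indicator mK
  -- Since `v - u` vanishes off the smaller ball, two overlapping open sets cover the space: in one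
  -- `h + g` works, in the other anything does.
  have hw : IsWeakUpperGradient μ p univ (fun x => v x - u x) (K.indicator fun x => h x + g x) := by
    refine IsWeakUpperGradient.of_cover hp (V := fun b => cond b (ball x₀ r₁) (closedBall x₀ r₀)ᶜ)
      (fun b => ?_) (fun x _ => ?_) fun b => ?_
    · cases b
      exacts [isClosed_closedBall.isOpen_compl, isOpen_ball]
    · rw [mem_iUnion]
      by_cases hx : x ∈ closedBall x₀ r₀
      · exact ⟨true, closedBall_subset_ball hr hx⟩
      · exact ⟨false, hx⟩
    · cases b
      · refine isWeakUpperGradient_of_eq_zero hp (fun x hx => sub_eq_zero.2 (hv x fun hx' => ?_))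
          mind
        exact hx (ball_subset_closedBall hx')
      · have := hh.add hp hg.1 (f := fun x => v x - u x) fun x _ y _ => by
          have : v x - u x - (v y - u y) = (v x - v y) - (u x - u y) := by ring
          rw [this]
          exact abs_sub _ _
        exact this.mono hp (ball_subset_closedBall.trans hK)
          (fun x hx => by rw [indicator_of_mem (ball_subset_closedBall hx : x ∈ K)]) mind
  have hfin : ∫⁻ x, (K.indicator fun x => h x + g x) x ^ p ∂μ ≠ ∞ := by
    have e : ∀ x, ((K.indicator fun x => h x + g x) x) ^ p =
        K.indicator (fun x => (h x + g x) ^ p) x := fun x => by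
      by_cases hx : x ∈ K <;> simp [hx, p0]
    simp only [e]
    rw [lintegral_indicator mK]
    exact ((hl.add hp.le hh.1 hg.2.1).lintegral_lt_top (isCompact_closedBall x₀ r₁) hK).ne
  obtain ⟨ψ, hψ, hψfin⟩ := hw.exists_isUpperGradient hp hfin
  obtain ⟨r', hr', hr''⟩ := exists_between hr
  refine ENNReal.le_of_forall_pos_le_add fun δ hδ _ => ?_
  -- The admissible test function `f'` replaces `v - u`, and `h + k` is then a weak upper gradient
  -- of `u + f'`. The intermediate radius `r'` keeps the support of `f'` inside `K`.
  obtain ⟨f', k, hlip, hsupp, hk, hkε⟩ := exists_lipschitz_approximation hp hb hd hP hvm hM hr'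
    (fun x hx => sub_eq_zero.2 (hv x hx)) hψ hψfin (ε := (δ : ℝ≥0∞) ^ p)
    (ENNReal.rpow_pos (by exact_mod_cast hδ) ENNReal.coe_ne_top)
  have hsub : Function.support f' ⊆ ball x₀ r' := fun x hx => by
    by_contra hx'
    exact hx (hsupp x hx')
  have htsub : tsupport f' ⊆ closedBall x₀ r' :=
    (closure_mono hsub).trans closure_ball_subset_closedBall
  have hcs : HasCompactSupport f' :=
    (isCompact_closedBall x₀ r').of_isClosed_subset (isClosed_tsupport f') htsub
  have htΩ : tsupport f' ⊆ Ω := htsub.trans ((closedBall_subset_closedBall hr''.le).trans hK)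
  have hwk : IsWeakUpperGradient μ p Ω (fun x => u x + f' x) fun x => h x + k x := by
    refine hh.add hp (hk.mono hp (subset_univ Ω) (fun x _ => le_rfl) hk.1) fun x _ y _ => ?_
    have : u x + f' x - (u y + f' y) =
        (v x - v y) - ((v x - u x - f' x) - (v y - u y - f' y)) := by ring
    rw [this]
    exact abs_sub _ _
  have hlk : LocLp μ p Ω fun x => h x + k x :=
    hl.add hp.le hh.1 (locLp_of_lintegral_ne_top hΩ (hkε.trans_le le_top).ne)
  obtain ⟨m, hmm⟩ := exists_isMinimalWeakUpperGradient hp hΩ hwk hlk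
  have h1 := hu.2.2 f' hlip hcs htΩ g m hg hmm
  have cont : Continuous f' := by
    obtain ⟨C, hC⟩ := hlip
    exact hC.continuous
  have mZ : MeasurableSet {x | f' x ≠ 0} := (isOpen_ne_fun cont continuous_const).measurableSet
  have h2 : ∫⁻ x in {x | f' x ≠ 0}, m x ^ p ∂μ ≤
      ∫⁻ x in {x | f' x ≠ 0}, (h x + k x) ^ p ∂μ := by
    refine setLIntegral_mono_ae ((hh.1.add hk.1).pow_const p).aemeasurable ?_
    filter_upwards [hmm.2.2 _ hwk hlk] with x hx hx0
    exact ENNReal.rpow_le_rpow (hx (htΩ (subset_tsupport f' hx0))) p0.le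
  -- Harmonicity compares energies only where `f' ≠ 0`. Elsewhere `u + f' = u`, and locality of
  -- minimal weak upper gradients gives the pointwise comparison.
  have h3 := hg.le_of_eq hp hwk hlk (A := {x | f' x ≠ 0}ᶜ) mZ.compl fun x hx => by
    rw [mem_compl_iff, mem_ofPred_eq, not_not] at hx
    rw [hx, add_zero]
  have hZK : K ∩ {x | f' x ≠ 0} = {x | f' x ≠ 0} := by
    refine inter_eq_right.2 fun x hx => ?_
    exact closedBall_subset_closedBall hr''.le (ball_subset_closedBall (hsub hx))
  have h4 : ∫⁻ x in K, g x ^ p ∂μ ≤ ∫⁻ x in K, (h x + k x) ^ p ∂μ := by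
    rw [← lintegral_inter_add_sdiff _ K mZ, ← lintegral_inter_add_sdiff (fun x => (h x + k x) ^ p) K
      mZ, hZK]
    refine add_le_add (h1.trans h2) ?_
    refine setLIntegral_mono_ae ((hh.1.add hk.1).pow_const p).aemeasurable ?_
    filter_upwards [h3] with x hx hxK
    exact ENNReal.rpow_le_rpow (hx (hK hxK.1) hxK.2) p0.le
  calc (∫⁻ x in K, g x ^ p ∂μ) ^ (1 / p) ≤ (∫⁻ x in K, (h x + k x) ^ p ∂μ) ^ (1 / p) :=
        ENNReal.rpow_le_rpow h4 (by positivity)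
    _ ≤ (∫⁻ x in K, h x ^ p ∂μ) ^ (1 / p) + (∫⁻ x in K, k x ^ p ∂μ) ^ (1 / p) :=
        ENNReal.lintegral_Lp_add_le hh.1.aemeasurable hk.1.aemeasurable hp.le
    _ ≤ (∫⁻ x in K, h x ^ p ∂μ) ^ (1 / p) + δ := by
        gcongr
        calc (∫⁻ x in K, k x ^ p ∂μ) ^ (1 / p) ≤ ((δ : ℝ≥0∞) ^ p) ^ (1 / p) :=
              ENNReal.rpow_le_rpow ((setLIntegral_le_lintegral _ _).trans hkε.le) (by positivity)
          _ = δ := by rw [← ENNReal.rpow_mul, mul_one_div_cancel p0.ne', ENNReal.rpow_one]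

end Minimality

/-! ### Compactness of gradient paths and extraction of gradient curves. -/

section GradientPaths

variable {X : Type*} [MetricSpace X] [MeasurableSpace X] [BorelSpace X]

/-- `f` is approximated from above on `K` by lower semicontinuous functions, with errors controlled
by `H`. This makes the curve integrals of `f` lower semicontinuous on the curves along which the
integral of `H` is bounded. -/
structure LscApproximation (K : Set X) (f H : X → ℝ≥0∞) (F : ℕ → X → ℝ≥0∞) : Prop where
  measurable : Measurable f
  lsc_control : LowerSemicontinuous H
  one_le_control : ∀ x ∈ K, 1 ≤ H x
  lsc : ∀ n, LowerSemicontinuous (F n)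
  le_approx : ∀ n, ∀ x ∈ K, f x ≤ F n x
  approx_le : ∀ n, ∀ x ∈ K, F n x ≤ f x + (2⁻¹ : ℝ≥0∞) ^ n * H x

/-- A curve in `K` that starts off `U`, has the integral of `H` bounded by `L`, and realizes equality
in the upper gradient inequality. -/
structure IsGradientPath (K U : Set X) (u : X → ℝ) (g H : X → ℝ≥0∞) (L : ℝ≥0) (γ : RectCurve X) :
    Prop where
  trace_subset : γ.trace ⊆ K
  start_notMem : γ.toFun 0 ∉ U
  control_le : γ.integral H ≤ L
  integral_le : γ.integral g ≤ ENNReal.ofReal |u (γ.toFun 0) - u (γ.toFun γ.len)|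

variable {K U : Set X} {u : X → ℝ} {g H : X → ℝ≥0∞} {G : ℕ → X → ℝ≥0∞} {L : ℝ≥0}

theorem LscApproximation.len_le (h : LscApproximation K g H G) {γ : RectCurve X}
    (hγ : γ.trace ⊆ K) (hL : γ.integral H ≤ L) : γ.len ≤ L := by
  have h1 := (γ.integral_mono hγ (ρ := fun _ => 1) h.one_le_control).trans hL
  rw [γ.integral_const, one_mul] at h1
  have h2 := ENNReal.toReal_mono ENNReal.coe_ne_top h1
  rwa [ENNReal.toReal_ofReal γ.len_nonneg, ENNReal.coe_toReal] at h2

/-- Limits of almost gradient paths are gradient paths. -/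
theorem LscApproximation.exists_limit (h : LscApproximation K g H G) (hK : IsCompact K)
    (hU : IsOpen U) (hu : ContinuousOn u K) (γ : ℕ → RectCurve X) {δ : ℕ → ℝ≥0∞}
    (hδ : Tendsto δ atTop (𝓝 0)) (hγK : ∀ i, (γ i).trace ⊆ K) (hγU : ∀ i, (γ i).toFun 0 ∉ U)
    (hγH : ∀ i, (γ i).integral H ≤ L)
    (hγg : ∀ i, (γ i).integral g ≤
      ENNReal.ofReal |u ((γ i).toFun 0) - u ((γ i).toFun (γ i).len)| + δ i) :
    ∃ (φ : ℕ → ℕ) (γ' : RectCurve X) (l : ℝ), StrictMono φ ∧ IsGradientPath K U u g H L γ' ∧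
      Tendsto (fun i => (γ (φ i)).toFun (γ (φ i)).len) atTop (𝓝 (γ'.toFun γ'.len)) ∧
      Tendsto (fun i => (γ (φ i)).len) atTop (𝓝 l) ∧ γ'.len ≤ l := by
  obtain ⟨φ, γ', l, hφ, htr, h0, h1, hl, hle, hlsc⟩ := RectCurve.exists_subseq_limit hK γ hγK
    (L := L) fun i => h.len_le (hγK i) (hγH i)
  refine ⟨φ, γ', l, hφ, ⟨htr, ?_, ?_, ?_⟩, h1, hl, hle⟩
  · exact hU.isClosed_compl.mem_of_tendsto h0 (Eventually.of_forall fun i => hγU _)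
  · exact (hlsc H h.lsc_control).trans
      (liminf_le_of_le (by isBoundedDefault) fun b hb => by
        obtain ⟨i, hi⟩ := hb.exists
        exact hi.trans (hγH _))
  · have hu0 : Tendsto (fun i => u ((γ (φ i)).toFun 0)) atTop (𝓝 (u (γ'.toFun 0))) :=
      (hu _ (htr γ'.zero_mem_trace)).tendsto.comp (tendsto_nhdsWithin_iff.2
        ⟨h0, Eventually.of_forall fun i => hγK _ (γ (φ i)).zero_mem_trace⟩)
    have hu1 : Tendsto (fun i => u ((γ (φ i)).toFun (γ (φ i)).len)) atTop
        (𝓝 (u (γ'.toFun γ'.len))) :=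
      (hu _ (htr γ'.len_mem_trace)).tendsto.comp (tendsto_nhdsWithin_iff.2
        ⟨h1, Eventually.of_forall fun i => hγK _ (γ (φ i)).len_mem_trace⟩)
    have hd : Tendsto (fun i => ENNReal.ofReal
        |u ((γ (φ i)).toFun 0) - u ((γ (φ i)).toFun (γ (φ i)).len)| + δ (φ i)) atTop
        (𝓝 (ENNReal.ofReal |u (γ'.toFun 0) - u (γ'.toFun γ'.len)| + 0)) :=
      ((ENNReal.continuous_ofReal.tendsto _).comp (hu0.sub hu1).abs).add
        (hδ.comp hφ.tendsto_atTop)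
    rw [add_zero] at hd
    -- The curve integral of `g` need not be lower semicontinuous, but that of `G n` is, and
    -- exchanging the two costs at most `2⁻ⁿ L` on all the curves simultaneously.
    have hn : ∀ n : ℕ, γ'.integral g ≤
        ENNReal.ofReal |u (γ'.toFun 0) - u (γ'.toFun γ'.len)| + (2⁻¹ : ℝ≥0∞) ^ n * L := by
      intro n
      refine (γ'.integral_mono htr (h.le_approx n)).trans ((hlsc _ (h.lsc n)).trans ?_)
      have hd' := hd.add_const ((2⁻¹ : ℝ≥0∞) ^ n * L)
      rw [← hd'.liminf_eq]
      refine liminf_le_liminf (Eventually.of_forall fun i => ?_)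
      refine ((γ (φ i)).integral_mono (hγK _) (h.approx_le n)).trans ?_
      rw [(γ (φ i)).integral_add h.measurable,
        (γ (φ i)).integral_const_mul _ h.lsc_control.measurable]
      exact add_le_add (hγg _) (mul_le_mul_right (hγH _) _)
    have hlim : Tendsto (fun n : ℕ => ENNReal.ofReal |u (γ'.toFun 0) - u (γ'.toFun γ'.len)| +
        (2⁻¹ : ℝ≥0∞) ^ n * L) atTop
        (𝓝 (ENNReal.ofReal |u (γ'.toFun 0) - u (γ'.toFun γ'.len)| + 0 * L)) :=
      tendsto_const_nhds.add (ENNReal.Tendsto.mul_const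
        (ENNReal.tendsto_pow_atTop_nhds_zero_of_lt_one (by
          rw [ENNReal.inv_lt_one]; exact ENNReal.one_lt_two)) (Or.inr ENNReal.coe_ne_top))
    rw [zero_mul, add_zero] at hlim
    exact ge_of_tendsto' hlim hn

/-- The points that can be reached by gradient paths. -/
def gradientReach (K U : Set X) (u : X → ℝ) (g H : X → ℝ≥0∞) (L : ℝ≥0) : Set X :=
  {x | ∃ γ, IsGradientPath K U u g H L γ ∧ γ.toFun γ.len = x}

/-- Endpoints of convergent gradient paths are endpoints of the limit path. Closedness later
provides the measurability of the set of all reachable points. -/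
theorem LscApproximation.isClosed_gradientReach (h : LscApproximation K g H G) (hK : IsCompact K)
    (hU : IsOpen U) (hu : ContinuousOn u K) : IsClosed (gradientReach K U u g H L) := by
  rw [← isSeqClosed_iff_isClosed]
  intro x a hx ha
  choose γ hγ hγx using hx
  obtain ⟨φ, γ', l, hφ, hγ', h1, -, -⟩ := h.exists_limit hK hU hu γ (δ := fun _ => 0)
    tendsto_const_nhds (fun i => (hγ i).trace_subset) (fun i => (hγ i).start_notMem)
    (fun i => (hγ i).control_le) (fun i => by rw [add_zero]; exact (hγ i).integral_le)
  refine ⟨γ', hγ', tendsto_nhds_unique h1 ?_⟩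
  simp only [hγx]
  exact ha.comp hφ.tendsto_atTop

/-- On the curves that end in a compact set without reachable points there is a gap in the upper
gradient inequality. -/
theorem LscApproximation.exists_gap (h : LscApproximation K g H G) (hK : IsCompact K)
    (hU : IsOpen U) (hu : ContinuousOn u K) {E : Set X} (hE : IsClosed E)
    (hdisj : Disjoint E (gradientReach K U u g H L)) :
    ∃ δ : ℝ≥0, 0 < δ ∧ ∀ γ : RectCurve X, γ.trace ⊆ K → γ.toFun 0 ∉ U → γ.toFun γ.len ∈ E →
      γ.integral H ≤ L →
        ENNReal.ofReal |u (γ.toFun 0) - u (γ.toFun γ.len)| + δ ≤ γ.integral g := by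
  -- Curves that violate the gap for `δ = 1 / (n + 1)` would subconverge to a gradient path ending
  -- in `E`.
  by_contra! hcon
  choose γ hγK hγU hγE hγH hγg using fun n : ℕ => hcon ((n : ℝ≥0) + 1)⁻¹ (by positivity)
  have hδ : Tendsto (fun n : ℕ => ((((n : ℝ≥0) + 1)⁻¹ : ℝ≥0) : ℝ≥0∞)) atTop (𝓝 0) := by
    rw [← ENNReal.coe_zero, ENNReal.tendsto_coe]
    have := tendsto_one_div_add_atTop_nhds_zero_nat (𝕜 := ℝ≥0)
    simpa using this
  obtain ⟨φ, γ', l, hφ, hγ', h1, -, -⟩ := h.exists_limit hK hU hu γ hδ hγK hγU hγH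
    fun i => (hγg i).le
  exact disjoint_left.1 hdisj (hE.mem_of_tendsto h1 (Eventually.of_forall fun i => hγE _))
    ⟨γ', hγ', rfl⟩

/-- Cutting out a loop would leave a shorter gradient path with the same endpoints, so the curve is
simple. It is nonconstant because it leads from outside `U` into `U`. Equality for the whole curve
forces equality on each subcurve, since on `[0, a]`, `[a, b]` and `[b, γ.len]` the upper gradient
inequality goes the other way and the integrals are finite. -/
theorem IsGradientPath.isGradientCurve_of_minimal {Ω : Set X} {ρ : X → ℝ≥0∞}
    (hg : UpperGradientOff Ω u g ρ) (hρ : ∀ x, ρ x ≤ H x) (hKΩ : K ⊆ Ω) {γ : RectCurve X}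
    (hγ : IsGradientPath K U u g H L γ) (hend : γ.toFun γ.len ∈ U)
    (hmin : ∀ γ', IsGradientPath K U u g H L γ' → γ'.toFun γ'.len = γ.toFun γ.len →
      γ.len ≤ γ'.len) : IsGradientCurve Ω u g γ := by
  have hΩ : γ.trace ⊆ Ω := hγ.trace_subset.trans hKΩ
  have hfin : γ.integral ρ ≠ ∞ :=
    ((γ.integral_mono' hρ).trans_lt (hγ.control_le.trans_lt ENNReal.coe_lt_top)).ne
  have hgfin : γ.integral g ≠ ∞ := (hγ.integral_le.trans_lt ENNReal.ofReal_lt_top).ne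
  have hpos : 0 < γ.len := by
    rcases γ.len_nonneg.eq_or_lt with h0 | h0
    · rw [← h0] at hend
      exact absurd hend hγ.start_notMem
    · exact h0
  have hinj : ∀ a b, 0 ≤ a → a < b → b ≤ γ.len → γ.toFun a ≠ γ.toFun b := by
    intro a b ha hab hb heq
    obtain ⟨γ', hl, h0, h1, htr, hint⟩ := RectCurve.exists_concat
      (γ.sub 0 a le_rfl ha (hab.le.trans hb)) (γ.sub b γ.len (ha.trans hab.le) hb le_rfl)
      (by rw [γ.sub_toFun_len, γ.sub_toFun_zero, heq])
    rw [γ.sub_toFun_zero] at h0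
    rw [γ.sub_toFun_len] at h1
    have hle : ∀ f : X → ℝ≥0∞, γ'.integral f ≤ γ.integral f := by
      intro f
      rw [hint, γ.sub_integral, γ.sub_integral]
      calc γ.integralOn f 0 a + γ.integralOn f b γ.len
          ≤ γ.integralOn f 0 b + γ.integralOn f b γ.len := by
            gcongr
            exact lintegral_mono_set (Icc_subset_Icc le_rfl hab.le)
        _ = γ.integral f := γ.integralOn_add f (ha.trans hab.le) hb
    have hγ' : IsGradientPath K U u g H L γ' := by
      refine ⟨htr.trans (union_subset ((γ.sub_trace_subset _ _ _).trans hγ.trace_subset)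
        ((γ.sub_trace_subset _ _ _).trans hγ.trace_subset)), ?_, (hle H).trans hγ.control_le, ?_⟩
      · rw [h0]; exact hγ.start_notMem
      · rw [h0, h1]; exact (hle g).trans hγ.integral_le
    have := hmin γ' hγ' h1
    rw [hl] at this
    change γ.len ≤ (a - 0) + (γ.len - b) at this
    linarith
  refine ⟨hpos, hΩ, ?_, ?_⟩
  · intro a ha b hb hab
    rcases lt_trichotomy a b with hlt | heq | hlt
    · exact absurd hab (hinj a b ha.1 hlt hb.2)
    · exact heq
    · exact absurd hab.symm (hinj b a hb.1 hlt ha.2)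
  · intro a b ha hab hb
    have i1 := hg.increment_le hΩ hfin le_rfl ha (hab.trans hb)
    have i2 := hg.increment_le hΩ hfin ha hab hb
    have i3 := hg.increment_le hΩ hfin (ha.trans hab) hb le_rfl
    rw [abs_sub_comm] at i1 i2 i3
    refine le_antisymm i2 ?_
    have f1 : γ.integralOn g 0 a ≠ ∞ :=
      ne_top_of_le_ne_top hgfin (γ.integralOn_le_integral g le_rfl (hab.trans hb))
    have f3 : γ.integralOn g b γ.len ≠ ∞ :=
      ne_top_of_le_ne_top hgfin (γ.integralOn_le_integral g (ha.trans hab) le_rfl)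
    have e : γ.integralOn g 0 a + γ.integralOn g a b + γ.integralOn g b γ.len = γ.integral g := by
      rw [γ.integralOn_add g ha hab, γ.integralOn_add g (ha.trans hab) hb]; rfl
    have tri : ENNReal.ofReal |u (γ.toFun 0) - u (γ.toFun γ.len)| ≤
        ENNReal.ofReal |u (γ.toFun 0) - u (γ.toFun a)| +
          ENNReal.ofReal |u (γ.toFun a) - u (γ.toFun b)| +
          ENNReal.ofReal |u (γ.toFun b) - u (γ.toFun γ.len)| := by
      rw [← ENNReal.ofReal_add (abs_nonneg _) (abs_nonneg _),
        ← ENNReal.ofReal_add (by positivity) (abs_nonneg _)]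
      refine ENNReal.ofReal_le_ofReal ?_
      have t1 := abs_sub_le (u (γ.toFun 0)) (u (γ.toFun a)) (u (γ.toFun γ.len))
      have t2 := abs_sub_le (u (γ.toFun a)) (u (γ.toFun b)) (u (γ.toFun γ.len))
      linarith
    have h1 : γ.integralOn g 0 a + γ.integralOn g a b + γ.integralOn g b γ.len ≤
        γ.integralOn g 0 a + ENNReal.ofReal |u (γ.toFun a) - u (γ.toFun b)| +
          γ.integralOn g b γ.len := by
      rw [e]
      refine hγ.integral_le.trans (tri.trans ?_)
      gcongr
    exact (ENNReal.add_le_add_iff_left f1).1 ((ENNReal.add_le_add_iff_right f3).1 h1)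

/-- Through every reachable point of `U` there passes a gradient curve. -/
theorem LscApproximation.exists_isGradientCurve (h : LscApproximation K g H G) (hK : IsCompact K)
    (hU : IsOpen U) (hu : ContinuousOn u K) {Ω : Set X} {ρ : X → ℝ≥0∞}
    (hg : UpperGradientOff Ω u g ρ) (hρ : ∀ x, ρ x ≤ H x) (hKΩ : K ⊆ Ω) {x : X} (hx : x ∈ U)
    (hreach : x ∈ gradientReach K U u g H L) :
    ∃ γ, IsGradientCurve Ω u g γ ∧ x ∈ γ.trace := by
  set S : Set ℝ := {l | ∃ γ, IsGradientPath K U u g H L γ ∧ γ.toFun γ.len = x ∧ γ.len = l} with hS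
  have hne : S.Nonempty := by
    obtain ⟨γ, hγ, hγx⟩ := hreach
    exact ⟨_, γ, hγ, hγx, rfl⟩
  have hbdd : BddBelow S := ⟨0, by rintro _ ⟨γ, -, -, rfl⟩; exact γ.len_nonneg⟩
  -- The infimum of the lengths is attained, because length is lower semicontinuous along the
  -- converging subsequence.
  obtain ⟨a, -, ha, haS⟩ := exists_seq_tendsto_sInf hne hbdd
  choose γ hγ hγx hγa using haS
  obtain ⟨φ, γ', l, hφ, hγ', h1, hl, hle⟩ := h.exists_limit hK hU hu γ (δ := fun _ => 0)
    tendsto_const_nhds (fun i => (hγ i).trace_subset) (fun i => (hγ i).start_notMem)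
    (fun i => (hγ i).control_le) (fun i => by rw [add_zero]; exact (hγ i).integral_le)
  have hx' : γ'.toFun γ'.len = x := by
    simp only [hγx] at h1
    exact tendsto_nhds_unique h1 tendsto_const_nhds
  have hl' : l = sInf S := by
    simp only [hγa] at hl
    exact tendsto_nhds_unique hl (ha.comp hφ.tendsto_atTop)
  refine ⟨γ', hγ'.isGradientCurve_of_minimal hg hρ hKΩ (hx'.symm ▸ hx) fun γ'' hγ'' hx'' => ?_,
    hx' ▸ γ'.len_mem_trace⟩
  exact hle.trans (hl'.trans_le (csInf_le hbdd ⟨γ'', hγ'', hx''.trans hx', rfl⟩))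

end GradientPaths

/-! ### Lower semicontinuous approximation of `L^p` functions. -/

section Control

variable {X : Type*} [MetricSpace X] [MeasurableSpace X] [BorelSpace X] {μ : Measure X} {p : ℝ}

theorem indicator_rpow {f : X → ℝ≥0∞} (hp : 0 < p) (K : Set X) (x : X) :
    K.indicator f x ^ p = K.indicator (fun y => f y ^ p) x := by
  by_cases hx : x ∈ K <;> simp [hx, hp]

/-- The Vitali–Carathéodory theorem in `L^p`. -/
theorem exists_lsc_majorant [μ.WeaklyRegular] [SigmaFinite μ] (hp : 0 < p) {f : X → ℝ≥0∞}
    (hf : Measurable f) {ε : ℝ≥0∞} (hε : ε ≠ 0) :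
    ∃ F : X → ℝ≥0∞, LowerSemicontinuous F ∧ (∀ x, f x ≤ F x) ∧
      ∫⁻ x, F x ^ p ∂μ ≤ ∫⁻ x, f x ^ p ∂μ + ε := by
  obtain ⟨G, hG, hGl, hGi⟩ :=
    exists_le_lowerSemicontinuous_lintegral_ge μ (fun x => f x ^ p) (hf.pow_const p) hε
  have cancel : ∀ y : ℝ≥0∞, (y ^ p) ^ (1 / p) = y := fun y => by
    rw [← ENNReal.rpow_mul, mul_one_div_cancel hp.ne', ENNReal.rpow_one]
  have cancel' : ∀ y : ℝ≥0∞, (y ^ (1 / p)) ^ p = y := fun y => by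
    rw [← ENNReal.rpow_mul, one_div_mul_cancel hp.ne', ENNReal.rpow_one]
  refine ⟨fun x => G x ^ (1 / p), ?_, fun x => ?_, ?_⟩
  · exact ENNReal.continuous_rpow_const.comp_lowerSemicontinuous hGl
      (ENNReal.monotone_rpow_of_nonneg (by positivity))
  · have := ENNReal.rpow_le_rpow (hG x) (show 0 ≤ 1 / p by positivity)
    rwa [cancel] at this
  · simp only [cancel']
    exact hGi

/-- Every `L^p` function on a compact set has good lower semicontinuous approximations. -/
theorem exists_lscApproximation [ProperSpace X] [IsLocallyFiniteMeasure μ] (hp : 1 < p) {K : Set X}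
    (hK : IsCompact K) {g ρ : X → ℝ≥0∞} (hg : Measurable g) (hgK : ∫⁻ x in K, g x ^ p ∂μ ≠ ∞)
    (hρ : Measurable ρ) (hρfin : ∫⁻ x, ρ x ^ p ∂μ ≠ ∞) :
    ∃ (H : X → ℝ≥0∞) (G : ℕ → X → ℝ≥0∞), LscApproximation K g H G ∧ (∀ x, ρ x ≤ H x) ∧
      ∫⁻ x, H x ^ p ∂μ ≠ ∞ := by
  have p0 : 0 < p := zero_lt_one.trans hp
  have mK : MeasurableSet K := hK.isClosed.measurableSet
  set f := K.indicator g with hf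
  have fm : Measurable f := hg.indicator mK
  have fint : ∫⁻ x, f x ^ p ∂μ ≠ ∞ := by
    simp only [hf, indicator_rpow p0]
    rwa [lintegral_indicator mK]
  have two0 : ∀ n : ℕ, ((2 : ℝ≥0∞) ^ n) ^ p ≠ ∞ := fun n =>
    ENNReal.rpow_ne_top_of_nonneg p0.le (ENNReal.pow_ne_top ENNReal.ofNat_ne_top)
  -- The tolerance gives `2 ^ n * (G n - f)` energy at most `2⁻ⁿ`, so one function in `L^p`
  -- dominates all the rescaled errors.
  choose G hGl hfG hGi using fun n : ℕ => exists_lsc_majorant (μ := μ) p0 fm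
    (ε := (2⁻¹ : ℝ≥0∞) ^ n / ((2 : ℝ≥0∞) ^ n) ^ p)
    (ENNReal.div_pos (pow_ne_zero _ (by simp)) (two0 n)).ne'
  have hdiff : ∀ n, ∫⁻ x, (G n x - f x) ^ p ∂μ ≤ (2⁻¹ : ℝ≥0∞) ^ n / ((2 : ℝ≥0∞) ^ n) ^ p := by
    intro n
    -- Superadditivity of the `p`-th power turns closeness of the energies into a small energy of
    -- the difference.
    have h1 : ∀ x, f x ^ p + (G n x - f x) ^ p ≤ G n x ^ p := fun x => by
      have := ENNReal.add_rpow_le_rpow_add (f x) (G n x - f x) hp.le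
      rwa [add_tsub_cancel_of_le (hfG n x)] at this
    have h2 := (lintegral_mono h1).trans (hGi n)
    rw [lintegral_add_left (fm.pow_const p)] at h2
    exact (ENNReal.add_le_add_iff_left fint).1 h2
  obtain ⟨σ, mσ, iσ, hσ⟩ := exists_lp_majorant (μ := μ) p0
    (fun (n : ℕ) x => (2 : ℝ≥0∞) ^ n * (G n x - f x))
    fun n => ((hGl n).measurable.sub fm).const_mul _
  have σfin : ∫⁻ x, σ x ^ p ∂μ ≠ ∞ := by
    rw [iσ]
    refine ((ENNReal.tsum_le_tsum (g := fun n : ℕ => (2⁻¹ : ℝ≥0∞) ^ n) fun n => ?_).trans_lt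
      ?_).ne
    · simp only [ENNReal.mul_rpow_of_nonneg _ _ p0.le]
      have mn : Measurable fun x => (G n x - f x) ^ p := ((hGl n).measurable.sub fm).pow_const p
      rw [lintegral_const_mul _ mn]
      exact (mul_le_mul_right (hdiff n) _).trans ENNReal.mul_div_le
    · rw [ENNReal.tsum_geometric]
      simp
  obtain ⟨τ, mτ, iτ, hτ⟩ := exists_lp_majorant (μ := μ) p0 ![σ, ρ, K.indicator fun _ => 1]
    (by
      intro i
      fin_cases i
      exacts [mσ, hρ, measurable_const.indicator mK])
  have τfin : ∫⁻ x, τ x ^ p ∂μ ≠ ∞ := by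
    rw [iτ, tsum_fintype]
    refine ENNReal.sum_ne_top.2 fun i _ => ?_
    fin_cases i
    · exact σfin
    · exact hρfin
    · change ∫⁻ x, (K.indicator (fun _ => (1 : ℝ≥0∞)) x) ^ p ∂μ ≠ ∞
      simp only [indicator_rpow p0, ENNReal.one_rpow]
      rw [lintegral_indicator mK, setLIntegral_one]
      exact hK.measure_lt_top.ne
  obtain ⟨H, hHl, hτH, hHi⟩ := exists_lsc_majorant (μ := μ) p0 mτ one_ne_zero
  refine ⟨H, G, ⟨hg, hHl, fun x hx => ?_, hGl, fun n x hx => ?_, fun n x hx => ?_⟩,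
    fun x => (hτ 1 x).trans (hτH x), ?_⟩
  · refine le_trans ?_ ((hτ 2 x).trans (hτH x))
    exact (indicator_of_mem hx (fun _ : X => (1 : ℝ≥0∞))).ge
  · have := hfG n x
    rwa [hf, indicator_of_mem hx] at this
  · have h1 : (2 : ℝ≥0∞) ^ n * (G n x - f x) ≤ H x :=
      (hσ n x).trans ((hτ 0 x).trans (hτH x))
    have h2 : G n x - f x ≤ (2⁻¹ : ℝ≥0∞) ^ n * H x := by
      refine le_trans (le_of_eq ?_) (mul_le_mul_right h1 _)
      rw [← mul_assoc, ← mul_pow, ENNReal.inv_mul_cancel two_ne_zero ENNReal.ofNat_ne_top, one_pow,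
        one_mul]
    calc G n x = f x + (G n x - f x) := (add_tsub_cancel_of_le (hfG n x)).symm
      _ ≤ g x + (2⁻¹ : ℝ≥0∞) ^ n * H x := by
          refine add_le_add ?_ h2
          rw [hf, indicator_of_mem hx]
  · exact (hHi.trans_lt (ENNReal.add_lt_top.2 ⟨τfin.lt_top, ENNReal.one_lt_top⟩)).ne

end Control

/-! ### Lowering the gradient on `E` and solving the boundary value problem. -/

section ValueFunction

variable {X : Type*} [MetricSpace X] [MeasurableSpace X] [BorelSpace X] {K U : Set X} {u : X → ℝ}
  {g H h ρ : X → ℝ≥0∞} {L : ℝ≥0}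

/-- If there is a gap in the upper gradient inequality on the curves through `E` with a small
integral of `H`, then `g` can be decreased in `E` at the cost of adding a multiple of `H`. -/
theorem increment_le_of_gap {Ω E : Set X} (hg : UpperGradientOff Ω u g ρ) (hρ : ∀ x, ρ x ≤ H x)
    (hgm : Measurable g) (hHm : Measurable H) (hKΩ : K ⊆ Ω) (hL : 0 < L)
    {δ s t C : ℝ≥0} (hs : 0 < s) (hst : s + t = 1)
    (hgap : ∀ γ : RectCurve X, γ.trace ⊆ K → γ.toFun 0 ∉ U → γ.toFun γ.len ∈ E →
      γ.integral H ≤ L →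
        ENNReal.ofReal |u (γ.toFun 0) - u (γ.toFun γ.len)| + δ ≤ γ.integral g)
    (hC : ∀ x ∈ K, ∀ y ∈ K, |u x - u y| ≤ C) (hsδ : s * C ≤ t * δ)
    (hh : ∀ x ∈ K, t * g x + (s * C / L : ℝ≥0) * H x ≤ h x) (hhE : ∀ x ∈ K, x ∉ E → g x ≤ h x)
    {γ : RectCurve X} (hγ : γ.trace ⊆ K) (h0 : γ.toFun 0 ∉ U) :
    ENNReal.ofReal |u (γ.toFun 0) - u (γ.toFun γ.len)| ≤ γ.integral h := by
  have hγΩ := hγ.trans hKΩ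
  have h1 : t * γ.integral g + (s * C / L : ℝ≥0) * γ.integral H ≤ γ.integral h := by
    rw [← γ.integral_const_mul _ hgm, ← γ.integral_const_mul _ hHm,
      ← γ.integral_add (hgm.const_mul _)]
    exact γ.integral_mono hγ hh
  set D := |u (γ.toFun 0) - u (γ.toFun γ.len)| with hD
  have D0 : 0 ≤ D := abs_nonneg _
  have hDC : ENNReal.ofReal D ≤ C := by
    rw [← ENNReal.ofReal_coe_nnreal]
    exact ENNReal.ofReal_le_ofReal (hC _ (hγ γ.zero_mem_trace) _ (hγ γ.len_mem_trace))
  have hst' : ENNReal.ofReal D = t * ENNReal.ofReal D + s * ENNReal.ofReal D := by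
    rw [← add_mul, ← ENNReal.coe_add, add_comm t s, hst, ENNReal.coe_one, one_mul]
  -- If `∫ H ≤ L` and the curve meets `E`, its part up to `E` gains `δ`, and `t * δ ≥ s * C` pays
  -- for the missing share `s` of `g`. If it avoids `E`, then `g ≤ h` along it. If `∫ H > L`, the
  -- term with `H` pays for the share `s`.
  rcases le_or_gt (γ.integral H) L with hle | hlt
  · have hfin : γ.integral ρ ≠ ∞ :=
      ((γ.integral_mono' hρ).trans_lt (hle.trans_lt ENNReal.coe_lt_top)).ne
    have hug : ENNReal.ofReal D ≤ γ.integral g := hg γ hγΩ hfin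
    by_cases hE : ∃ τ ∈ Icc 0 γ.len, γ.toFun τ ∈ E
    · obtain ⟨τ, hτ, hτE⟩ := hE
      have g1 := hgap (γ.sub 0 τ le_rfl hτ.1 hτ.2) ((γ.sub_trace_subset _ _ _).trans hγ)
        (by rwa [γ.sub_toFun_zero]) (by rwa [γ.sub_toFun_len])
        (by
          rw [γ.sub_integral]
          exact (γ.integralOn_le_integral H le_rfl hτ.2).trans hle)
      rw [γ.sub_toFun_zero, γ.sub_toFun_len, γ.sub_integral] at g1
      have g2 := hg.increment_le hγΩ hfin hτ.1 hτ.2 le_rfl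
      rw [abs_sub_comm] at g2
      have g3 : ENNReal.ofReal D + δ ≤ γ.integral g := by
        have e : γ.integral g = γ.integralOn g 0 τ + γ.integralOn g τ γ.len :=
          (γ.integralOn_add g hτ.1 hτ.2).symm
        rw [e]
        refine le_trans ?_ (add_le_add g1 g2)
        rw [add_right_comm, ← ENNReal.ofReal_add (abs_nonneg _) (abs_nonneg _)]
        gcongr
        exact abs_sub_le _ _ _
      calc ENNReal.ofReal D = t * ENNReal.ofReal D + s * ENNReal.ofReal D := hst'
        _ ≤ t * ENNReal.ofReal D + t * δ := by
            refine add_le_add_right ((mul_le_mul_right hDC _).trans ?_) _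
            exact_mod_cast hsδ
        _ = t * (ENNReal.ofReal D + δ) := (mul_add _ _ _).symm
        _ ≤ t * γ.integral g := mul_le_mul_right g3 _
        _ ≤ _ := le_self_add.trans h1
    · push Not at hE
      refine hug.trans (γ.integral_mono (s := γ.trace) subset_rfl fun x hx => ?_)
      obtain ⟨τ, hτ, rfl⟩ := hx
      exact hhE _ (hγ (γ.mem_trace hτ.1 hτ.2)) (hE τ hτ)
  · by_cases hfin : γ.integral ρ = ∞
    -- On curves exceptional for `g` the integral of `h` is infinite, or `C = 0` and the increment
    -- of `u` vanishes. So the inequality holds without exceptional curves.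
    · have hHtop : γ.integral H = ∞ := top_le_iff.1 (hfin ▸ γ.integral_mono' hρ)
      by_cases hsC : s * C / L = 0
      · have hsC' : s * C = 0 := by
          rcases div_eq_zero_iff.1 hsC with h | h
          exacts [h, absurd h hL.ne']
        rw [(mul_eq_zero.1 hsC').resolve_left hs.ne'] at hDC
        exact hDC.trans (by simp)
      · rw [hHtop, ENNReal.mul_top (by exact_mod_cast hsC), add_top] at h1
        exact le_top.trans h1
    · have hug : ENNReal.ofReal D ≤ γ.integral g := hg γ hγΩ hfin
      calc ENNReal.ofReal D = t * ENNReal.ofReal D + s * ENNReal.ofReal D := hst'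
        _ ≤ t * γ.integral g + s * C :=
            add_le_add (mul_le_mul_right hug _) (mul_le_mul_right hDC _)
        _ ≤ t * γ.integral g + (s * C / L : ℝ≥0) * γ.integral H := by
            refine add_le_add_right ?_ _
            calc (s * C : ℝ≥0∞) = ((s * C / L : ℝ≥0) : ℝ≥0∞) * L := by
                  rw [← ENNReal.coe_mul, ← ENNReal.coe_mul, div_mul_cancel₀ _ hL.ne']
              _ ≤ _ := mul_le_mul_right hlt.le _
        _ ≤ _ := h1

/-- The value function of the boundary value problem for the metric `h ds`. -/
theorem exists_value_function (hK : IsCompact K) (hU : IsOpen U) (hUK : U ⊆ K)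
    (hu : ContinuousOn u K) {m : ℝ} {C : ℝ≥0} (hm : ∀ x ∈ K, m ≤ u x ∧ u x ≤ m + C)
    (hh : LowerSemicontinuous h) {c : ℝ≥0} (hc : 0 < c) (hch : ∀ x ∈ K, c ≤ h x)
    (hadm : ∀ γ : RectCurve X, γ.trace ⊆ K → γ.toFun 0 ∉ U → γ.toFun γ.len ∉ U →
      ENNReal.ofReal |u (γ.toFun 0) - u (γ.toFun γ.len)| ≤ γ.integral h) :
    ∃ v : X → ℝ, (∀ x ∉ U, v x = u x) ∧ (∀ x, |v x - u x| ≤ C) ∧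
      (Measurable fun x => v x - u x) ∧
      ∀ γ : RectCurve X, γ.trace ⊆ K →
        ENNReal.ofReal |v (γ.toFun 0) - v (γ.toFun γ.len)| ≤ γ.integral h := by
  classical
  let P : X → Type _ := fun y =>
    {γ : RectCurve X // γ.trace ⊆ K ∧ γ.toFun 0 ∉ U ∧ γ.toFun γ.len = y}
  let val : RectCurve X → ℝ≥0∞ := fun γ => ENNReal.ofReal (u (γ.toFun 0) - m) + γ.integral h
  -- The shift by `m` makes the boundary values nonnegative. `V` is `∞` where no admissible curve
  -- arrives, which the truncation at `C` in `w` repairs.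
  let V : X → ℝ≥0∞ := fun y => ⨅ γ : P y, val γ.1
  have hlen : ∀ (γ : RectCurve X), γ.trace ⊆ K → c * ENNReal.ofReal γ.len ≤ γ.integral h :=
    fun γ hγ => by
      rw [← γ.integral_const]
      exact γ.integral_mono hγ hch
  -- Needed for the measurability of `v - u`. The lower bound `c ≤ h` on `K` bounds the lengths of
  -- almost optimal curves, so that they subconverge.
  have Vlsc : LowerSemicontinuous V := by
    rw [lowerSemicontinuous_iff_isClosed_preimage]
    intro τ
    by_cases hτ : τ = ∞
    · rw [hτ, Iic_top, preimage_univ]; exact isClosed_univ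
    rw [← isSeqClosed_iff_isClosed]
    intro y a hy ha
    set ε : ℕ → ℝ≥0∞ := fun n => ((n : ℝ≥0∞) + 1)⁻¹ with hε
    have hε0 : ∀ n, ε n ≠ 0 := fun n => ENNReal.inv_ne_zero.2 (by simp)
    have hε1 : ∀ n, ε n ≤ 1 := fun n => ENNReal.inv_le_one.2 le_add_self
    have hεlim : Tendsto ε atTop (𝓝 0) := by
      have := (tendsto_add_atTop_iff_nat 1).2 ENNReal.tendsto_inv_nat_nhds_zero
      simpa [hε] using this
    have ex : ∀ n, ∃ γ : P (y n), val γ.1 < τ + ε n := fun n =>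
      iInf_lt_iff.1 ((show V (y n) ≤ τ from hy n).trans_lt (ENNReal.lt_add_right hτ (hε0 n)))
    choose γ hγ using ex
    have hlenb : ∀ n, (γ n).1.len ≤ ((τ + 1) / c).toReal := by
      intro n
      have h1 : c * ENNReal.ofReal (γ n).1.len ≤ τ + 1 :=
        (hlen _ (γ n).2.1).trans (le_add_self.trans ((hγ n).le.trans
          (add_le_add_right (hε1 n) τ)))
      have h2 : ENNReal.ofReal (γ n).1.len ≤ (τ + 1) / c := by
        rw [ENNReal.le_div_iff_mul_le (Or.inl (by exact_mod_cast hc.ne')) (Or.inl (by simp)),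
          mul_comm]
        exact h1
      exact (ENNReal.ofReal_le_iff_le_toReal (ENNReal.div_ne_top (by simp [hτ])
        (by exact_mod_cast hc.ne'))).1 h2
    obtain ⟨φ, γ', l, hφ, htr, h0, h1, -, -, hlsc⟩ := RectCurve.exists_subseq_limit hK
      (fun n => (γ n).1) (fun n => (γ n).2.1) hlenb
    have hend : γ'.toFun γ'.len = a := by
      have e : ∀ n, (γ n).1.toFun (γ n).1.len = y n := fun n => (γ n).2.2.2
      simp only [e] at h1
      exact tendsto_nhds_unique h1 (ha.comp hφ.tendsto_atTop)
    have hstart : γ'.toFun 0 ∉ U :=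
      hU.isClosed_compl.mem_of_tendsto h0 (Eventually.of_forall fun n => (γ (φ n)).2.2.1)
    have hu0 : Tendsto (fun n => ENNReal.ofReal (u ((γ (φ n)).1.toFun 0) - m)) atTop
        (𝓝 (ENNReal.ofReal (u (γ'.toFun 0) - m))) := by
      refine (ENNReal.continuous_ofReal.tendsto _).comp (Tendsto.sub_const ?_ m)
      exact (hu _ (htr γ'.zero_mem_trace)).tendsto.comp (tendsto_nhdsWithin_iff.2
        ⟨h0, Eventually.of_forall fun n => (γ (φ n)).2.1 (γ (φ n)).1.zero_mem_trace⟩)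
    have hτε : Tendsto (fun n => τ + ε (φ n)) atTop (𝓝 τ) := by
      simpa using (hεlim.comp hφ.tendsto_atTop).const_add τ
    have h2 : ENNReal.ofReal (u (γ'.toFun 0) - m) ≤ τ :=
      le_of_tendsto_of_tendsto' hu0 hτε fun n => le_self_add.trans (hγ (φ n)).le
    have h3 : γ'.integral h ≤ τ - ENNReal.ofReal (u (γ'.toFun 0) - m) := by
      refine (hlsc h hh).trans ?_
      rw [← (ENNReal.Tendsto.sub hτε hu0 (Or.inl hτ)).liminf_eq]
      refine liminf_le_liminf (Eventually.of_forall fun n => ?_)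
      exact ENNReal.le_sub_of_add_le_left ENNReal.ofReal_ne_top (hγ (φ n)).le
    have h4 : val γ' ≤ τ := by
      refine (add_le_add_right h3 _).trans ?_
      rw [add_tsub_cancel_of_le h2]
    exact (iInf_le (fun γ : P a => val γ.1) ⟨γ', htr, hstart, hend⟩).trans h4
  have Vtri : ∀ γ : RectCurve X, γ.trace ⊆ K →
      V (γ.toFun γ.len) ≤ V (γ.toFun 0) + γ.integral h := by
    intro γ hγ
    simp only [V]
    rw [ENNReal.iInf_add]
    refine le_iInf fun γ₁ => ?_
    obtain ⟨γ₂, -, e0, e1, etr, eint⟩ := RectCurve.exists_concat γ₁.1 γ γ₁.2.2.2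
    refine (iInf_le (fun γ' : P (γ.toFun γ.len) => val γ'.1) ⟨γ₂, ?_, ?_, e1⟩).trans_eq ?_
    · exact etr.trans (union_subset γ₁.2.1 hγ)
    · rw [e0]; exact γ₁.2.2.1
    · simp only [val]
      rw [e0, eint, add_assoc]
  -- The constant curve gives one inequality; the other is the admissibility `hadm` of `h`.
  have Vbd : ∀ x ∈ K, x ∉ U → V x = ENNReal.ofReal (u x - m) := by
    intro x hxK hxU
    apply le_antisymm
    · refine (iInf_le (fun γ : P x => val γ.1) ⟨RectCurve.const x, ?_, hxU, rfl⟩).trans_eq ?_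
      · rw [RectCurve.const_trace]; exact singleton_subset_iff.2 hxK
      · simp only [val, RectCurve.const_integral, add_zero]
        rfl
    · refine le_iInf fun γ => ?_
      obtain ⟨γ, hγ, h0, rfl⟩ := γ
      refine le_trans ?_ (add_le_add_right (hadm γ hγ h0 hxU) _)
      rw [← ENNReal.ofReal_add (by linarith [(hm _ (hγ γ.zero_mem_trace)).1]) (abs_nonneg _)]
      refine ENNReal.ofReal_le_ofReal ?_
      have := neg_abs_le (u (γ.toFun 0) - u (γ.toFun γ.len))
      linarith
  let w : X → ℝ := fun x => m + (min (V x) C).toReal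
  have wbd : ∀ x, m ≤ w x ∧ w x ≤ m + C := fun x => by
    have h1 : (min (V x) (C : ℝ≥0∞)).toReal ≤ C :=
      (ENNReal.toReal_mono ENNReal.coe_ne_top (min_le_right _ _)).trans_eq
        (ENNReal.coe_toReal C)
    have h2 : 0 ≤ (min (V x) (C : ℝ≥0∞)).toReal := ENNReal.toReal_nonneg
    exact ⟨by simp only [w]; linarith, by simp only [w]; linarith⟩
  have wu : ∀ x ∈ K, x ∉ U → w x = u x := by
    intro x hxK hxU
    have h1 := hm x hxK
    simp only [w]
    rw [Vbd x hxK hxU, min_eq_left, ENNReal.toReal_ofReal (by linarith)]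
    · ring
    · rw [← ENNReal.ofReal_coe_nnreal]
      exact ENNReal.ofReal_le_ofReal (by linarith)
  have wtri : ∀ γ : RectCurve X, γ.trace ⊆ K → γ.integral h ≠ ∞ →
      w (γ.toFun γ.len) ≤ w (γ.toFun 0) + (γ.integral h).toReal := by
    intro γ hγ hfin
    have h1 : min (V (γ.toFun γ.len)) (C : ℝ≥0∞) ≤ min (V (γ.toFun 0)) C + γ.integral h := by
      rw [← min_add_add_right]
      exact min_le_min (Vtri γ hγ) le_self_add
    have hne : min (V (γ.toFun 0)) (C : ℝ≥0∞) ≠ ∞ :=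
      ne_top_of_le_ne_top ENNReal.coe_ne_top (min_le_right _ _)
    have h2 := ENNReal.toReal_mono (ENNReal.add_ne_top.2 ⟨hne, hfin⟩) h1
    rw [ENNReal.toReal_add hne hfin] at h2
    simp only [w]
    linarith
  have vw : ∀ x ∈ K, U.piecewise w u x = w x := fun x hx => by
    by_cases hxU : x ∈ U
    · rw [piecewise_eq_of_mem _ _ _ hxU]
    · rw [piecewise_eq_of_notMem _ _ _ hxU, wu x hx hxU]
  refine ⟨U.piecewise w u, fun x hx => piecewise_eq_of_notMem _ _ _ hx, fun x => ?_, ?_, ?_⟩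
  · by_cases hx : x ∈ U
    · rw [piecewise_eq_of_mem _ _ _ hx, abs_le]
      have h1 := hm x (hUK hx)
      have h2 := wbd x
      constructor <;> linarith [h1.1, h1.2, h2.1, h2.2]
    · rw [piecewise_eq_of_notMem _ _ _ hx, sub_self, abs_zero]; exact C.2
  · have wm : Measurable w := measurable_const.add
      (Vlsc.measurable.min measurable_const).ennreal_toReal
    have um : Measurable (U.piecewise u 0) :=
      (hu.mono hUK).measurable_piecewise continuousOn_const hU.measurableSet
    have e : (fun x => U.piecewise w u x - u x) =
        fun x => U.piecewise w 0 x - U.piecewise u 0 x := by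
      funext x
      by_cases hx : x ∈ U <;> simp [hx]
    rw [e]
    exact (wm.piecewise hU.measurableSet measurable_const).sub um
  · intro γ hγ
    rw [vw _ (hγ γ.zero_mem_trace), vw _ (hγ γ.len_mem_trace)]
    by_cases hfin : γ.integral h = ∞
    · rw [hfin]; exact le_top
    refine (ENNReal.ofReal_le_iff_le_toReal hfin).2 (abs_le.2 ⟨?_, ?_⟩)
    · linarith [wtri γ hγ hfin]
    · have h1 := wtri γ.reverse (γ.reverse_trace.trans hγ) (by rwa [γ.reverse_integral])
      rw [γ.reverse_toFun_zero, γ.reverse_toFun_len, γ.reverse_integral] at h1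
      linarith

end ValueFunction

/-! ### Comparison of energies and vanishing of `g` off the reachable set. -/

section Comparison

variable {X : Type*} [MetricSpace X] [MeasurableSpace X] [BorelSpace X] {μ : Measure X} {p : ℝ}

theorem lintegral_rpow_const_mul (hp : 0 < p) (ν : Measure X) {f : X → ℝ≥0∞} (hf : Measurable f)
    (c : ℝ≥0∞) :
    (∫⁻ x, (c * f x) ^ p ∂ν) ^ (1 / p) = c * (∫⁻ x, f x ^ p ∂ν) ^ (1 / p) := by
  simp only [ENNReal.mul_rpow_of_nonneg _ _ hp.le]
  rw [lintegral_const_mul _ (hf.pow_const p), ENNReal.mul_rpow_of_nonneg _ _ (by positivity),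
    ← ENNReal.rpow_mul, mul_one_div_cancel hp.ne', ENNReal.rpow_one]

theorem lowerSemicontinuous_indicator_of_isOpen {V : Set X} (hV : IsOpen V) {f : X → ℝ≥0∞}
    (hf : LowerSemicontinuous f) : LowerSemicontinuous (V.indicator f) := by
  intro x y hy
  by_cases hx : x ∈ V
  · rw [indicator_of_mem hx] at hy
    filter_upwards [hf x y hy, hV.mem_nhds hx] with z hz hzV
    rwa [indicator_of_mem hzV]
  · rw [indicator_of_notMem hx] at hy
    exact absurd hy not_lt_zero

/-- After the limit in `n` the finite term `t * a` is subtracted and `s` cancelled. This is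
essential, since in the application `s` comes from a gap of unknown size. -/
theorem le_of_forall_le_convex_add {a b d : ℝ≥0∞} {s t k : ℝ≥0} (hs : 0 < s) (hst : s + t = 1)
    (ha : a ≠ ∞) (hd : d ≠ ∞)
    (h : ∀ n : ℕ, a ≤ t * a + s * b + ((s * k : ℝ≥0) * d + (2⁻¹ : ℝ≥0∞) ^ n * d)) :
    a ≤ b + k * d := by
  have hlim : Tendsto (fun n : ℕ => t * a + s * b + ((s * k : ℝ≥0) * d + (2⁻¹ : ℝ≥0∞) ^ n * d))
      atTop (𝓝 (t * a + s * b + ((s * k : ℝ≥0) * d + 0 * d))) := by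
    refine Tendsto.const_add _ (Tendsto.const_add _ (ENNReal.Tendsto.mul_const ?_ (Or.inr hd)))
    exact ENNReal.tendsto_pow_atTop_nhds_zero_of_lt_one (by simp)
  have h1 := ge_of_tendsto' hlim h
  rw [zero_mul, add_zero, ENNReal.coe_mul, mul_assoc, add_assoc, ← mul_add] at h1
  have h2 : a = t * a + s * a := by
    rw [← add_mul, ← ENNReal.coe_add, add_comm t s, hst, ENNReal.coe_one, one_mul]
  nth_rewrite 1 [h2] at h1
  have h3 := (ENNReal.add_le_add_iff_left (ENNReal.mul_ne_top ENNReal.coe_ne_top ha)).1 h1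
  exact (ENNReal.mul_le_mul_iff_right (by exact_mod_cast hs.ne') ENNReal.coe_ne_top).1 h3

/-- The energy of a `p`-harmonic function on a set without points reachable by gradient paths of
bounded control is compensated by the control. -/
theorem IsPHarmonic.lintegral_le_of_disjoint_gradientReach [ProperSpace X] (hp : 1 < p)
    (hb : BallsPosFinite μ) (hd : IsDoubling μ) (hP : SupportsPoincare μ p) {Ω : Set X}
    (hΩ : IsOpen Ω) {u : X → ℝ} (hu : IsPHarmonic μ p Ω u) {g ρ H : X → ℝ≥0∞}
    {G : ℕ → X → ℝ≥0∞} (hg : IsMinimalWeakUpperGradient μ p Ω u g) (hgρ : UpperGradientOff Ω u g ρ)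
    {x₀ : X} {r₀ r₁ : ℝ} (hr : r₀ < r₁) (hKΩ : closedBall x₀ r₁ ⊆ Ω)
    (hG : LscApproximation (closedBall x₀ r₁) g H G) (hρ : ∀ x, ρ x ≤ H x)
    (hH : ∫⁻ x, H x ^ p ∂μ ≠ ∞) {m : ℝ} {C : ℝ≥0} (hC0 : 0 < C)
    (hm : ∀ x ∈ closedBall x₀ r₁, m ≤ u x ∧ u x ≤ m + C) {L : ℝ≥0} (hL : 0 < L) {E : Set X}
    (hE : IsClosed E) (hEU : E ⊆ ball x₀ r₀)
    (hdisj : Disjoint E (gradientReach (closedBall x₀ r₁) (ball x₀ r₀) u g H L)) :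
    (∫⁻ x in closedBall x₀ r₁, g x ^ p ∂μ) ^ (1 / p) ≤
      (∫⁻ x in closedBall x₀ r₁, (Eᶜ.indicator g x) ^ p ∂μ) ^ (1 / p) +
        (C / L : ℝ≥0) * (∫⁻ x, H x ^ p ∂μ) ^ (1 / p) := by
  classical
  have p0 : 0 < p := zero_lt_one.trans hp
  have q0 : 0 ≤ 1 / p := by positivity
  set K := closedBall x₀ r₁ with hKdef
  set U := ball x₀ r₀ with hUdef
  have hK : IsCompact K := isCompact_closedBall x₀ r₁
  have mK : MeasurableSet K := measurableSet_closedBall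
  have hUK : U ⊆ K := ball_subset_closedBall.trans (closedBall_subset_closedBall hr.le)
  have huK : ContinuousOn u K := hu.1.mono hKΩ
  have gm : Measurable g := hg.1.1
  have Hm : Measurable H := hG.lsc_control.measurable
  obtain ⟨δ, hδ, hgap⟩ := hG.exists_gap hK isOpen_ball huK hE hdisj
  -- The weights solve `s * C = t * δ`: what a curve meeting `E` loses is exactly balanced by the
  -- gap.
  obtain ⟨s, t, hs, hst, hsδ⟩ : ∃ s t : ℝ≥0, 0 < s ∧ s + t = 1 ∧ s * C ≤ t * δ := by
    refine ⟨δ / (C + δ), C / (C + δ), by positivity, ?_, le_of_eq ?_⟩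
    · rw [← add_div, add_comm, div_self (by positivity)]
    · ring
  have hosc : ∀ x ∈ K, ∀ y ∈ K, |u x - u y| ≤ C := fun x hx y hy => by
    rw [abs_le]
    constructor <;> linarith [(hm x hx).1, (hm x hx).2, (hm y hy).1, (hm y hy).2]
  have hts : ∀ a : ℝ≥0∞, t * a + s * a = a := fun a => by
    rw [← add_mul, ← ENNReal.coe_add, add_comm t s, hst, ENNReal.coe_one, one_mul]
  set c : ℝ≥0 := s * C / L with hc
  have hc0 : 0 < c := by positivity
  have hgK : (∫⁻ x in K, g x ^ p ∂μ) ^ (1 / p) ≠ ∞ :=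
    ENNReal.rpow_ne_top_of_nonneg q0 (hg.2.1.lintegral_lt_top hK hKΩ).ne
  have hHK : (∫⁻ x in K, H x ^ p ∂μ) ^ (1 / p) ≤ (∫⁻ x, H x ^ p ∂μ) ^ (1 / p) :=
    ENNReal.rpow_le_rpow (setLIntegral_le_lintegral _ _) q0
  have key : ∀ n : ℕ, (∫⁻ x in K, g x ^ p ∂μ) ^ (1 / p) ≤
      t * (∫⁻ x in K, g x ^ p ∂μ) ^ (1 / p) +
        s * (∫⁻ x in K, (Eᶜ.indicator g x) ^ p ∂μ) ^ (1 / p) +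
        ((s * (C / L) : ℝ≥0) * (∫⁻ x, H x ^ p ∂μ) ^ (1 / p) +
          (2⁻¹ : ℝ≥0∞) ^ n * (∫⁻ x, H x ^ p ∂μ) ^ (1 / p)) := by
    intro n
    -- Off `E` the first two terms add up to `G n`; on `E` only the share `t` is kept. Lower
    -- semicontinuity holds because `Eᶜ` is open.
    set h : X → ℝ≥0∞ := fun x => t * G n x + Eᶜ.indicator (fun y => s * G n y) x + c * H x with hh
    have lscmul : ∀ {F : X → ℝ≥0∞} (a : ℝ≥0), LowerSemicontinuous F →
        LowerSemicontinuous fun x => a * F x := fun a hF =>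
      (ENNReal.continuous_const_mul ENNReal.coe_ne_top).comp_lowerSemicontinuous hF
        fun _ _ h => mul_le_mul_right h _
    have hlsc : LowerSemicontinuous h := by
      refine ((lscmul t (hG.lsc n)).add ?_).add (lscmul c hG.lsc_control)
      exact lowerSemicontinuous_indicator_of_isOpen hE.isOpen_compl (lscmul s (hG.lsc n))
    have hle : ∀ x ∈ K, t * g x + c * H x ≤ h x := fun x hx =>
      add_le_add_left ((mul_le_mul_right (hG.le_approx n x hx) _).trans le_self_add) _
    have hleE : ∀ x ∈ K, x ∉ E → g x ≤ h x := fun x hx hxE => by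
      have : h x = t * G n x + s * G n x + c * H x := by
        simp only [hh]
        rw [indicator_of_mem (show x ∈ Eᶜ from hxE)]
      rw [this, hts]
      exact (hG.le_approx n x hx).trans le_self_add
    have hch : ∀ x ∈ K, c ≤ h x := fun x hx => by
      refine le_trans ?_ (le_add_self.trans (hle x hx))
      exact (mul_one (c : ℝ≥0∞)).symm.le.trans (mul_le_mul_right (hG.one_le_control x hx) _)
    obtain ⟨v, hvU, hvC, hvm, hv⟩ := exists_value_function hK isOpen_ball hUK huK hm hlsc hc0 hch
      fun γ hγ h0 _ => increment_le_of_gap hgρ hρ gm Hm hKΩ hL hs hst hgap hosc hsδ hle hleE hγ h0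
    have mh : Measurable (K.piecewise h g) := hlsc.measurable.piecewise mK gm
    -- In the open ball of radius `r₁` the value function provides `h`. Off the closed ball of
    -- radius `r₀` one has `v = u`, and `g ≤ h` on the part in `K`, because `E ⊆ U`.
    have hwug : IsWeakUpperGradient μ p Ω v (K.piecewise h g) := by
      refine IsWeakUpperGradient.of_cover hp
        (V := fun b => cond b (ball x₀ r₁) ((closedBall x₀ r₀)ᶜ ∩ Ω)) (fun b => ?_) (fun x hx => ?_)
        fun b => ?_
      · cases b
        exacts [isClosed_closedBall.isOpen_compl.inter hΩ, isOpen_ball]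
      · rw [mem_iUnion]
        by_cases hx' : x ∈ closedBall x₀ r₀
        · exact ⟨true, closedBall_subset_ball hr hx'⟩
        · exact ⟨false, hx', hx⟩
      · cases b
        · have hug : IsWeakUpperGradient μ p ((closedBall x₀ r₀)ᶜ ∩ Ω) u (K.piecewise h g) :=
            hg.1.mono hp inter_subset_right (fun x hx => ?_) mh
          · exact hug.congr fun x hx => hvU x fun hx' => hx.1 (ball_subset_closedBall hx')
          · by_cases hxK : x ∈ K
            · rw [piecewise_eq_of_mem _ _ _ hxK]
              exact hleE x hxK fun hxE => hx.1 (ball_subset_closedBall (hEU hxE))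
            · rw [piecewise_eq_of_notMem _ _ _ hxK]
        · refine IsUpperGradient.isWeakUpperGradient hp ⟨mh, fun γ _ hγ => ?_⟩
          have hγK : γ.trace ⊆ K := hγ.trans ball_subset_closedBall
          refine (hv γ hγK).trans (γ.integral_mono hγK fun x hx => ?_)
          rw [piecewise_eq_of_mem _ _ _ hx]
    have hbound : ∀ x ∈ K, h x ≤ t * g x + s * Eᶜ.indicator g x + (c + (2⁻¹ : ℝ≥0∞) ^ n) * H x := by
      intro x hx
      have h1 := hG.approx_le n x hx
      by_cases hxE : x ∈ E
      · have e1 : h x = t * G n x + 0 + c * H x := by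
          simp only [hh]
          rw [indicator_of_notMem (show x ∉ Eᶜ from fun h => h hxE)]
        rw [e1, indicator_of_notMem (show x ∉ Eᶜ from fun h => h hxE), mul_zero, add_zero, add_zero]
        have ht1 : (t : ℝ≥0∞) ≤ 1 := by
          rw [← ENNReal.coe_one, ← hst, ENNReal.coe_le_coe]
          exact le_add_self
        calc t * G n x + c * H x
            ≤ t * (g x + (2⁻¹ : ℝ≥0∞) ^ n * H x) + c * H x :=
              add_le_add_left (mul_le_mul_right h1 _) _
          _ = t * g x + t * ((2⁻¹ : ℝ≥0∞) ^ n * H x) + c * H x := by rw [mul_add]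
          _ ≤ t * g x + 1 * ((2⁻¹ : ℝ≥0∞) ^ n * H x) + c * H x :=
              add_le_add_left (add_le_add_right (mul_le_mul_left ht1 _) _) _
          _ = _ := by ring
      · have e1 : h x = t * G n x + s * G n x + c * H x := by
          simp only [hh]
          rw [indicator_of_mem (show x ∈ Eᶜ from hxE)]
        rw [e1, indicator_of_mem (show x ∈ Eᶜ from hxE), hts, hts]
        calc G n x + c * H x ≤ g x + (2⁻¹ : ℝ≥0∞) ^ n * H x + c * H x := add_le_add_left h1 _
          _ = _ := by ring
    have hloc : LocLp μ p Ω (K.piecewise h g) := by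
      have l2 : LocLp μ p Ω fun x => (c + (2⁻¹ : ℝ≥0∞) ^ n) * H x := by
        refine locLp_of_lintegral_ne_top hΩ ?_
        simp only [ENNReal.mul_rpow_of_nonneg _ _ p0.le]
        have mn : Measurable fun x => H x ^ p := Hm.pow_const p
        rw [lintegral_const_mul _ mn]
        exact ENNReal.mul_ne_top (ENNReal.rpow_ne_top_of_nonneg p0.le (by finiteness)) hH
      refine (hg.2.1.add hp.le gm l2).mono p0.le fun x => ?_
      by_cases hxK : x ∈ K
      · rw [piecewise_eq_of_mem _ _ _ hxK]
        refine (hbound x hxK).trans (add_le_add_left ?_ _)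
        calc t * g x + s * Eᶜ.indicator g x ≤ t * g x + s * g x :=
              add_le_add_right (mul_le_mul_right (indicator_le_self _ _ _) _) _
          _ = g x := hts _
      · rw [piecewise_eq_of_notMem _ _ _ hxK]
        exact le_self_add
    have mEg : Measurable (Eᶜ.indicator g) := gm.indicator hE.measurableSet.compl
    have m1 : Measurable fun x => t * g x := gm.const_mul _
    have m2 : Measurable fun x => s * Eᶜ.indicator g x := mEg.const_mul _
    have m3 : Measurable fun x => (c + (2⁻¹ : ℝ≥0∞) ^ n) * H x := Hm.const_mul _
    calc (∫⁻ x in K, g x ^ p ∂μ) ^ (1 / p)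
        ≤ (∫⁻ x in K, K.piecewise h g x ^ p ∂μ) ^ (1 / p) :=
          hu.lintegral_le hp hb hd hP hΩ hg hr hKΩ hvm hvC hvU hwug hloc
      _ ≤ (∫⁻ x in K, (((fun x => t * g x) + fun x => s * Eᶜ.indicator g x) +
            fun x => (c + (2⁻¹ : ℝ≥0∞) ^ n) * H x) x ^ p ∂μ) ^ (1 / p) := by
          refine ENNReal.rpow_le_rpow (setLIntegral_mono' mK fun x hx => ?_) q0
          rw [piecewise_eq_of_mem _ _ _ hx]
          exact ENNReal.rpow_le_rpow (hbound x hx) p0.le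
      _ ≤ (∫⁻ x in K, (t * g x) ^ p ∂μ) ^ (1 / p) +
            (∫⁻ x in K, (s * Eᶜ.indicator g x) ^ p ∂μ) ^ (1 / p) +
            (∫⁻ x in K, ((c + (2⁻¹ : ℝ≥0∞) ^ n) * H x) ^ p ∂μ) ^ (1 / p) :=
          (ENNReal.lintegral_Lp_add_le (m1.add m2).aemeasurable m3.aemeasurable hp.le).trans
            (add_le_add_left
              (ENNReal.lintegral_Lp_add_le m1.aemeasurable m2.aemeasurable hp.le) _)
      _ = t * (∫⁻ x in K, g x ^ p ∂μ) ^ (1 / p) +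
            s * (∫⁻ x in K, (Eᶜ.indicator g x) ^ p ∂μ) ^ (1 / p) +
            (c + (2⁻¹ : ℝ≥0∞) ^ n) * (∫⁻ x in K, H x ^ p ∂μ) ^ (1 / p) := by
          rw [lintegral_rpow_const_mul p0 _ gm, lintegral_rpow_const_mul p0 _ mEg,
            lintegral_rpow_const_mul p0 _ Hm]
      _ ≤ _ := by
          refine add_le_add_right ((mul_le_mul_right hHK _).trans_eq ?_) _
          rw [add_mul, hc, mul_div_assoc]
  exact le_of_forall_le_convex_add hs hst hgK (ENNReal.rpow_ne_top_of_nonneg q0 hH) key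

/-- Almost every point of a small ball where the minimal weak upper gradient of a `p`-harmonic
function does not vanish lies on a gradient curve. -/
theorem IsPHarmonic.measure_ball_inter_eq_zero [ProperSpace X] (hp : 1 < p)
    (hb : BallsPosFinite μ) (hd : IsDoubling μ) (hP : SupportsPoincare μ p) {Ω : Set X}
    (hΩ : IsOpen Ω) {u : X → ℝ} (hu : IsPHarmonic μ p Ω u) {g : X → ℝ≥0∞}
    (hg : IsMinimalWeakUpperGradient μ p Ω u g) {x₀ : X} {r₀ r₁ : ℝ} (hr : r₀ < r₁)
    (hKΩ : closedBall x₀ r₁ ⊆ Ω) :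
    μ (ball x₀ r₀ ∩ {x | g x ≠ 0 ∧ ¬ ∃ γ, IsGradientCurve Ω u g γ ∧ x ∈ γ.trace}) = 0 := by
  have p0 : 0 < p := zero_lt_one.trans hp
  have := hb.isLocallyFiniteMeasure
  set K := closedBall x₀ r₁ with hKdef
  set U := ball x₀ r₀ with hUdef
  have hK : IsCompact K := isCompact_closedBall x₀ r₁
  have mK : MeasurableSet K := measurableSet_closedBall
  have hUK : U ⊆ K := ball_subset_closedBall.trans (closedBall_subset_closedBall hr.le)
  have huK : ContinuousOn u K := hu.1.mono hKΩ
  have gm : Measurable g := hg.1.1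
  have hgK : ∫⁻ x in K, g x ^ p ∂μ ≠ ∞ := (hg.2.1.lintegral_lt_top hK hKΩ).ne
  obtain ⟨-, ρ, mρ, iρ, hgρ⟩ := (isWeakUpperGradient_iff hp).1 hg.1
  obtain ⟨H, G, hG, hρ, hH⟩ := exists_lscApproximation hp hK gm hgK mρ iρ
  obtain ⟨M, hM⟩ := hK.exists_bound_of_continuousOn huK
  obtain ⟨m, C, hC0, hm⟩ : ∃ (m : ℝ) (C : ℝ≥0), 0 < C ∧ ∀ x ∈ K, m ≤ u x ∧ u x ≤ m + C := by
    refine ⟨-|M|, (2 * |M| + 1).toNNReal, Real.toNNReal_pos.2 (by positivity), fun x hx => ?_⟩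
    have h1 := abs_le.1 ((hM x hx).trans (le_abs_self M))
    rw [Real.coe_toNNReal _ (by positivity)]
    exact ⟨h1.1, by linarith [h1.2]⟩
  set T : Set X := ⋃ n : ℕ, gradientReach K U u g H (n + 1 : ℝ≥0) with hT
  have mT : MeasurableSet T :=
    MeasurableSet.iUnion fun n => (hG.isClosed_gradientReach hK isOpen_ball huK).measurableSet
  have hnull : ∀ E ⊆ U \ T, IsCompact E → ∫⁻ x in E, g x ^ p ∂μ = 0 := by
    intro E hET hE
    have hEU : E ⊆ U := fun x hx => (hET hx).1
    have mE : MeasurableSet E := hE.isClosed.measurableSet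
    have h1 : ∀ n : ℕ, (∫⁻ x in K, g x ^ p ∂μ) ^ (1 / p) ≤
        (∫⁻ x in K, (Eᶜ.indicator g x) ^ p ∂μ) ^ (1 / p) +
          (C / (n + 1 : ℝ≥0) : ℝ≥0) * (∫⁻ x, H x ^ p ∂μ) ^ (1 / p) := fun n =>
      hu.lintegral_le_of_disjoint_gradientReach hp hb hd hP hΩ hg hgρ hr hKΩ hG hρ hH hC0 hm
        (by positivity) hE.isClosed hEU
        (disjoint_left.2 fun x hx hx' => (hET hx).2 (mem_iUnion.2 ⟨n, hx'⟩))
    have hlim : Tendsto (fun n : ℕ => (∫⁻ x in K, (Eᶜ.indicator g x) ^ p ∂μ) ^ (1 / p) +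
        ((C / (n + 1 : ℝ≥0) : ℝ≥0) : ℝ≥0∞) * (∫⁻ x, H x ^ p ∂μ) ^ (1 / p)) atTop
        (𝓝 ((∫⁻ x in K, (Eᶜ.indicator g x) ^ p ∂μ) ^ (1 / p) +
          ((0 : ℝ≥0) : ℝ≥0∞) * (∫⁻ x, H x ^ p ∂μ) ^ (1 / p))) := by
      refine Tendsto.const_add _ (ENNReal.Tendsto.mul_const (ENNReal.tendsto_coe.2 ?_)
        (Or.inr (ENNReal.rpow_ne_top_of_nonneg (by positivity) hH)))
      have h := (tendsto_one_div_add_atTop_nhds_zero_nat (𝕜 := ℝ≥0)).const_mul C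
      simpa [div_eq_mul_inv] using h
    -- With `L = n + 1 → ∞` the control term disappears: deleting `g` on `E` does not lower the
    -- energy over `K`, which is finite.
    have h2 := ge_of_tendsto' hlim h1
    rw [ENNReal.coe_zero, zero_mul, add_zero, ENNReal.rpow_le_rpow_iff (by positivity)] at h2
    simp only [indicator_rpow p0] at h2
    rw [lintegral_indicator mE.compl, Measure.restrict_restrict mE.compl,
      ← lintegral_inter_add_sdiff (fun x => g x ^ p) K mE, inter_comm Eᶜ K, ← sdiff_eq,
      inter_eq_right.2 (hEU.trans hUK)] at h2
    have hfin : ∫⁻ x in K \ E, g x ^ p ∂μ ≠ ∞ :=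
      ne_top_of_le_ne_top hgK (lintegral_mono_set sdiff_subset)
    have h3 : ∫⁻ x in E, g x ^ p ∂μ + ∫⁻ x in K \ E, g x ^ p ∂μ ≤
        0 + ∫⁻ x in K \ E, g x ^ p ∂μ := by rwa [zero_add]
    exact le_zero_iff.1 ((ENNReal.add_le_add_iff_right hfin).1 h3)
  set A : Set X := (U \ T) ∩ {x | g x ≠ 0} with hA
  have mA : MeasurableSet A :=
    (measurableSet_ball.diff mT).inter (gm (measurableSet_singleton 0).compl)
  have hA0 : μ A = 0 := by
    by_contra hne
    have hAfin : μ A ≠ ∞ := ne_top_of_le_ne_top hK.measure_lt_top.ne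
      (measure_mono fun x hx => hUK hx.1.1)
    -- The gap requires a closed set, so `A` is tested from inside by compact sets.
    obtain ⟨E, hEA, hE, hEpos⟩ := mA.exists_lt_isCompact_of_ne_top hAfin (pos_iff_ne_zero.2 hne)
    have mE : MeasurableSet E := hE.isClosed.measurableSet
    have h1 := hnull E (fun x hx => (hEA hx).1) hE
    rw [setLIntegral_eq_zero_iff mE (gm.pow_const p)] at h1
    have h2 : ∀ᵐ x ∂μ, x ∉ E := h1.mono fun x hx hxE =>
      (hEA hxE).2 ((ENNReal.rpow_eq_zero_iff_of_pos p0).1 (hx hxE))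
    exact hEpos.ne' (measure_eq_zero_iff_ae_notMem.2 h2)
  refine measure_mono_null ?_ hA0
  rintro x ⟨hxU, hxg, hcon⟩
  refine ⟨⟨hxU, fun hxT => hcon ?_⟩, hxg⟩
  obtain ⟨n, hn⟩ := mem_iUnion.1 hxT
  exact hG.exists_isGradientCurve hK isOpen_ball huK hgρ hρ hKΩ hxU hn

end Comparison

end MetricPotential

theorem corollary1p2 {X : Type*} [MetricSpace X] [CompleteSpace X] [MeasurableSpace X]
    [BorelSpace X] (μ : Measure X) (p : ℝ) (hp : 1 < p)
    (hballs : MetricPotential.BallsPosFinite μ)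
    (hdoubling : MetricPotential.IsDoubling μ)
    (hpoincare : MetricPotential.SupportsPoincare μ p)
    (Ω : Set X) (hΩo : IsOpen Ω) (hΩc : IsConnected Ω)
    (u : X → ℝ) (hu : MetricPotential.IsPHarmonic μ p Ω u)
    (hnonconst : ∃ x ∈ Ω, ∃ y ∈ Ω, u x ≠ u y)
    (g : X → ℝ≥0∞) (hg : MetricPotential.IsMinimalWeakUpperGradient μ p Ω u g) :
    ∀ᵐ x ∂μ, x ∈ Ω → g x ≠ 0 →
      ∃ γ : MetricPotential.RectCurve X,
        MetricPotential.IsGradientCurve Ω u g γ ∧ x ∈ γ.trace := by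
  have := hdoubling.properSpace hballs
  have h : μ (Ω ∩ {x | g x ≠ 0 ∧ ¬ ∃ γ : MetricPotential.RectCurve X,
      MetricPotential.IsGradientCurve Ω u g γ ∧ x ∈ γ.trace}) = 0 := by
    -- In a second countable space it suffices that each point has a neighborhood, here a ball whose
    -- closed double lies in `Ω`, that meets the bad set in a null set.
    refine measure_null_of_locally_null _ fun x hx => ?_
    obtain ⟨r, hr, hrΩ⟩ := Metric.nhds_basis_closedBall.mem_iff.1 (hΩo.mem_nhds hx.1)
    refine ⟨ball x (r / 2) ∩ _, ?_, hu.measure_ball_inter_eq_zero hp hballs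
      hdoubling hpoincare hΩo hg (half_lt_self hr) hrΩ⟩
    exact Filter.inter_mem (mem_nhdsWithin_of_mem_nhds (ball_mem_nhds x (half_pos hr)))
      (mem_of_superset self_mem_nhdsWithin inter_subset_right)
  filter_upwards [measure_eq_zero_iff_ae_notMem.1 h] with x hx hxΩ hgx
  by_contra hcon
  exact hx ⟨hxΩ, hgx, hcon⟩
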